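/- Let $\rho>0$, let $\mathbb{S}^1_\rho=\mathbb{R}/2\pi\rho\mathbb{Z}$, and let $C(\mathbb{S}^1_\rho)=(0,\infty)\times\mathbb{S}^1_\rho$ be the flat cone with the metric $dr^2+r^2\,d\theta^2$ and the Riemannian measure $r\,dr\,d\theta$. Let $\Delta$ be the Friedrichs extension in $L^2(C(\mathbb{S}^1_\rho),r\,dr\,d\theta)$ of the positive Laplacian $-\partial_r^2-\frac1r\partial_r-\frac1{r^2}\partial_\theta^2$ on $C_c^\infty(C(\mathbb{S}^1_\rho))$, and let $e^{it\Delta}$, $t\in\mathbb{R}$, be the Schrödinger propagator: the strongly continuous one-parameter group of unitary operators on $L^2$ with infinitesimal generator $i\Delta$ (it exists and is unique). For $\nu\ge 0$ and $x>0$ let $$J_\nu(x)=\sum_{k=0}^\infty\frac{(-1)^k}{k!\,\Gamma(\nu+k+1)}\left(\frac x2\right)^{\nu+2k}$$ be the Bessel function of order $\nu$, and put $i^{a}=e^{i\pi a/2}$ for $a\ge0$. Then, for every $t>0$, the operator $e^{it\Delta}$ has, with respect to the measure $r\,dr\,d\theta$, the locally integrable Schwartz kernel $$K_{e^{it\Delta}}(r_1,\theta_1,r_2,\theta_2)=-\frac{\exp\left[\frac{r_1^2+r_2^2}{4it}\right]}{4\pi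 i\rho t}\left\{J_0\left(\frac{r_1r_2}{2t}\right)+2\sum_{j=1}^\infty i^{j/\rho}\,J_{j/\rho}\left(\frac{r_1r_2}{2t}\right)\cos\left[\frac j\rho(\theta_1-\theta_2)\right]\right\},$$ where the series converges absolutely for all $r_1,r_2>0$ and all $\theta_1,\theta_2\in\mathbb{S}^1_\rho$; that is, for all $\varphi,\psi\in C_c^\infty(C(\mathbb{S}^1_\rho))$, $$\int_{C(\mathbb{S}^1_\rho)}(e^{it\Delta}\varphi)(p)\,\psi(p)\,d\mu(p)=\iint_{C(\mathbb{S}^1_\rho)\times C(\mathbb{S}^1_\rho)} K_{e^{it\Delta}}(p,q)\,\psi(p)\,\varphi(q)\,d\mu(p)\,d\mu(q),\qquad d\mu=r\,dr\,d\theta .$$ For every $t>0$, the operator $e^{-it\Delta}$ has the complex conjugate Schwartz kernel $\overline{K_{e^{it\Delta}}}$. -/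

import Mathlib

open MeasureTheory Filter Topology
open scoped ContDiff ComplexConjugate

noncomputable section

namespace FlatCone

/-! ### Unbounded operators and the unitary groups they generate -/

section Hilbert

variable {H : Type*} [NormedAddCommGroup H] [InnerProductSpace ℂ H]

/-- The graph of the Friedrichs extension of a nonnegative symmetric operator with graph `A`.
It consists of those `(u, w)` in the graph of the adjoint of `A` for which `u` lies in the form
domain, i.e. `u` is the limit of some vectors `u₀, u₁, …` of the domain of `A` with
`⟪uₘ - uₙ, A (uₘ - uₙ)⟫ → 0` as `m, n → ∞`. -/
def friedrichs (A : Submodule ℂ (H × H)) : Set (H × H) :=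
  {p | p ∈ A.adjoint ∧
    ∃ f : ℕ → H × H, (∀ n, f n ∈ A) ∧
      Tendsto (fun n => (f n).1) atTop (𝓝 p.1) ∧
      Tendsto (fun k : ℕ × ℕ =>
        inner ℂ ((f k.1).1 - (f k.2).1) ((f k.1).2 - (f k.2).2)) atTop (𝓝 0)}

/-- `U` is the unitary group `t ↦ exp (i t A)`, where `A` is given by its graph: a strongly
continuous one-parameter group of unitary operators whose infinitesimal generator, with its
exact domain, is `i A`. -/
structure IsUnitaryGroupOf (U : ℝ → H ≃ₗᵢ[ℂ] H) (A : Set (H × H)) : Prop where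
  map_zero : ∀ u, U 0 u = u
  map_add : ∀ s t u, U (s + t) u = U s (U t u)
  continuous : ∀ u, Continuous fun t => U t u
  generator : ∀ u w, (u, w) ∈ A ↔ HasDerivAt (fun t => U t u) (Complex.I • w) 0

end Hilbert

/-! ### The cone over the circle of radius `ρ` -/

instance factCircumference (ρ : ℝ) [h : Fact (0 < ρ)] : Fact (0 < 2 * Real.pi * ρ) :=
  ⟨mul_pos Real.two_pi_pos h.out⟩

/-- Polar coordinates `(r, θ)`, with `θ` in the circle `ℝ / 2πρℤ`.  The cone itself is the open
subset `cone ρ` where `0 < r`. -/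
abbrev Polar (ρ : ℝ) : Type := ℝ × AddCircle (2 * Real.pi * ρ)

/-- The cone `(0, ∞) × (ℝ / 2πρℤ)`. -/
def cone (ρ : ℝ) : Set (Polar ρ) := {p | 0 < p.1}

/-- The Riemannian measure `r dr dθ` of the metric `dr² + r² dθ²` on the cone (no mass is given to
`r ≤ 0`). -/
def coneMeasure (ρ : ℝ) [Fact (0 < ρ)] : Measure (Polar ρ) :=
  ((volume.restrict (Set.Ioi (0 : ℝ))).withDensity fun r => ENNReal.ofReal r).prod volume

/-- The Hilbert space `L²` of the cone. -/
abbrev L2 (ρ : ℝ) [Fact (0 < ρ)] : Type := Lp ℂ 2 (coneMeasure ρ)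

/-- Smooth functions with compact support in the cone (extended by `0` to `r ≤ 0`). -/
structure IsTestFunction (ρ : ℝ) (φ : Polar ρ → ℂ) : Prop where
  smooth : ContDiff ℝ ∞ fun x : ℝ × ℝ => φ (x.1, (x.2 : AddCircle (2 * Real.pi * ρ)))
  compact : HasCompactSupport φ
  support : tsupport φ ⊆ cone ρ

/-- The positive Laplacian `-∂ᵣ² - r⁻¹ ∂ᵣ - r⁻² ∂_θ²`. -/
def laplacian (ρ : ℝ) (φ : Polar ρ → ℂ) (p : Polar ρ) : ℂ :=
  -iteratedDeriv 2 (fun r : ℝ => φ (r, p.2)) p.1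
    - 1 / (p.1 : ℂ) * deriv (fun r : ℝ => φ (r, p.2)) p.1
    - 1 / (p.1 : ℂ) ^ 2 *
      iteratedDeriv 2 (fun h : ℝ => φ (p.1, p.2 + (h : AddCircle (2 * Real.pi * ρ)))) 0

theorem IsTestFunction.contDiff_radial {ρ : ℝ} {φ : Polar ρ → ℂ} (h : IsTestFunction ρ φ)
    (θ : AddCircle (2 * Real.pi * ρ)) : ContDiff ℝ ∞ fun r : ℝ => φ (r, θ) := by
  induction θ using QuotientAddGroup.induction_on with
  | H z => exact h.smooth.comp (contDiff_id.prodMk contDiff_const)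

theorem IsTestFunction.contDiff_angular {ρ : ℝ} {φ : Polar ρ → ℂ} (h : IsTestFunction ρ φ)
    (p : Polar ρ) :
    ContDiff ℝ ∞ fun s : ℝ => φ (p.1, p.2 + (s : AddCircle (2 * Real.pi * ρ))) := by
  obtain ⟨r, θ⟩ := p
  induction θ using QuotientAddGroup.induction_on with
  | H z => exact h.smooth.comp (contDiff_const.prodMk (contDiff_const.add contDiff_id))

theorem IsTestFunction.zero (ρ : ℝ) : IsTestFunction ρ 0 where
  smooth := contDiff_const
  compact := HasCompactSupport.zero
  support := by simp [tsupport]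

theorem IsTestFunction.add {ρ : ℝ} {φ ψ : Polar ρ → ℂ} (hφ : IsTestFunction ρ φ)
    (hψ : IsTestFunction ρ ψ) : IsTestFunction ρ (φ + ψ) where
  smooth := hφ.smooth.add hψ.smooth
  compact := hφ.compact.add hψ.compact
  support := (tsupport_add φ ψ).trans (Set.union_subset hφ.support hψ.support)

theorem IsTestFunction.smul {ρ : ℝ} {φ : Polar ρ → ℂ} (hφ : IsTestFunction ρ φ) (c : ℂ) :
    IsTestFunction ρ (c • φ) where
  smooth := contDiff_const.smul hφ.smooth
  compact := hφ.compact.smul_left (f := fun _ => c)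
  support := (closure_mono (Function.support_const_smul_subset c φ)).trans hφ.support

theorem laplacian_zero (ρ : ℝ) : laplacian ρ 0 = 0 := by
  funext p
  simp [laplacian]

theorem laplacian_add {ρ : ℝ} {φ ψ : Polar ρ → ℂ} (hφ : IsTestFunction ρ φ)
    (hψ : IsTestFunction ρ ψ) : laplacian ρ (φ + ψ) = laplacian ρ φ + laplacian ρ ψ := by
  funext p
  have e1 := iteratedDeriv_fun_add (n := 2)
    (contDiff_infty.1 (hφ.contDiff_radial p.2) 2).contDiffAt
    (contDiff_infty.1 (hψ.contDiff_radial p.2) 2).contDiffAt (x := p.1)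
  have e2 := iteratedDeriv_fun_add (n := 2)
    (contDiff_infty.1 (hφ.contDiff_angular p) 2).contDiffAt
    (contDiff_infty.1 (hψ.contDiff_angular p) 2).contDiffAt (x := 0)
  have e3 := deriv_fun_add (x := p.1)
    ((hφ.contDiff_radial p.2).differentiable (by simp)).differentiableAt
    ((hψ.contDiff_radial p.2).differentiable (by simp)).differentiableAt
  simp only [laplacian, Pi.add_apply, e1, e2, e3]
  ring

theorem laplacian_smul {ρ : ℝ} (φ : Polar ρ → ℂ) (c : ℂ) :
    laplacian ρ (c • φ) = c • laplacian ρ φ := by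
  funext p
  simp only [laplacian, Pi.smul_apply, smul_eq_mul]
  have e1 : iteratedDeriv 2 (fun r : ℝ => c * φ (r, p.2)) p.1
      = c * iteratedDeriv 2 (fun r : ℝ => φ (r, p.2)) p.1 :=
    iteratedDeriv_fun_const_smul_field c _
  have e2 : iteratedDeriv 2
      (fun h : ℝ => c * φ (p.1, p.2 + (h : AddCircle (2 * Real.pi * ρ)))) 0
      = c * iteratedDeriv 2 (fun h : ℝ => φ (p.1, p.2 + (h : AddCircle (2 * Real.pi * ρ)))) 0 :=
    iteratedDeriv_fun_const_smul_field c _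
  have e3 : deriv (fun r : ℝ => c * φ (r, p.2)) p.1 = c * deriv (fun r : ℝ => φ (r, p.2)) p.1 :=
    deriv_const_mul_field c
  rw [e1, e2, e3]
  ring

/-- The graph of the positive Laplacian on the smooth functions with compact support in the cone,
as an operator in `L²`. -/
def minimalLaplacian (ρ : ℝ) [Fact (0 < ρ)] : Submodule ℂ (L2 ρ × L2 ρ) where
  carrier := {p | ∃ φ : Polar ρ → ℂ, IsTestFunction ρ φ ∧
    p.1 =ᵐ[coneMeasure ρ] φ ∧ p.2 =ᵐ[coneMeasure ρ] laplacian ρ φ}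
  zero_mem' := by
    refine ⟨0, IsTestFunction.zero ρ, Lp.coeFn_zero _ _ _, ?_⟩
    rw [laplacian_zero]
    exact Lp.coeFn_zero _ _ _
  add_mem' := by
    rintro p q ⟨φ, hφ, hp1, hp2⟩ ⟨ψ, hψ, hq1, hq2⟩
    refine ⟨φ + ψ, hφ.add hψ, (Lp.coeFn_add _ _).trans (hp1.add hq1), ?_⟩
    rw [laplacian_add hφ hψ]
    exact (Lp.coeFn_add _ _).trans (hp2.add hq2)
  smul_mem' := by
    rintro c p ⟨φ, hφ, hp1, hp2⟩
    refine ⟨c • φ, hφ.smul c, (Lp.coeFn_smul _ _).trans (hp1.const_smul c), ?_⟩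
    rw [laplacian_smul]
    exact (Lp.coeFn_smul _ _).trans (hp2.const_smul c)

/-- The Laplacian `Δ` of the cone: the Friedrichs extension of the positive Laplacian on the smooth
functions with compact support in the cone (as a graph). -/
def friedrichsLaplacian (ρ : ℝ) [Fact (0 < ρ)] : Set (L2 ρ × L2 ρ) :=
  friedrichs (minimalLaplacian ρ)

/-- The bounded operator `T` of `L²` has the Schwartz kernel `K`, with respect to the Riemannian
measure: `K` is locally integrable on the product of the cone with itself, and the pairing of
`T φ` with `ψ` is the pairing of `K` with `ψ ⊗ φ` for all test functions `φ`, `ψ`. -/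
def HasSchwartzKernel {ρ : ℝ} [Fact (0 < ρ)] (T : L2 ρ → L2 ρ) (K : Polar ρ → Polar ρ → ℂ) :
    Prop :=
  LocallyIntegrableOn (fun z : Polar ρ × Polar ρ => K z.1 z.2) (cone ρ ×ˢ cone ρ)
      ((coneMeasure ρ).prod (coneMeasure ρ)) ∧
    ∀ φ ψ : Polar ρ → ℂ, IsTestFunction ρ φ → IsTestFunction ρ ψ →
      ∀ u : L2 ρ, u =ᵐ[coneMeasure ρ] φ →
        ∫ p, T u p * ψ p ∂coneMeasure ρ =
          ∫ z : Polar ρ × Polar ρ, K z.1 z.2 * (ψ z.1 * φ z.2)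
            ∂(coneMeasure ρ).prod (coneMeasure ρ)

/-! ### The kernel -/

/-- The Bessel function `J_ν(x)`, for `0 < x` and `0 ≤ ν`. -/
def besselJ (ν x : ℝ) : ℝ :=
  ∑' k : ℕ, (-1) ^ k / ((k.factorial : ℝ) * Real.Gamma (ν + k + 1)) * (x / 2) ^ (ν + 2 * k)

theorem cos_periodic (ρ : ℝ) (j : ℕ) :
    Function.Periodic (fun η : ℝ => Real.cos (j / ρ * η)) (2 * Real.pi * ρ) := by
  intro η
  by_cases h : ρ = 0
  · simp [h]
  · have e : (j : ℝ) / ρ * (η + 2 * Real.pi * ρ) = j / ρ * η + j * (2 * Real.pi) := by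
      field_simp
    simp only [e, Real.cos_add_nat_mul_two_pi]

/-- The function `η ↦ cos (j η / ρ)` on the circle `ℝ / 2πρℤ`. -/
def circleCos (ρ : ℝ) (j : ℕ) : AddCircle (2 * Real.pi * ρ) → ℝ :=
  (cos_periodic ρ j).lift

/-- The term `i ^ (j/ρ) J_{j/ρ}(x) cos (j η / ρ)`. -/
def modeTerm (ρ x : ℝ) (η : AddCircle (2 * Real.pi * ρ)) (j : ℕ) : ℂ :=
  Complex.I ^ (((j / ρ : ℝ)) : ℂ) * (besselJ (j / ρ) x : ℂ) * (circleCos ρ j η : ℂ)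

/-- The Schrödinger kernel at time `t`. -/
def schrodingerKernel (ρ t : ℝ) (p q : Polar ρ) : ℂ :=
  -(Complex.exp (((p.1 : ℂ) ^ 2 + (q.1 : ℂ) ^ 2) / (4 * Complex.I * t))
      / (4 * Real.pi * Complex.I * ρ * t)) *
    ((besselJ 0 (p.1 * q.1 / (2 * t)) : ℂ) +
      2 * ∑' j : ℕ, modeTerm ρ (p.1 * q.1 / (2 * t)) (p.2 - q.2) (j + 1))

end FlatCone

end

noncomputable section

namespace FlatCone

/-! ### Self-adjoint graphs, the Friedrichs extension and unitary groups -/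

section Hilbert

universe u

variable {H : Type*} [NormedAddCommGroup H] [InnerProductSpace ℂ H]

/-! The propagator can be computed explicitly on the Gaussian packets `b ^ (-ν - 1) r ^ ν exp (-r² /
b) exp (i n θ / ρ)` with `ν = |n| / ρ` and `0 < Re b`. On them the positive Laplacian is `-4 ∂_b`,
so `exp (i t Δ)` has to be the translation `b ↦ b - 4 i t`. Two packets of the same frequency have
inner product a constant times `(conj b + c) ^ (-ν - 1)`, which this translation preserves, and
packets of different frequencies are orthogonal. The packets are total (`packet_total`): Fourier
series in `θ`, then Fourier transform in the variable `r²`. Hence the translation extends to a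
strongly continuous unitary group, and its generator is exactly `i` times the adjoint of the
Laplacian on the span of the packets (`exists_unitaryGroup`, `exists_packet_group`).

It remains to see that this adjoint is the Friedrichs extension. The choice of extension matters:
for `0 < ν < 1` the singular solution `r ^ (-ν)` is square integrable near the vertex too. By
`friedrichs_eq_adjoint` it suffices that test functions lie in the adjoint, which is Green's formula
(`minimalLaplacian_le`), and that they approximate the packets in the norm of the form. The second
point (`exists_approx_packetCore`) uses cutoffs in `log r`, whose form energy tends to zero even in
the borderline case `ν = 0`.

For the kernel, the bound `|J_ν(x)| ≤ 2 ^ (-ν) exp (2 x)` makes the series over the frequencies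
converge geometrically. Each mode annihilates the packets of other frequencies and, by Weber's
integral of `J_ν` against a Gaussian, sends the packet of parameter `b` to that of parameter `b - 4
i t` (`integral_schrodingerKernel_mul_gauss`). The kernel is symmetric, so for a test function `φ`
the functions `∫ K φ` and `U t φ` have the same integrals against every packet needed for totality,
and therefore coincide (`propagator_ae_eq`). The kernel of `U (-t)` follows because `U (-t)` is the
Hilbert space adjoint of `U t`. -/

theorem mem_adjoint_iff_inner {A : Submodule ℂ (H × H)} {p : H × H} :
    p ∈ A.adjoint ↔ ∀ a ∈ A, inner ℂ a.2 p.1 = inner ℂ a.1 p.2 := by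
  rw [Submodule.mem_adjoint_iff]
  exact ⟨fun h a ha => sub_eq_zero.1 (h a.1 a.2 ha), fun h a b hab => sub_eq_zero.2 (h (a, b) hab)⟩

/-- The adjoint of a graph is its orthogonal complement turned by `(x, y) ↦ (y, -x)`. Doing this
twice gives the double orthogonal complement, which is the closure. The product has to carry the
Hilbert norm of `WithLp 2` for this argument. -/
theorem mem_closure_of_mem_adjoint_adjoint [CompleteSpace H] {C : Submodule ℂ (H × H)} {p : H × H}
    (hp : p ∈ C.adjoint.adjoint) : p ∈ closure (C : Set (H × H)) := by
  let e : WithLp 2 (H × H) ≃L[ℂ] H × H := WithLp.prodContinuousLinearEquiv 2 ℂ H H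
  let D : Submodule ℂ (WithLp 2 (H × H)) := C.comap (e : WithLp 2 (H × H) →ₗ[ℂ] H × H)
  have key : e.symm p ∈ Dᗮᗮ := by
    rw [Submodule.mem_orthogonal]
    intro y hy
    have hy' : (y.snd, -y.fst) ∈ C.adjoint := by
      rw [mem_adjoint_iff_inner]
      intro a ha
      have h := (Submodule.mem_orthogonal _ _).1 hy (e.symm a) (by simpa [D] using ha)
      rw [WithLp.prod_inner_apply] at h
      have h' : inner ℂ a.1 y.fst + inner ℂ a.2 y.snd = 0 := h
      rw [inner_neg_right]
      linear_combination h'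
    have h := mem_adjoint_iff_inner.1 hp _ hy'
    rw [WithLp.prod_inner_apply]
    have h' : inner ℂ (-y.fst) p.1 = inner ℂ y.snd p.2 := h
    change inner ℂ y.fst p.1 + inner ℂ y.snd p.2 = 0
    rw [← h', inner_neg_left]
    ring
  rw [Submodule.orthogonal_orthogonal_eq_closure] at key
  have key' : e.symm p ∈ closure (D : Set (WithLp 2 (H × H))) := key
  have := image_closure_subset_closure_image e.continuous (Set.mem_image_of_mem e key')
  rw [e.apply_symm_apply] at this
  refine closure_mono ?_ this
  rintro _ ⟨x, hx, rfl⟩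
  exact hx

/-- The graph of a nonnegative symmetric operator `B` is a semi-inner product space for the form
`⟪u, B v⟫`. -/
theorem exists_formSpace {H : Type u} [NormedAddCommGroup H] [InnerProductSpace ℂ H]
    (B : Submodule ℂ (H × H)) (sym : ∀ x ∈ B, ∀ y ∈ B, (inner ℂ x.2 y.1 : ℂ) = inner ℂ x.1 y.2)
    (pos : ∀ x ∈ B, 0 ≤ (inner ℂ x.1 x.2 : ℂ).re) :
    ∃ (E : Type u) (_ : SeminormedAddCommGroup E) (_ : InnerProductSpace ℂ E)
      (j : E →ₗ[ℂ] H × H), (∀ x, j x ∈ B) ∧ (∀ p ∈ B, ∃ x, j x = p) ∧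
        ∀ x y, (inner ℂ x y : ℂ) = inner ℂ (j x).1 (j y).2 := by
  let core : PreInnerProductSpace.Core ℂ B :=
    { inner x y := inner ℂ (x : H × H).1 (y : H × H).2
      conj_inner_symm x y := by rw [inner_conj_symm, sym x x.2 y y.2]
      re_inner_nonneg x := pos x x.2
      add_left x y z := inner_add_left _ _ _
      smul_left x y r := inner_smul_left _ _ _ }
  exact ⟨B, InnerProductSpace.Core.toSeminormedAddCommGroup (c := core),
    InnerProductSpace.ofCore core, B.subtype, fun x => x.2, fun p hp => ⟨⟨p, hp⟩, rfl⟩,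
    fun _ _ => rfl⟩

/-- A criterion for the Friedrichs extension of `A` to be the closure of the essentially
self-adjoint operator `C`: the domain of `A` is dense in that of `C` for the norm of the form. -/
theorem friedrichs_eq_adjoint [CompleteSpace H] {A C : Submodule ℂ (H × H)}
    (symC : C ≤ C.adjoint) (clC : (C.adjoint : Set (H × H)) ⊆ closure C)
    (posC : ∀ c ∈ C, 0 ≤ (inner ℂ c.1 c.2 : ℂ).re) (hAC : A ≤ C.adjoint)
    (approx : ∀ c ∈ C, ∀ ε > 0, ∃ a ∈ A, ‖a.1 - c.1‖ < ε ∧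
      ‖(inner ℂ (a.1 - c.1) (a.2 - c.2) : ℂ)‖ < ε) :
    friedrichs A = C.adjoint := by
  set B := C.adjoint with hB
  -- The inclusion of `B` in the closure of `C` transfers symmetry, and then positivity, from `C` to
  -- `B`.
  have symB : ∀ x ∈ B, ∀ y ∈ B, (inner ℂ x.2 y.1 : ℂ) = inner ℂ x.1 y.2 := by
    intro x hx y hy
    refine closure_minimal (s := (C : Set (H × H)))
      (t := {x : H × H | (inner ℂ x.2 y.1 : ℂ) = inner ℂ x.1 y.2}) ?_ ?_ (clC hx)
    · intro c hc
      exact mem_adjoint_iff_inner.1 hy c hc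
    · exact isClosed_eq (by fun_prop) (by fun_prop)
  have posB : ∀ x ∈ B, 0 ≤ (inner ℂ x.1 x.2 : ℂ).re := by
    intro x hx
    refine closure_minimal (s := (C : Set (H × H)))
      (t := {x : H × H | 0 ≤ (inner ℂ x.1 x.2 : ℂ).re}) posC ?_ (clC hx)
    exact isClosed_le continuous_const (Complex.continuous_re.comp (by fun_prop))
  obtain ⟨E, _, _, j, hjB, hj, inner_def⟩ := exists_formSpace B symB posB
  have nsq : ∀ x : E, ‖x‖ ^ 2 = ‖(inner ℂ (j x).1 (j x).2 : ℂ)‖ := by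
    intro x
    rw [← inner_def, inner_self_eq_norm_sq_to_K (𝕜 := ℂ) x, norm_pow, RCLike.norm_ofReal,
      abs_norm]
  have small : ∀ {x : E} {ε : ℝ}, 0 < ε →
      ‖(inner ℂ (j x).1 (j x).2 : ℂ)‖ < ε ^ 2 → ‖x‖ < ε := by
    intro x ε hε h
    rw [← nsq] at h
    exact lt_of_pow_lt_pow_left₀ 2 hε.le h
  ext p
  constructor
  · rintro ⟨hpA, f, hfA, hf1, hf2⟩
    change p ∈ B
    rw [hB, mem_adjoint_iff_inner]
    intro c hc
    have hcB : c ∈ B := symC hc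
    choose F hF using fun n => hj _ (hAC (hfA n))
    have hF2 : Tendsto (fun k : ℕ × ℕ => ‖F k.1 - F k.2‖ ^ 2) atTop (𝓝 0) := by
      have := hf2.norm
      rw [norm_zero] at this
      refine this.congr fun k => ?_
      rw [nsq, map_sub, hF, hF]
      rfl
    -- Of the Cauchy property only the boundedness of a tail in the form norm is needed.
    obtain ⟨⟨N1, N2⟩, hN⟩ := (eventually_atTop.1 (hF2.eventually (gt_mem_nhds one_pos)))
    have bdd : ∃ M : ℝ, 0 < M ∧ ∀ n ≥ N1, ‖F n‖ ≤ M := by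
      refine ⟨‖F N2‖ + 1, by positivity, fun n hn => ?_⟩
      have h1 := hN (n, N2) ⟨hn, le_rfl⟩
      have h2 : ‖F n - F N2‖ < 1 := by
        have := norm_nonneg (F n - F N2)
        simp only at h1
        nlinarith
      calc ‖F n‖ = ‖F N2 + (F n - F N2)‖ := by rw [add_sub_cancel]
        _ ≤ ‖F N2‖ + ‖F n - F N2‖ := norm_add_le _ _
        _ ≤ _ := by gcongr
    obtain ⟨M, hM, hFM⟩ := bdd
    -- `⟪c, p⟫` is compared with `⟪a, p⟫`, for `a` in `A` close to `c`
    refine eq_of_forall_dist_le fun ε hε => ?_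
    -- The first entry makes `‖a.1 - c.1‖ * ‖p.2‖` at most `ε / 2`, with `+ 1` guarding against `p.2
    -- = 0`. The second makes the form distance from `a` to `c` less than `ε / 2 / M`.
    set δ := min (ε / 2 / (‖p.2‖ + 1)) ((ε / 2 / M) ^ 2) with hδ
    have hδ0 : 0 < δ := by positivity
    obtain ⟨a, haA, ha1, ha2⟩ := approx c hc δ hδ0
    obtain ⟨a', ha'⟩ := hj a (hAC haA)
    obtain ⟨c', hc'⟩ := hj c hcB
    have hac : ‖a' - c'‖ < ε / 2 / M := by
      refine small (by positivity) ?_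
      rw [map_sub, ha', hc']
      exact lt_of_lt_of_le ha2 (min_le_right _ _)
    -- Before the limit, the difference is the form pairing of `a - c` with `f n`, controlled by
    -- Cauchy–Schwarz for the form. The limit needs only convergence of `(f n).1` in `H`.
    have e1 : dist (inner ℂ c.2 p.1 : ℂ) (inner ℂ a.2 p.1) ≤ ε / 2 := by
      have l1 : Tendsto (fun n => dist (inner ℂ c.2 (f n).1 : ℂ) (inner ℂ a.2 (f n).1)) atTop
          (𝓝 (dist (inner ℂ c.2 p.1 : ℂ) (inner ℂ a.2 p.1))) :=
        ((tendsto_const_nhds.inner hf1)).dist (tendsto_const_nhds.inner hf1)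
      refine le_of_tendsto l1 (eventually_atTop.2 ⟨N1, fun n hn => ?_⟩)
      have : (inner ℂ c.2 (f n).1 : ℂ) - inner ℂ a.2 (f n).1 = - inner ℂ (a' - c') (F n) := by
        rw [inner_sub_left, inner_def, inner_def, hF, ha', hc', symB _ hcB _ (hAC (hfA n)),
          symB _ (hAC haA) _ (hAC (hfA n))]
        ring
      rw [dist_eq_norm, this, norm_neg]
      calc _ ≤ ‖a' - c'‖ * ‖F n‖ := norm_inner_le_norm _ _
        _ ≤ ε / 2 / M * M := by
          gcongr
          exact hFM n hn
        _ = ε / 2 := by field_simp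
    have e2 : dist (inner ℂ a.2 p.1 : ℂ) (inner ℂ c.1 p.2) ≤ ε / 2 := by
      rw [mem_adjoint_iff_inner.1 hpA a haA, dist_eq_norm, ← inner_sub_left]
      calc _ ≤ ‖a.1 - c.1‖ * ‖p.2‖ := norm_inner_le_norm _ _
        _ ≤ ε / 2 / (‖p.2‖ + 1) * (‖p.2‖ + 1) := by
          gcongr
          · exact ha1.le.trans (min_le_left _ _)
          · linarith
        _ = ε / 2 := by field_simp
    calc _ ≤ _ := dist_triangle _ (inner ℂ a.2 p.1 : ℂ) _
      _ ≤ ε / 2 + ε / 2 := add_le_add e1 e2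
      _ = ε := by ring
  · intro hp
    have hp : p ∈ B := hp
    refine ⟨mem_adjoint_iff_inner.2 fun a ha => symB a (hAC ha) p hp, ?_⟩
    obtain ⟨p', hp'⟩ := hj p hp
    have ex : ∀ ε > 0, ∃ a : E, j a ∈ A ∧ ‖(j a).1 - p.1‖ < ε ∧ ‖a - p'‖ < ε := by
      intro ε hε
      obtain ⟨c, hc, hcp⟩ := Metric.mem_closure_iff.1 (clC hp) (ε / 2) (by positivity)
      obtain ⟨a, ha, h1, h2⟩ := approx c hc (min (ε / 2) ((ε / 2) ^ 2)) (by positivity)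
      obtain ⟨a', rfl⟩ := hj a (hAC ha)
      obtain ⟨c', rfl⟩ := hj c (symC hc)
      rw [dist_eq_norm, ← norm_neg, neg_sub] at hcp
      have hc1 : ‖(j c').1 - p.1‖ < ε / 2 := lt_of_le_of_lt (norm_fst_le (j c' - p)) hcp
      have hc2 : ‖(j c').2 - p.2‖ < ε / 2 := lt_of_le_of_lt (norm_snd_le (j c' - p)) hcp
      refine ⟨a', ha, ?_, ?_⟩
      · calc ‖(j a').1 - p.1‖ = ‖((j a').1 - (j c').1) + ((j c').1 - p.1)‖ := by congr 1; abel
          _ ≤ _ := norm_add_le _ _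
          _ < ε / 2 + ε / 2 := add_lt_add (lt_of_lt_of_le h1 (min_le_left _ _)) hc1
          _ = ε := by ring
      · have e1 : ‖a' - c'‖ < ε / 2 := by
          refine small (by positivity) ?_
          rw [map_sub]
          exact lt_of_lt_of_le h2 (min_le_right _ _)
        -- The form is dominated by the graph norm, `⟪u, B u⟫ ≤ ‖u‖ ‖B u‖`, so closeness in the
        -- graph gives closeness in the form.
        have e2 : ‖c' - p'‖ < ε / 2 := by
          refine small (by positivity) ?_
          rw [map_sub, hp']
          calc _ ≤ ‖(j c').1 - p.1‖ * ‖(j c').2 - p.2‖ := norm_inner_le_norm _ _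
            _ < (ε / 2) * (ε / 2) := by gcongr
            _ = _ := by ring
        calc ‖a' - p'‖ = ‖(a' - c') + (c' - p')‖ := by congr 1; abel
          _ ≤ _ := norm_add_le _ _
          _ < ε / 2 + ε / 2 := add_lt_add e1 e2
          _ = ε := by ring
    choose f hfA hf1 hf2 using fun n : ℕ => ex (1 / ((n : ℝ) + 1)) (by positivity)
    refine ⟨fun n => j (f n), hfA, ?_, ?_⟩
    · rw [tendsto_iff_norm_sub_tendsto_zero]
      exact squeeze_zero (fun _ => norm_nonneg _) (fun n => (hf1 n).le)
        tendsto_one_div_add_atTop_nhds_zero_nat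
    · have l0 : Tendsto (fun n => ‖f n - p'‖) atTop (𝓝 0) :=
        squeeze_zero (fun _ => norm_nonneg _) (fun n => (hf2 n).le)
          tendsto_one_div_add_atTop_nhds_zero_nat
      rw [tendsto_zero_iff_norm_tendsto_zero]
      have l1 : Tendsto (fun k : ℕ × ℕ => (‖f k.1 - p'‖ + ‖f k.2 - p'‖) ^ 2) atTop (𝓝 0) := by
        rw [← prod_atTop_atTop_eq]
        simpa using ((l0.comp tendsto_fst).add (l0.comp tendsto_snd)).pow 2
      refine squeeze_zero (fun _ => norm_nonneg _) (fun k => ?_) l1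
      have : ‖f k.1 - f k.2‖ ^ 2 ≤ (‖f k.1 - p'‖ + ‖f k.2 - p'‖) ^ 2 := by
        gcongr
        calc ‖f k.1 - f k.2‖ = ‖(f k.1 - p') - (f k.2 - p')‖ := by congr 1; abel
          _ ≤ _ := norm_sub_le _ _
      rw [nsq, map_sub] at this
      exact this

/-- The unitary group generated by a given self-adjoint operator is unique. -/
theorem IsUnitaryGroupOf.unique {U V : ℝ → H ≃ₗᵢ[ℂ] H} {A : Set (H × H)}
    (hU : IsUnitaryGroupOf U A) (hV : IsUnitaryGroupOf V A)
    (hA : Dense (Prod.fst '' A)) : V = U := by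
  have deriv_at : ∀ {W : ℝ → H ≃ₗᵢ[ℂ] H}, IsUnitaryGroupOf W A → ∀ u w, (u, w) ∈ A → ∀ t,
      HasDerivAt (fun t => W t u) (W t (Complex.I • w)) t := by
    intro W hW u w huw t
    have h := (hW.generator u w).1 huw
    have h1 : HasDerivAt (fun s => W (s - t) u) (Complex.I • w) t := by
      have h' : HasDerivAt (fun t => W t u) (Complex.I • w) (t - t) := by rwa [sub_self]
      exact HasDerivAt.comp_sub_const t t h'
    have h2 := ((W t).toContinuousLinearEquiv.toContinuousLinearMap.restrictScalars
      ℝ).hasFDerivAt.comp_hasDerivAt t h1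
    refine h2.congr_of_eventuallyEq (Eventually.of_forall fun s => ?_)
    change W s u = W t (W (s - t) u)
    rw [← hW.map_add]
    congr 2
    ring
  funext t
  ext u
  have key : ∀ p ∈ A, V t p.1 = U t p.1 := by
    rintro ⟨u, w⟩ huw
    -- The group leaves the domain of its generator invariant and commutes with it.
    have stay : ∀ s, (U s u, U s w) ∈ A := by
      intro s
      rw [hU.generator]
      have h := deriv_at hU u w huw s
      have h' : HasDerivAt (fun t => U t u) (U s (Complex.I • w)) (0 + s) := by rwa [zero_add]
      have h1 := HasDerivAt.comp_add_const 0 s h'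
      rw [map_smul] at h1
      refine h1.congr_of_eventuallyEq (Eventually.of_forall fun t => ?_)
      exact (hU.map_add t s u).symm
    -- The path `s ↦ V (t - s) (U s u)` joins `V t u` to `U t u`; it is constant.
    have d1 : ∀ s, HasDerivAt (fun s => V (t - s) (U s u)) 0 s := by
      intro s
      have hVs := (hV.generator _ _).1 (stay s)
      rw [hasDerivAt_iff_tendsto_slope]
      -- The groups are only strongly continuous, so the product rule is done on slopes: `V (t - r)`
      -- is isometric and does not enlarge the error in the slope of `U`.
      have a1 : Tendsto (fun r => V (t - r) (slope (fun r => U r u) s r)) (𝓝[≠] s)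
          (𝓝 (V (t - s) (U s (Complex.I • w)))) := by
        have hs := hasDerivAt_iff_tendsto_slope.1 (deriv_at hU u w huw s)
        have hc : Tendsto (fun r => V (t - r) (U s (Complex.I • w))) (𝓝[≠] s)
            (𝓝 (V (t - s) (U s (Complex.I • w)))) :=
          (((hV.continuous _).comp (continuous_const.sub continuous_id)).tendsto s).mono_left
            nhdsWithin_le_nhds
        have h0 : Tendsto (fun r => V (t - r) (slope (fun r => U r u) s r - U s (Complex.I • w)))
            (𝓝[≠] s) (𝓝 0) := by
          rw [tendsto_zero_iff_norm_tendsto_zero]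
          simp_rw [LinearIsometryEquiv.norm_map]
          rw [← tendsto_iff_norm_sub_tendsto_zero]
          exact hs
        simpa using h0.add hc
      have a2 : Tendsto (slope (fun r => V (t - r) (U s u)) s) (𝓝[≠] s)
          (𝓝 (-V (t - s) (Complex.I • U s w))) := by
        rw [← hasDerivAt_iff_tendsto_slope]
        have := (deriv_at hV _ _ (stay s) (t - s)).scomp s
          ((hasDerivAt_id s).const_sub t)
        simpa [Function.comp_def] using this
      have := a1.add a2
      rw [map_smul, add_neg_cancel] at this
      refine this.congr fun r => ?_
      have hs : ∀ c : ℝ, ∀ x : H, V (t - r) (c • x) = c • V (t - r) x := fun c x =>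
        ((V (t - r)).toLinearEquiv.toLinearMap.restrictScalars ℝ).map_smul c x
      rw [slope_def_module, slope_def_module, slope_def_module, hs, map_sub, ← smul_add]
      congr 1
      abel
    have const := is_const_of_deriv_eq_zero (fun s => (d1 s).differentiableAt)
      (fun s => (d1 s).deriv) 0 t
    simpa [hU.map_zero, hV.map_zero] using const
  refine congrFun (Continuous.ext_on hA (V t).continuous (U t).continuous ?_) u
  rintro _ ⟨p, hp, rfl⟩
  exact key p hp

/-- A one-parameter group acting on a total family so that the Gram matrix is preserved extends to
a strongly continuous unitary group. -/
theorem exists_unitaryGroup [CompleteSpace H] {ι : Type*} (act : ℝ → ι → ι) (v w : ι → H)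
    (act_zero : ∀ i, act 0 i = i) (act_add : ∀ s t i, act (s + t) i = act s (act t i))
    (gram : ∀ t i j, (inner ℂ (v (act t i)) (v (act t j)) : ℂ) = inner ℂ (v i) (v j))
    (total : ∀ u, (∀ i, (inner ℂ (v i) u : ℂ) = 0) → u = 0)
    (hderiv : ∀ i, HasDerivAt (fun t => v (act t i)) (Complex.I • w i) 0) :
    ∃ U : ℝ → H ≃ₗᵢ[ℂ] H, (∀ t i, U t (v i) = v (act t i)) ∧
      IsUnitaryGroupOf U
        ((Submodule.span ℂ (Set.range fun i => (v i, w i))).adjoint : Set (H × H)) := by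
  set C := Submodule.span ℂ (Set.range fun i => (v i, w i)) with hC
  have eq_of_inner : ∀ {x y : H}, (∀ i, (inner ℂ (v i) x : ℂ) = inner ℂ (v i) y) → x = y := by
    intro x y h
    refine sub_eq_zero.1 (total _ fun i => ?_)
    rw [inner_sub_right, h, sub_self]
  -- Each `act t` is a bijection, with inverse `act (-t)`, so the family at time `t` is the original
  -- family reindexed.
  have dense0 : ∀ t, DenseRange (Finsupp.linearCombination ℂ fun i => v (act t i)) := by
    intro t
    have : (Submodule.span ℂ (Set.range fun i => v (act t i)))ᗮ = ⊥ := by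
      rw [Submodule.eq_bot_iff]
      intro x hx
      refine total x fun i => ?_
      have := (Submodule.mem_orthogonal _ _).1 hx (v (act t (act (-t) i)))
        (Submodule.subset_span ⟨_, rfl⟩)
      rwa [← act_add, add_neg_cancel, act_zero] at this
    rw [← Submodule.topologicalClosure_eq_top_iff, ← Finsupp.range_linearCombination] at this
    rw [DenseRange, ← LinearMap.coe_range]
    exact Submodule.dense_iff_topologicalClosure_eq_top.2 this
  have norm_eq : ∀ t (x : ι →₀ ℂ), ‖Finsupp.linearCombination ℂ (fun i => v (act t i)) x‖
      = ‖Finsupp.linearCombination ℂ (fun i => v (act 0 i)) x‖ := by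
    intro t x
    rw [← sq_eq_sq₀ (norm_nonneg _) (norm_nonneg _)]
    have : (inner ℂ (Finsupp.linearCombination ℂ (fun i => v (act t i)) x)
        (Finsupp.linearCombination ℂ (fun i => v (act t i)) x) : ℂ) =
        inner ℂ (Finsupp.linearCombination ℂ (fun i => v (act 0 i)) x)
        (Finsupp.linearCombination ℂ (fun i => v (act 0 i)) x) := by
      simp only [Finsupp.linearCombination_apply, Finsupp.sum_inner, Finsupp.inner_sum,
        inner_smul_left, inner_smul_right, gram]
    rw [inner_self_eq_norm_sq_to_K, inner_self_eq_norm_sq_to_K] at this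
    exact_mod_cast this
  -- Equality of Gram matrices makes `v i ↦ v (act t i)` a well-defined isometry on finite
  -- combinations, even when the vectors are linearly dependent.
  let U : ℝ → H ≃ₗᵢ[ℂ] H := fun t =>
    (LinearEquiv.refl ℂ (ι →₀ ℂ)).extendOfIsometry
      (Finsupp.linearCombination ℂ fun i => v (act 0 i))
      (Finsupp.linearCombination ℂ fun i => v (act t i)) (dense0 0) (dense0 t) (norm_eq t)
  have hU : ∀ t i, U t (v i) = v (act t i) := by
    intro t i
    have := LinearEquiv.extendOfIsometry_eq (f := LinearEquiv.refl ℂ (ι →₀ ℂ))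
      (Finsupp.linearCombination ℂ fun i => v (act 0 i))
      (Finsupp.linearCombination ℂ fun i => v (act t i)) (dense0 0) (dense0 t) (norm_eq t)
      (Finsupp.single i 1)
    rw [Finsupp.linearCombination_single, one_smul, act_zero, LinearEquiv.refl_apply,
      Finsupp.linearCombination_single, one_smul] at this
    exact this
  have ext_clm : ∀ {S T : H →L[ℂ] H}, (∀ i, S (v i) = T (v i)) → ∀ u, S u = T u := by
    intro S T h u
    have := (dense0 0).equalizer S.continuous T.continuous (by
      funext x
      simp [Finsupp.linearCombination_apply, Finsupp.sum, act_zero, h])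
    exact congrFun this u
  have map_add : ∀ s t u, U (s + t) u = U s (U t u) := by
    intro s t u
    refine ext_clm (S := ((U (s + t)).toContinuousLinearEquiv : H →L[ℂ] H))
      (T := ((U s).toContinuousLinearEquiv : H →L[ℂ] H).comp
        ((U t).toContinuousLinearEquiv : H →L[ℂ] H)) (fun i => ?_) u
    simp [hU, act_add]
  have map_zero : ∀ u, U 0 u = u := by
    intro u
    refine ext_clm (S := ((U 0).toContinuousLinearEquiv : H →L[ℂ] H))
      (T := ContinuousLinearMap.id ℂ H) (fun i => ?_) u
    simp [hU, act_zero]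
  have inner_move : ∀ t u x, (inner ℂ u (U t x) : ℂ) = inner ℂ (U (-t) u) x := by
    intro t u x
    rw [← (U (-t)).inner_map_map u (U t x), ← map_add, neg_add_cancel, map_zero]
  have cont0 : ∀ u, ContinuousAt (fun t => U t u) 0 := by
    intro u
    have hcl : ∀ x : ι →₀ ℂ,
        ContinuousAt (fun t => U t (Finsupp.linearCombination ℂ (fun i => v (act 0 i)) x)) 0 := by
      intro x
      simp only [Finsupp.linearCombination_apply, Finsupp.sum, act_zero, map_sum, map_smul, hU]
      refine tendsto_finsetSum _ fun i _ => ?_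
      exact ((hderiv i).continuousAt.const_smul (x i)).tendsto
    rw [Metric.continuousAt_iff']
    intro ε hε
    obtain ⟨x, hx⟩ := (dense0 0).exists_dist_lt u (ε := ε / 3) (by positivity)
    filter_upwards [Metric.continuousAt_iff'.1 (hcl x) (ε / 3) (by positivity)] with t ht
    set y := Finsupp.linearCombination ℂ (fun i => v (act 0 i)) x
    calc dist (U t u) (U 0 u)
        ≤ dist (U t u) (U t y) + dist (U t y) (U 0 y) + dist (U 0 y) (U 0 u) :=
          dist_triangle4 _ _ _ _
      _ < ε / 3 + ε / 3 + ε / 3 := by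
          rw [(U t).dist_map, (U 0).dist_map, dist_comm y u]
          gcongr
      _ = ε := by ring
  have cont : ∀ u, Continuous fun t => U t u := by
    intro u
    rw [continuous_iff_continuousAt]
    intro t
    have h1 : ContinuousAt (fun s => U t (U (s - t) u)) t := by
      refine (U t).continuous.continuousAt.comp ?_
      have : ContinuousAt (fun t => U t u) (t - t) := by rw [sub_self]; exact cont0 u
      exact this.comp (f := fun s => s - t) (by fun_prop)
    refine h1.congr (Eventually.of_forall fun s => ?_)
    change U t (U (s - t) u) = U s u
    rw [← map_add, add_sub_cancel]
  have hderiv' : ∀ i t, HasDerivAt (fun t => v (act t i)) (Complex.I • w (act t i)) t := by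
    intro i t
    have h' : HasDerivAt (fun s => v (act s (act t i))) (Complex.I • w (act t i)) (t - t) := by
      rw [sub_self]; exact hderiv _
    refine (HasDerivAt.comp_sub_const t t h').congr_of_eventuallyEq
      (Eventually.of_forall fun s => ?_)
    change v (act s i) = v (act (s - t) (act t i))
    rw [← act_add, sub_add_cancel]
  refine ⟨U, hU, map_zero, map_add, cont, fun u z => ?_⟩
  constructor
  · intro h
    have hadj : ∀ i, (inner ℂ (w i) u : ℂ) = inner ℂ (v i) z := fun i =>
      mem_adjoint_iff_inner.1 h (v i, w i) (Submodule.subset_span ⟨i, rfl⟩)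
    have hcz : Continuous fun t => Complex.I • U t z := (cont z).const_smul _
    -- An element of the adjoint is differentiable along the orbit only weakly at first, against
    -- each `v i`. Integrating and using totality gives an identity of vectors, from which the
    -- strong derivative is read off.
    have key : ∀ t, U t u = u + ∫ s in (0 : ℝ)..t, Complex.I • U s z := by
      intro t
      refine eq_of_inner fun i => ?_
      have hd : ∀ s, HasDerivAt (fun s => (inner ℂ (v i) (U s u) : ℂ))
          (inner ℂ (v i) (Complex.I • U s z)) s := by
        intro s
        have e : (fun s => (inner ℂ (v i) (U s u) : ℂ)) = fun s => inner ℂ (v (act (-s) i)) u := by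
          funext s
          rw [inner_move, hU]
        rw [e]
        have h1 := (hderiv' i (-s)).scomp s (hasDerivAt_neg s)
        have h2 := h1.inner ℂ (hasDerivAt_const s u)
        refine h2.congr_deriv ?_
        rw [inner_zero_right, zero_add, neg_smul, one_smul, inner_neg_left, inner_smul_left,
          hadj, ← hU, ← inner_move, inner_smul_right, Complex.conj_I]
        ring
      have hftc := intervalIntegral.integral_eq_sub_of_hasDerivAt (a := 0) (b := t)
        (fun s _ => hd s) (Continuous.intervalIntegrable (by fun_prop) _ _)
      have hin := ((innerSL ℂ (v i)).intervalIntegral_comp_comm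
        (hcz.intervalIntegrable (μ := volume) 0 t))
      simp only [innerSL_apply_apply] at hin
      rw [inner_add_right, ← hin, hftc, map_zero]
      ring
    have h3 : HasDerivAt (fun t => u + ∫ s in (0 : ℝ)..t, Complex.I • U s z)
        (Complex.I • U 0 z) 0 :=
      (intervalIntegral.integral_hasDerivAt_right (hcz.intervalIntegrable _ _)
        (hcz.stronglyMeasurableAtFilter _ _) hcz.continuousAt).const_add u
    rw [map_zero] at h3
    exact h3.congr_of_eventuallyEq (Eventually.of_forall key)
  · intro h
    have hadj : ∀ i, (inner ℂ (w i) u : ℂ) = inner ℂ (v i) z := by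
      intro i
      have h1 := (hderiv i).inner ℂ h
      -- Unitarity makes the pairing constant; its derivative at `0` is the relation defining the
      -- adjoint.
      have h2 : (fun t => (inner ℂ (v (act t i)) (U t u) : ℂ)) = fun _ => inner ℂ (v i) u := by
        funext t
        rw [← hU, LinearIsometryEquiv.inner_map_map]
      rw [h2] at h1
      have h3 := h1.unique (hasDerivAt_const (0 : ℝ) _)
      rw [inner_smul_right, inner_smul_left, act_zero, map_zero, Complex.conj_I] at h3
      have h4 : Complex.I * ((inner ℂ (v i) z : ℂ) - inner ℂ (w i) u) = 0 := by
        linear_combination h3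
      rcases mul_eq_zero.1 h4 with h5 | h5
      · exact absurd h5 Complex.I_ne_zero
      · exact (sub_eq_zero.1 h5).symm
    change (u, z) ∈ C.adjoint
    rw [mem_adjoint_iff_inner]
    intro a ha
    refine Submodule.span_induction (p := fun a _ => (inner ℂ a.2 u : ℂ) = inner ℂ a.1 z)
      ?_ ?_ ?_ ?_ ha
    · rintro _ ⟨i, rfl⟩
      exact hadj i
    · simp
    · intro x y _ _ hx hy
      rw [Prod.snd_add, Prod.fst_add, inner_add_left, inner_add_left, hx, hy]
    · intro c x _ hx
      rw [Prod.smul_snd, Prod.smul_fst, inner_smul_left, inner_smul_left, hx]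

end Hilbert

/-! ### Determining sets of test functions -/

section Determining

open scoped BoundedContinuousFunction

variable {X : Type*} [MeasurableSpace X] {μ : Measure X}

/-- Splitting a real integrable function into positive and negative parts turns it into a difference
of two finite measures, so uniqueness theorems for finite measures apply to functions. -/
theorem integral_withDensity_pos_sub_neg {f : X → ℝ} (hf : Integrable f μ) {g : X → ℂ}
    (hg : AEStronglyMeasurable g μ) {C : ℝ} (hC : ∀ x, ‖g x‖ ≤ C) :
    ∫ x, g x ∂(μ.withDensity fun x => ENNReal.ofReal (f x)) -
      ∫ x, g x ∂(μ.withDensity fun x => ENNReal.ofReal (-f x)) = ∫ x, (f x : ℂ) * g x ∂μ := by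
  have hp : Integrable (fun x => max (f x) 0 • g x) μ :=
    hf.pos_part.smul_bdd C hg (Eventually.of_forall hC)
  have hn : Integrable (fun x => max (-f x) 0 • g x) μ :=
    hf.neg_part.smul_bdd C hg (Eventually.of_forall hC)
  have hn' : AEMeasurable (fun x => ENNReal.ofReal (-f x)) μ := hf.neg.aemeasurable.ennreal_ofReal
  rw [integral_withDensity_eq_integral_toReal_smul₀ hf.aemeasurable.ennreal_ofReal (by simp),
    integral_withDensity_eq_integral_toReal_smul₀ hn' (by simp)]
  simp only [ENNReal.toReal_ofReal']
  rw [← integral_sub hp hn]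
  congr 1
  funext x
  rw [← sub_smul, Complex.real_smul]
  congr 2
  rcases le_total 0 (f x) with h | h
  · rw [max_eq_left h, max_eq_right (by linarith), sub_zero]
  · rw [max_eq_right h, max_eq_left (by linarith)]
    ring

theorem isFiniteMeasure_withDensity_of_integrable {f : X → ℝ} (hf : Integrable f μ) :
    IsFiniteMeasure (μ.withDensity fun x => ENNReal.ofReal (f x)) :=
  isFiniteMeasure_withDensity_ofReal hf.2

theorem ae_eq_zero_of_withDensity_eq {f : X → ℝ} (hf : Integrable f μ)
    (h : μ.withDensity (fun x => ENNReal.ofReal (f x)) =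
      μ.withDensity fun x => ENNReal.ofReal (-f x)) : f =ᵐ[μ] 0 := by
  have hfin : ∫⁻ x, ENNReal.ofReal (f x) ∂μ ≠ ⊤ := hf.lintegral_lt_top.ne
  have hn : AEMeasurable (fun x => ENNReal.ofReal (-f x)) μ := hf.neg.aemeasurable.ennreal_ofReal
  filter_upwards [(withDensity_eq_iff hf.aemeasurable.ennreal_ofReal hn hfin).1 h] with x hx
  rcases le_total 0 (f x) with h0 | h0
  · rw [ENNReal.ofReal_of_nonpos (p := -f x) (by linarith), ENNReal.ofReal_eq_zero] at hx
    exact le_antisymm hx h0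
  · rw [ENNReal.ofReal_of_nonpos (p := f x) h0, eq_comm, ENNReal.ofReal_eq_zero] at hx
    exact le_antisymm h0 (by simpa using hx)

/-- Vanishing against `conj g` is needed as well: conjugating it says that `conj f` is orthogonal to
`g`, and `Re f` is half of `f + conj f`. -/
theorem integral_re_mul_eq_zero {f g : X → ℂ} (hf : Integrable f μ)
    (hg : AEStronglyMeasurable g μ) {C : ℝ} (hC : ∀ x, ‖g x‖ ≤ C)
    (h1 : ∫ x, f x * g x ∂μ = 0) (h2 : ∫ x, f x * conj (g x) ∂μ = 0) :
    ∫ x, ((f x).re : ℂ) * g x ∂μ = 0 := by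
  have h3 : ∫ x, conj (f x) * g x ∂μ = 0 := by
    rw [← map_zero (starRingEnd ℂ), ← h2, ← integral_conj]
    simp
  have hf' : Integrable (fun x => conj (f x)) μ :=
    ⟨Complex.continuous_conj.comp_aestronglyMeasurable hf.1, by
      refine hf.2.congr' (Eventually.of_forall fun x => ?_)
      simp⟩
  have i1 : Integrable (fun x => f x * g x) μ := hf.mul_bdd (c := C) hg (Eventually.of_forall hC)
  have i2 : Integrable (fun x => conj (f x) * g x) μ :=
    hf'.mul_bdd (c := C) hg (Eventually.of_forall hC)
  have : ∀ x, ((f x).re : ℂ) * g x = (1 / 2 : ℂ) * (f x * g x + conj (f x) * g x) := by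
    intro x
    rw [← add_mul, Complex.add_conj]
    push_cast
    ring
  simp_rw [this]
  rw [integral_const_mul, integral_add i1 i2, h1, h3]
  simp

/-- The imaginary part of `f` is the real part of `-i f`, so a class of functions stable under this
multiplication need only be treated through real parts. -/
theorem ae_eq_zero_of_re {P : (X → ℂ) → Prop} {f : X → ℂ}
    (hre : ∀ f, P f → (fun x => (f x).re) =ᵐ[μ] 0) (hf : P f) (hf' : P fun x => -Complex.I * f x) :
    f =ᵐ[μ] 0 := by
  filter_upwards [hre f hf, hre _ hf'] with x h1 h2
  apply Complex.ext
  · exact h1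
  · simpa using h2

/-- An integrable function of a real variable all of whose Fourier coefficients with respect to an
injective phase vanish is zero. -/
theorem ae_eq_zero_of_integral_exp {μ : Measure ℝ} {T : ℝ → ℝ} (hT : MeasurableEmbedding T)
    {f : ℝ → ℂ} (hf : Integrable f μ)
    (h : ∀ y : ℝ, ∫ x, f x * Complex.exp (y * T x * Complex.I) ∂μ = 0) : f =ᵐ[μ] 0 := by
  refine ae_eq_zero_of_re (P := fun f => Integrable f μ ∧
    ∀ y : ℝ, ∫ x, f x * Complex.exp (y * T x * Complex.I) ∂μ = 0) ?_ ⟨hf, h⟩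
    ⟨hf.const_mul _, fun y => ?_⟩
  · rintro f ⟨hf, h⟩
    have hre : Integrable (fun x => (f x).re) μ := hf.re
    -- Pushed forward by `T`, the measures of the positive and negative parts have equal
    -- characteristic functions; injectivity of `T` brings the equality back.
    refine ae_eq_zero_of_withDensity_eq hre (hT.map_injective ?_)
    have := isFiniteMeasure_withDensity_of_integrable hre
    have := isFiniteMeasure_withDensity_of_integrable hre.neg
    refine Measure.ext_of_charFun (funext fun y => ?_)
    have hm : Measurable fun x => Complex.exp (y * T x * Complex.I) := by
      have := hT.measurable
      fun_prop
    rw [charFun_apply_real, charFun_apply_real, integral_map hT.measurable.aemeasurable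
      (by fun_prop), integral_map hT.measurable.aemeasurable (by fun_prop), ← sub_eq_zero]
    have hb : ∀ x, ‖Complex.exp (y * T x * Complex.I)‖ ≤ 1 := fun x => by
      rw [← Complex.ofReal_mul, Complex.norm_exp_ofReal_mul_I]
    rw [integral_withDensity_pos_sub_neg hre hm.aestronglyMeasurable hb]
    refine integral_re_mul_eq_zero hf hm.aestronglyMeasurable hb (h y) ?_
    rw [← h (-y)]
    congr 1
    funext x
    rw [← Complex.exp_conj]
    simp
  · simp_rw [mul_assoc (-Complex.I)]
    rw [integral_const_mul, h, mul_zero]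

/-- An integrable function on the circle all of whose Fourier coefficients vanish is zero. -/
theorem ae_eq_zero_of_integral_fourier {T : ℝ} [Fact (0 < T)] {f : AddCircle T → ℂ}
    (hf : Integrable f) (h : ∀ n : ℤ, ∫ x, f x * fourier n x = 0) : f =ᵐ[volume] 0 := by
  have bd : ∀ g : C(AddCircle T, ℂ), ∀ x, ‖g x‖ ≤ ‖g‖ := fun g x => g.norm_coe_le_norm x
  -- Trigonometric polynomials are uniformly dense in the continuous functions, and pairing with an
  -- integrable `f` is continuous for the uniform norm.
  have key : ∀ g : C(AddCircle T, ℂ), ∀ f : AddCircle T → ℂ, Integrable f →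
      (∀ n : ℤ, ∫ x, f x * fourier n x = 0) → ∫ x, f x * g x = 0 := by
    intro g f hf h
    have hint : ∀ g : C(AddCircle T, ℂ), Integrable fun x => f x * g x := fun g =>
      hf.mul_bdd (c := ‖g‖) g.continuous.aestronglyMeasurable (Eventually.of_forall (bd g))
    let L : C(AddCircle T, ℂ) →ₗ[ℂ] ℂ :=
      { toFun g := ∫ x, f x * g x
        map_add' g g' := by
          rw [← integral_add (hint g) (hint g')]
          simp [mul_add]
        map_smul' c g := by
          rw [RingHom.id_apply, smul_eq_mul, ← integral_const_mul]
          congr 1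
          funext x
          simp only [ContinuousMap.coe_smul, Pi.smul_apply, smul_eq_mul]
          ring }
    have hL : Continuous L := by
      refine (L.mkContinuous (∫ x, ‖f x‖) fun g => ?_).continuous
      calc ‖∫ x, f x * g x‖ ≤ ∫ x, ‖f x * g x‖ := norm_integral_le_integral_norm _
        _ ≤ ∫ x, ‖f x‖ * ‖g‖ := by
          refine integral_mono (hint g).norm (hf.norm.mul_const _) fun x => ?_
          simp only [norm_mul]
          exact mul_le_mul_of_nonneg_left (bd g x) (norm_nonneg _)
        _ = _ := integral_mul_const _ _
    have hs : (Submodule.span ℂ (Set.range <| @fourier T)) ≤ LinearMap.ker L := by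
      rw [Submodule.span_le]
      rintro _ ⟨n, rfl⟩
      exact h n
    have hcl : IsClosed (LinearMap.ker L : Set C(AddCircle T, ℂ)) :=
      isClosed_singleton.preimage hL
    have := Submodule.topologicalClosure_minimal _ hs hcl
    rw [span_fourier_closure_eq_top] at this
    exact this (Submodule.mem_top (x := g))
  refine ae_eq_zero_of_re (P := fun f : AddCircle T → ℂ => Integrable f ∧
    ∀ g : C(AddCircle T, ℂ), ∫ x, f x * g x = 0) ?_ ⟨hf, fun g => key g f hf h⟩
    ⟨hf.const_mul _, fun g => ?_⟩
  · rintro f ⟨hf, h⟩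
    have hre : Integrable fun x => (f x).re := hf.re
    refine ae_eq_zero_of_withDensity_eq hre ?_
    have := isFiniteMeasure_withDensity_of_integrable hre
    have := isFiniteMeasure_withDensity_of_integrable hre.neg
    refine ext_of_forall_integral_eq_of_IsFiniteMeasure fun g => ?_
    let g' : C(AddCircle T, ℂ) := ⟨fun x => (g x : ℂ), by fun_prop⟩
    have h1 := integral_withDensity_pos_sub_neg hre
      (g'.continuous.aestronglyMeasurable (μ := volume)) (bd g')
    rw [integral_re_mul_eq_zero hf g'.continuous.aestronglyMeasurable (bd g') (h g')] at h1
    · have h2 := sub_eq_zero.1 h1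
      simp only [g', ContinuousMap.coe_mk, integral_complex_ofReal] at h2
      exact_mod_cast h2
    · rw [← h g']
      simp [g']
  · simp_rw [mul_assoc (-Complex.I)]
    rw [integral_const_mul, key g f hf h, mul_zero]

theorem norm_fourier_apply {T : ℝ} (n : ℤ) (x : AddCircle T) : ‖fourier n x‖ = 1 :=
  Circle.norm_coe _

end Determining

/-! ### Integration in polar coordinates -/

section Polar

variable {ρ : ℝ} [Fact (0 < ρ)]

/-- The radial part `r dr` of the Riemannian measure. -/
def radialMeasure : Measure ℝ :=
  (volume.restrict (Set.Ioi (0 : ℝ))).withDensity fun r => ENNReal.ofReal r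

theorem coneMeasure_eq : coneMeasure ρ = radialMeasure.prod volume := rfl

instance : SigmaFinite radialMeasure := by
  unfold radialMeasure
  exact SigmaFinite.withDensity_of_ne_top (by simp)

instance : IsLocallyFiniteMeasure radialMeasure :=
  IsLocallyFiniteMeasure.withDensity_ofReal continuous_id

instance : IsLocallyFiniteMeasure (coneMeasure ρ) := by
  rw [coneMeasure_eq]
  infer_instance

instance : SigmaFinite (coneMeasure ρ) := by
  rw [coneMeasure_eq]
  infer_instance

theorem ae_radialMeasure_iff {p : ℝ → Prop} :
    (∀ᵐ r ∂radialMeasure, p r) ↔ ∀ᵐ r, 0 < r → p r := by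
  rw [radialMeasure, ae_withDensity_iff (by fun_prop),
    ae_restrict_iff' measurableSet_Ioi]
  refine eventually_congr (Eventually.of_forall fun r => ?_)
  simp only [Set.mem_Ioi, ne_eq, ENNReal.ofReal_eq_zero, not_le]
  tauto

theorem ae_radialMeasure_pos : ∀ᵐ r ∂radialMeasure, 0 < r :=
  ae_radialMeasure_iff.2 (Eventually.of_forall fun _ h => h)

theorem ae_cone : ∀ᵐ p ∂coneMeasure ρ, p ∈ cone ρ :=
  Measure.quasiMeasurePreserving_fst.ae ae_radialMeasure_pos

theorem integral_radialMeasure (f : ℝ → ℂ) :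
    ∫ r, f r ∂radialMeasure = ∫ r in Set.Ioi (0 : ℝ), (r : ℂ) * f r := by
  rw [radialMeasure, integral_withDensity_eq_integral_toReal_smul (by fun_prop) (by simp)]
  refine setIntegral_congr_fun measurableSet_Ioi fun r hr => ?_
  simp only [ENNReal.toReal_ofReal (le_of_lt hr), Complex.real_smul]

theorem integrable_radialMeasure_iff {E : Type*} [NormedAddCommGroup E] [NormedSpace ℝ E]
    {f : ℝ → E} :
    Integrable f radialMeasure ↔ IntegrableOn (fun r => r • f r) (Set.Ioi 0) := by
  rw [radialMeasure, integrable_withDensity_iff_integrable_smul' (by fun_prop) (by simp)]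
  refine integrableOn_congr_fun (fun r hr => ?_) measurableSet_Ioi
  simp only [ENNReal.toReal_ofReal (le_of_lt hr)]

/-- On `r > 0` this is the phase variable `r²`. The odd extension makes it injective on the whole
line, on which the radial measure is defined. -/
theorem isEmbedding_mul_abs : MeasurableEmbedding fun r : ℝ => r * |r| := by
  refine Continuous.measurableEmbedding (by fun_prop) ?_
  have : StrictMono fun r : ℝ => r * |r| := by
    intro a b hab
    simp only
    rcases abs_cases a with ⟨h1, h2⟩ | ⟨h1, h2⟩ <;> rcases abs_cases b with ⟨h3, h4⟩ | ⟨h3, h4⟩ <;>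
      rw [h1, h3] <;> nlinarith
  exact this.injective

/-- Gaussian wave packets are total. -/
theorem ae_eq_zero_of_integral_gaussian {w : Polar ρ → ℂ} {a : ℝ} {ν : ℤ → ℝ}
    (hw : ∀ n, Integrable (fun p => w p * ((p.1 ^ ν n * Real.exp (-a * p.1 ^ 2) : ℝ) : ℂ))
      (coneMeasure ρ))
    (h : ∀ n : ℤ, ∀ y : ℝ, ∫ p, w p * (((p.1 ^ ν n : ℝ) : ℂ) *
      Complex.exp (-(a + y * Complex.I) * p.1 ^ 2) * fourier n p.2) ∂coneMeasure ρ = 0) :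
    w =ᵐ[coneMeasure ρ] 0 := by
  have key : ∀ n : ℤ, ∀ᵐ r ∂radialMeasure, ∫ θ, w (r, θ) * fourier n θ = 0 := by
    intro n
    set W : Polar ρ → ℂ := fun p =>
      w p * ((p.1 ^ ν n * Real.exp (-a * p.1 ^ 2) : ℝ) : ℂ) * fourier n p.2 with hW
    have hWi : Integrable W (radialMeasure.prod volume) := by
      refine (hw n).mul_bdd (c := 1) ((map_continuous _).comp continuous_snd).aestronglyMeasurable
        (Eventually.of_forall fun p => (norm_fourier_apply n p.2).le)
    have h0 := ae_eq_zero_of_integral_exp isEmbedding_mul_abs hWi.integral_prod_left (fun y => by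
      -- The Gaussian of width `a + i y` carries the phase `exp (-i y r²)`, hence the sign.
      rw [← h n (-y), coneMeasure_eq, integral_prod]
      · refine integral_congr_ae ?_
        filter_upwards [ae_radialMeasure_pos] with r hr
        rw [← integral_mul_const]
        congr 1
        funext θ
        simp only [hW, abs_of_pos hr, neg_mul]
        have : Complex.exp (-((a + (-y : ℝ) * Complex.I) * r ^ 2)) =
            Complex.exp (-(a * r ^ 2)) * Complex.exp (y * (r * r : ℝ) * Complex.I) := by
          rw [← Complex.exp_add]
          congr 1
          push_cast
          ring
        rw [this]
        push_cast
        ring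
      · refine (hWi.mul_bdd (c := 1) (g := fun p => Complex.exp (y * (p.1 ^ 2 : ℝ) * Complex.I))
          (by fun_prop) (Eventually.of_forall fun p => ?_)).congr (Eventually.of_forall fun p => ?_)
        · rw [← Complex.ofReal_mul, Complex.norm_exp_ofReal_mul_I]
        · simp only [hW]
          have : Complex.exp (-(a + (-y : ℝ) * Complex.I) * p.1 ^ 2) =
              Complex.exp (-a * p.1 ^ 2) * Complex.exp (y * (p.1 ^ 2 : ℝ) * Complex.I) := by
            rw [← Complex.exp_add]
            congr 1
            push_cast
            ring
          rw [this]
          push_cast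
          ring)
    filter_upwards [h0, ae_radialMeasure_pos] with r h1 hr
    simp only [hW, Pi.zero_apply] at h1
    have e : ∀ θ, w (r, θ) * ((r ^ ν n * Real.exp (-a * r ^ 2) : ℝ) : ℂ) * fourier n θ =
        ((r ^ ν n * Real.exp (-a * r ^ 2) : ℝ) : ℂ) * (w (r, θ) * fourier n θ) := fun θ => by ring
    simp_rw [e] at h1
    rw [integral_const_mul] at h1
    refine (mul_eq_zero.1 h1).resolve_left ?_
    exact_mod_cast (mul_pos (Real.rpow_pos_of_pos hr _) (Real.exp_pos _)).ne'
  -- Measurability of `w` is recovered from one weighted version by dividing by the positive weight.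
  have hm : AEStronglyMeasurable w (coneMeasure ρ) := by
    refine ((hw 0).1.mul (g := fun p => (((p.1 ^ ν 0 * Real.exp (-a * p.1 ^ 2))⁻¹ : ℝ) : ℂ))
      (by fun_prop)).congr ?_
    filter_upwards [ae_cone] with p hp
    have hp : 0 < p.1 := hp
    have : ((p.1 ^ ν 0 * Real.exp (-a * p.1 ^ 2) : ℝ) : ℂ) ≠ 0 := by
      exact_mod_cast (mul_pos (Real.rpow_pos_of_pos hp _) (Real.exp_pos _)).ne'
    simp only [Pi.mul_apply]
    rw [Complex.ofReal_inv, mul_assoc, mul_inv_cancel₀ this, mul_one]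
  have hslice : ∀ᵐ r ∂radialMeasure, Integrable fun θ => w (r, θ) := by
    filter_upwards [(hw 0).prod_right_ae, ae_radialMeasure_pos] with r h1 hr
    have : ((r ^ ν 0 * Real.exp (-a * r ^ 2) : ℝ) : ℂ) ≠ 0 := by
      exact_mod_cast (mul_pos (Real.rpow_pos_of_pos hr _) (Real.exp_pos _)).ne'
    refine (h1.mul_const (((r ^ ν 0 * Real.exp (-a * r ^ 2) : ℝ) : ℂ)⁻¹)).congr
      (Eventually.of_forall fun θ => ?_)
    simp only
    rw [mul_assoc, mul_inv_cancel₀ this, mul_one]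
  have h2 : ∀ᵐ r ∂radialMeasure, (fun θ => w (r, θ)) =ᵐ[volume] 0 := by
    filter_upwards [ae_all_iff.2 key, hslice] with r h1 h2
    exact ae_eq_zero_of_integral_fourier h2 h1
  -- Passing from almost every slice to almost every point requires a measurable set, hence a
  -- measurable representative.
  obtain ⟨w', hw', hww⟩ := hm
  refine hww.trans ?_
  have h3 : ∀ᵐ r ∂radialMeasure, ∀ᵐ θ, w (r, θ) = w' (r, θ) := Measure.ae_ae_of_ae_prod hww
  refine (Measure.ae_prod_iff_ae_ae (μ := radialMeasure)
    (measurableSet_eq_fun hw'.measurable measurable_const)).2 ?_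
  filter_upwards [h2, h3] with r h4 h5
  filter_upwards [h4, h5] with θ h6 h7
  rw [← h7]
  exact h6

end Polar

/-! ### Gaussian integrals -/

/-- For real `c` this is the Gamma integral. The left side is the complex moment generating function
of `r²` under `r ^ s dr`, hence holomorphic for `0 < Re c`, and so is the right side with the
principal power. The identity theorem does the rest. -/
theorem integral_rpow_mul_cexp_neg_mul_sq {s : ℝ} (hs : -1 < s) {c : ℂ} (hc : 0 < c.re) :
    ∫ r in Set.Ioi (0 : ℝ), ((r ^ s : ℝ) : ℂ) * Complex.exp (-c * r ^ 2) =
      (Real.Gamma ((s + 1) / 2) / 2 : ℝ) * c ^ (-(((s + 1) / 2 : ℝ) : ℂ)) := by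
  set μ : Measure ℝ := (volume.restrict (Set.Ioi 0)).withDensity
    fun r => ENNReal.ofReal (r ^ s) with hμ
  have toReal : ∀ r ∈ Set.Ioi (0 : ℝ), (ENNReal.ofReal (r ^ s)).toReal = r ^ s := fun r hr =>
    ENNReal.toReal_ofReal (Real.rpow_nonneg (le_of_lt hr) _)
  have hmgf : ∀ c : ℂ, ProbabilityTheory.complexMGF (fun r => r ^ 2) μ (-c) =
      ∫ r in Set.Ioi (0 : ℝ), ((r ^ s : ℝ) : ℂ) * Complex.exp (-c * r ^ 2) := by
    intro c
    rw [ProbabilityTheory.complexMGF, hμ,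
      integral_withDensity_eq_integral_toReal_smul (by fun_prop) (by simp)]
    refine setIntegral_congr_fun measurableSet_Ioi fun r hr => ?_
    simp only [toReal r hr, Complex.real_smul]
    push_cast
    rfl
  have hset : ∀ c : ℂ, 0 < c.re →
      (-c).re ∈ interior (ProbabilityTheory.integrableExpSet (fun r : ℝ => r ^ 2) μ) := by
    intro c hc
    rw [mem_interior]
    refine ⟨Set.Iio 0, ?_, isOpen_Iio, by simpa using hc⟩
    intro x hx
    rw [ProbabilityTheory.integrableExpSet, Set.mem_ofPred_eq, hμ,
      integrable_withDensity_iff_integrable_smul' (by fun_prop) (by simp)]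
    refine ((integrableOn_rpow_mul_exp_neg_mul_sq (b := -x) (neg_pos.2 hx) hs)).congr_fun
      (fun r hr => ?_) measurableSet_Ioi
    simp only [toReal r hr, smul_eq_mul, neg_neg]
  have hU : IsPreconnected {c : ℂ | 0 < c.re} := (convex_halfSpace_re_gt 0).isPreconnected
  have hopen : IsOpen {c : ℂ | 0 < c.re} := isOpen_lt continuous_const Complex.continuous_re
  have an1 : AnalyticOnNhd ℂ (fun c => ProbabilityTheory.complexMGF (fun r : ℝ => r ^ 2) μ (-c))
      {c : ℂ | 0 < c.re} := by
    intro c hc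
    exact (ProbabilityTheory.analyticAt_complexMGF (hset c hc)).fun_comp analyticAt_id.neg
  have an2 : AnalyticOnNhd ℂ (fun c : ℂ => ((Real.Gamma ((s + 1) / 2) / 2 : ℝ) : ℂ) *
      c ^ (-(((s + 1) / 2 : ℝ) : ℂ))) {c : ℂ | 0 < c.re} := by
    intro c hc
    exact analyticAt_const.mul (analyticAt_id.cpow analyticAt_const (Or.inl hc))
  have heq : ∀ x : ℝ, 0 < x → ProbabilityTheory.complexMGF (fun r : ℝ => r ^ 2) μ (-(x : ℂ)) =
      ((Real.Gamma ((s + 1) / 2) / 2 : ℝ) : ℂ) * (x : ℂ) ^ (-(((s + 1) / 2 : ℝ) : ℂ)) := by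
    intro x hx
    rw [hmgf, ← Complex.ofReal_neg ((s + 1) / 2), ← Complex.ofReal_cpow hx.le]
    have h1 := integral_rpow_mul_exp_neg_mul_rpow (p := 2) two_pos hs hx
    have h2 : ∀ r : ℝ, ((r ^ s : ℝ) : ℂ) * Complex.exp (-x * r ^ 2) =
        ((r ^ s * Real.exp (-x * r ^ (2 : ℝ)) : ℝ) : ℂ) := by
      intro r
      rw [Real.rpow_two]
      push_cast
      rfl
    simp_rw [h2]
    rw [integral_complex_ofReal, h1]
    rw [← Complex.ofReal_mul]
    congr 1
    ring_nf
  rw [← hmgf]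
  refine an1.eqOn_of_preconnected_of_frequently_eq an2 hU (z₀ := 1) (by simp) ?_ hc
  -- Real points accumulating at `1` and distinct from it.
  have hlim : Tendsto (fun n : ℕ => ((1 + 1 / ((n : ℝ) + 1) : ℝ) : ℂ)) atTop (𝓝[≠] 1) := by
    refine tendsto_nhdsWithin_iff.2 ⟨?_, Eventually.of_forall fun n => ?_⟩
    · have : Tendsto (fun n : ℕ => (1 + 1 / ((n : ℝ) + 1) : ℝ)) atTop (𝓝 1) := by
        simpa using tendsto_one_div_add_atTop_nhds_zero_nat.const_add (1 : ℝ)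
      exact_mod_cast (Complex.continuous_ofReal.tendsto 1).comp this
    · have : (1 + 1 / ((n : ℝ) + 1) : ℝ) ≠ 1 := by
        have : (0 : ℝ) < 1 / ((n : ℝ) + 1) := by positivity
        linarith
      rw [Set.mem_compl_iff, Set.mem_singleton_iff]
      exact_mod_cast this
  refine hlim.frequently (Eventually.frequently (Eventually.of_forall fun n => ?_))
  exact heq _ (by positivity)

theorem integrableOn_rpow_mul_cexp_neg_mul_sq {s : ℝ} (hs : -1 < s) {c : ℂ} (hc : 0 < c.re) :
    IntegrableOn (fun r : ℝ => ((r ^ s : ℝ) : ℂ) * Complex.exp (-c * r ^ 2)) (Set.Ioi 0) := by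
  refine (integrableOn_rpow_mul_exp_neg_mul_sq hc hs).mono' (by fun_prop) ?_
  filter_upwards [ae_restrict_mem measurableSet_Ioi] with r hr
  rw [norm_mul, norm_cexp_neg_mul_sq, Complex.norm_real, Real.norm_of_nonneg
    (Real.rpow_nonneg (le_of_lt hr) _)]

/-! ### Gaussian wave packets -/

section Packets

variable (ρ : ℝ)

/-- The function `r ^ ν exp (-a r²) exp (i n θ / ρ)`. -/
def gauss (ν : ℝ) (n : ℤ) (a : ℂ) (p : Polar ρ) : ℂ :=
  ((p.1 ^ ν : ℝ) : ℂ) * Complex.exp (-a * p.1 ^ 2) * fourier n p.2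

variable {ρ}

theorem aestronglyMeasurable_gauss {ν : ℝ} {n : ℤ} {a : ℂ} {μ : Measure (Polar ρ)} :
    AEStronglyMeasurable (gauss ρ ν n a) μ := by
  unfold gauss
  have h : Measurable fun p : Polar ρ => fourier n p.2 :=
    (map_continuous (fourier n)).measurable.comp measurable_snd
  exact Measurable.aestronglyMeasurable (by fun_prop)

theorem norm_gauss {ν : ℝ} {n : ℤ} {a : ℂ} {p : Polar ρ} (hp : p ∈ cone ρ) :
    ‖gauss ρ ν n a p‖ = p.1 ^ ν * Real.exp (-a.re * p.1 ^ 2) := by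
  have hp : 0 < p.1 := hp
  rw [gauss, norm_mul, norm_mul, norm_fourier_apply, mul_one, norm_cexp_neg_mul_sq,
    Complex.norm_real, Real.norm_of_nonneg (Real.rpow_nonneg hp.le _)]

theorem gauss_mul_gauss {ν μ : ℝ} {n m : ℤ} {a b : ℂ} {p : Polar ρ} (hp : p ∈ cone ρ) :
    gauss ρ ν n a p * gauss ρ μ m b p = gauss ρ (ν + μ) (n + m) (a + b) p := by
  have hp : 0 < p.1 := hp
  rw [gauss, gauss, gauss, Real.rpow_add hp, fourier_add, neg_add, add_mul, Complex.exp_add]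
  push_cast
  ring

theorem conj_gauss {ν : ℝ} {n : ℤ} {a : ℂ} {p : Polar ρ} :
    conj (gauss ρ ν n a p) = gauss ρ ν (-n) (conj a) p := by
  rw [gauss, gauss, map_mul, map_mul, Complex.conj_ofReal, ← Complex.exp_conj, fourier_neg]
  simp

variable [Fact (0 < ρ)]

theorem integrable_gauss {ν : ℝ} (hν : -2 < ν) {n : ℤ} {a : ℂ} (ha : 0 < a.re) :
    Integrable (gauss ρ ν n a) (coneMeasure ρ) := by
  have h1 : Integrable (fun r : ℝ => ((r ^ ν : ℝ) : ℂ) * Complex.exp (-a * r ^ 2))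
      radialMeasure := by
    rw [integrable_radialMeasure_iff]
    refine (integrableOn_rpow_mul_cexp_neg_mul_sq (s := ν + 1) (by linarith) ha).congr_fun
      (fun r hr => ?_) measurableSet_Ioi
    simp only [Real.rpow_add_one (ne_of_gt hr), Complex.real_smul]
    push_cast
    ring
  have h2 : Integrable (fun θ : AddCircle (2 * Real.pi * ρ) => fourier n θ) :=
    (map_continuous (fourier n)).integrable_of_hasCompactSupport (HasCompactSupport.of_compactSpace _)
  exact h1.mul_prod h2

theorem integral_fourier (n : ℤ) :
    ∫ θ : AddCircle (2 * Real.pi * ρ), fourier n θ = if n = 0 then ((2 * Real.pi * ρ : ℝ) : ℂ) else 0 := by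
  split_ifs with h
  · subst h
    simp only [fourier_zero, integral_const, Measure.real, AddCircle.measure_univ]
    rw [ENNReal.toReal_ofReal (factCircumference ρ).out.le]
    simp
  · have h1 := (orthonormal_fourier (T := 2 * Real.pi * ρ)).2 (i := 0) (j := n) (Ne.symm h)
    simp only at h1
    rw [fourierLp, fourierLp, ContinuousMap.inner_toLp, AddCircle.integral_haarAddCircle] at h1
    have h2 := (smul_eq_zero.1 h1).resolve_left (inv_ne_zero (factCircumference ρ).out.ne')
    rw [← h2]
    congr 1
    funext θ
    rw [fourier_zero]
    simp

theorem integral_gauss {ν : ℝ} (hν : 0 ≤ ν) {n : ℤ} {a : ℂ} (ha : 0 < a.re) :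
    ∫ p, gauss ρ ν n a p ∂coneMeasure ρ = if n = 0 then
      ((2 * Real.pi * ρ * (Real.Gamma (ν / 2 + 1) / 2) : ℝ) : ℂ) * a ^ (-((ν / 2 + 1 : ℝ) : ℂ))
      else 0 := by
  have h := integral_prod_mul (μ := radialMeasure) (ν := volume)
    (fun r : ℝ => ((r ^ ν : ℝ) : ℂ) * Complex.exp (-a * r ^ 2))
    (fun θ : AddCircle (2 * Real.pi * ρ) => fourier n θ)
  rw [← coneMeasure_eq, integral_fourier] at h
  unfold gauss
  rw [h]
  split_ifs
  · rw [integral_radialMeasure]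
    have e : ∫ r in Set.Ioi (0 : ℝ), (r : ℂ) * (((r ^ ν : ℝ) : ℂ) * Complex.exp (-a * r ^ 2)) =
        ∫ r in Set.Ioi (0 : ℝ), ((r ^ (ν + 1) : ℝ) : ℂ) * Complex.exp (-a * r ^ 2) := by
      refine setIntegral_congr_fun measurableSet_Ioi fun r hr => ?_
      simp only [Real.rpow_add_one (ne_of_gt hr)]
      push_cast
      ring
    rw [e, integral_rpow_mul_cexp_neg_mul_sq (by linarith) ha]
    have : (ν + 1 + 1) / 2 = ν / 2 + 1 := by ring
    rw [this]
    push_cast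
    ring
  · rw [mul_zero]

theorem memLp_gauss {ν : ℝ} (hν : 0 ≤ ν) {n : ℤ} {a : ℂ} (ha : 0 < a.re) :
    MemLp (gauss ρ ν n a) 2 (coneMeasure ρ) := by
  rw [memLp_two_iff_integrable_sq_norm aestronglyMeasurable_gauss]
  refine (integrable_gauss (ρ := ρ) (ν := ν + ν) (n := n + -n) (a := a + conj a) (by linarith)
    (by simpa using ha)).norm.congr ?_
  filter_upwards [ae_cone] with p hp
  rw [← gauss_mul_gauss hp, ← conj_gauss, norm_mul, RCLike.norm_conj, sq]

open Classical in
/-- The wave packet `r ^ ν exp (-a r²) exp (i n θ / ρ)` as a vector of `L²`. -/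
def gaussL2 (ρ : ℝ) [Fact (0 < ρ)] (ν : ℝ) (n : ℤ) (a : ℂ) : L2 ρ :=
  if h : MemLp (gauss ρ ν n a) 2 (coneMeasure ρ) then h.toLp _ else 0

theorem coeFn_gaussL2 {ν : ℝ} (hν : 0 ≤ ν) {n : ℤ} {a : ℂ} (ha : 0 < a.re) :
    gaussL2 ρ ν n a =ᵐ[coneMeasure ρ] gauss ρ ν n a := by
  rw [gaussL2, dif_pos (memLp_gauss hν ha)]
  exact MemLp.coeFn_toLp _

theorem inner_gaussL2 {ν : ℝ} (hν : 0 ≤ ν) {n m : ℤ} {a b : ℂ} (ha : 0 < a.re) (hb : 0 < b.re) :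
    (inner ℂ (gaussL2 ρ ν n a) (gaussL2 ρ ν m b) : ℂ) = if n = m then
      ((2 * Real.pi * ρ * (Real.Gamma (ν + 1) / 2) : ℝ) : ℂ) * (conj a + b) ^ (-((ν + 1 : ℝ) : ℂ))
      else 0 := by
  rw [L2.inner_def]
  have : ∫ p, (inner ℂ (gaussL2 ρ ν n a p) (gaussL2 ρ ν m b p) : ℂ) ∂coneMeasure ρ =
      ∫ p, gauss ρ (ν + ν) (-n + m) (conj a + b) p ∂coneMeasure ρ := by
    refine integral_congr_ae ?_
    filter_upwards [coeFn_gaussL2 (ρ := ρ) hν (n := n) ha, coeFn_gaussL2 (ρ := ρ) hν (n := m) hb,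
      ae_cone] with p h1 h2 hp
    rw [h1, h2, ← gauss_mul_gauss hp, ← conj_gauss, RCLike.inner_apply, mul_comm]
  rw [this, integral_gauss (by linarith) (by simp; linarith)]
  have e : (ν + ν) / 2 + 1 = ν + 1 := by ring
  rw [e]
  refine if_congr ?_ rfl rfl
  omega

/-- The second-order Taylor remainder of `exp (-h r²)` is at most `(|h| r²)² exp (|h| r²)`. For `|h|
< Re a / 2` half of the Gaussian decay absorbs the exponential, leaving `|h|²` times a fixed packet
of index `ν + 4`. -/
theorem hasDerivAt_gaussL2 {ν : ℝ} (hν : 0 ≤ ν) (n : ℤ) {a : ℂ} (ha : 0 < a.re) :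
    HasDerivAt (gaussL2 ρ ν n) (-gaussL2 ρ (ν + 2) n a) a := by
  rw [hasDerivAt_iff_isLittleO_nhds_zero]
  refine (Asymptotics.IsBigO.of_bound ‖gaussL2 ρ (ν + 4) n ((a.re / 2 : ℝ) : ℂ)‖
    (g := fun h : ℂ => h ^ 2) ?_).trans_isLittleO (Asymptotics.isLittleO_pow_id one_lt_two)
  have hball : ∀ᶠ h : ℂ in 𝓝 0, ‖h‖ < a.re / 2 := by
    have := Metric.ball_mem_nhds (0 : ℂ) (half_pos ha)
    filter_upwards [this] with h hh
    simpa using hh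
  filter_upwards [hball] with h hh
  have hre : 0 < (a + h).re := by
    have := Complex.abs_re_le_norm h
    rw [abs_le] at this
    rw [Complex.add_re]
    linarith [this.1]
  have ha2 : 0 < ((a.re / 2 : ℝ) : ℂ).re := by
    rw [Complex.ofReal_re]; linarith
  rw [mul_comm ‖gaussL2 ρ (ν + 4) n _‖]
  refine Lp.norm_le_mul_norm_of_ae_le_mul ?_
  filter_upwards [Lp.coeFn_sub (gaussL2 ρ ν n (a + h) - gaussL2 ρ ν n a)
      (h • -gaussL2 ρ (ν + 2) n a), Lp.coeFn_sub (gaussL2 ρ ν n (a + h)) (gaussL2 ρ ν n a),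
    Lp.coeFn_smul h (-gaussL2 ρ (ν + 2) n a), Lp.coeFn_neg (gaussL2 ρ (ν + 2) n a),
    coeFn_gaussL2 (ρ := ρ) hν (n := n) hre, coeFn_gaussL2 (ρ := ρ) hν (n := n) ha,
    coeFn_gaussL2 (ρ := ρ) (ν := ν + 2) (by linarith) (n := n) ha,
    coeFn_gaussL2 (ρ := ρ) (ν := ν + 4) (by linarith) (n := n) ha2,
    ae_cone] with p e1 e2 e3 e4 e5 e6 e7 e8 hp
  rw [e1, Pi.sub_apply, e2, Pi.sub_apply, e3, Pi.smul_apply, e4, Pi.neg_apply, e5, e6, e7, e8,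
    norm_gauss hp]
  have hp' : 0 < p.1 := hp
  have f1 : gauss ρ ν n (a + h) p - gauss ρ ν n a p - h • -gauss ρ (ν + 2) n a p =
      gauss ρ ν n a p * (Complex.exp (-h * p.1 ^ 2) - (1 + -h * p.1 ^ 2)) := by
    simp only [gauss, Real.rpow_add hp', Real.rpow_two, neg_add, add_mul, Complex.exp_add,
      smul_eq_mul]
    push_cast
    ring
  have f2 := Complex.norm_exp_sub_sum_le_norm_mul_exp (-h * p.1 ^ 2) 2
  rw [Finset.sum_range_succ, Finset.sum_range_one] at f2
  simp only [pow_zero, Nat.factorial_zero, Nat.cast_one, div_one, pow_one, Nat.factorial_one,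
    norm_mul, norm_neg, norm_pow, Complex.norm_real, Real.norm_of_nonneg hp'.le] at f2
  rw [f1, norm_mul, norm_gauss hp]
  calc p.1 ^ ν * Real.exp (-a.re * p.1 ^ 2) * ‖Complex.exp (-h * p.1 ^ 2) - (1 + -h * p.1 ^ 2)‖
      ≤ p.1 ^ ν * Real.exp (-a.re * p.1 ^ 2) *
        ((‖h‖ * p.1 ^ 2) ^ 2 * Real.exp (‖h‖ * p.1 ^ 2)) := by gcongr
    _ ≤ p.1 ^ ν * Real.exp (-a.re * p.1 ^ 2) *
        ((‖h‖ * p.1 ^ 2) ^ 2 * Real.exp (a.re / 2 * p.1 ^ 2)) := by gcongr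
    _ = ‖h ^ 2‖ * (p.1 ^ (ν + 4) * Real.exp (-((a.re / 2 : ℝ) : ℂ).re * p.1 ^ 2)) := by
      rw [Real.rpow_add hp', Complex.ofReal_re, norm_pow]
      have : Real.exp (-(a.re / 2) * p.1 ^ 2) =
          Real.exp (-a.re * p.1 ^ 2) * Real.exp (a.re / 2 * p.1 ^ 2) := by
        rw [← Real.exp_add]
        congr 1
        ring
      rw [this]
      have : p.1 ^ (4 : ℝ) = p.1 ^ 4 := by
        exact_mod_cast Real.rpow_natCast p.1 4
      rw [this]
      ring

/-! ### Packets as functions of the complex width -/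

/-- The packet `b ^ (-ν - 1) r ^ ν exp (-r² / b) exp (i n θ / ρ)`, on which the Schrödinger
evolution acts by translations of `b`. -/
def packet (ρ : ℝ) [Fact (0 < ρ)] (ν : ℝ) (n : ℤ) (b : ℂ) : L2 ρ :=
  b ^ (-((ν + 1 : ℝ) : ℂ)) • gaussL2 ρ ν n b⁻¹

/-- The Laplacian of `packet ρ ν n b`, for `ν = |n| / ρ`. -/
def packetLaplacian (ρ : ℝ) [Fact (0 < ρ)] (ν : ℝ) (n : ℤ) (b : ℂ) : L2 ρ :=
  b ^ (-((ν + 1 : ℝ) : ℂ)) •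
    ((4 * (ν + 1) / b) • gaussL2 ρ ν n b⁻¹ - (4 / b ^ 2) • gaussL2 ρ (ν + 2) n b⁻¹)

theorem inv_re_pos {b : ℂ} (hb : 0 < b.re) : 0 < (b⁻¹).re := by
  rw [Complex.inv_re]
  exact div_pos hb (Complex.normSq_pos.2 (by rintro rfl; simp at hb))

theorem ne_zero_of_re_pos {b : ℂ} (hb : 0 < b.re) : b ≠ 0 := by
  rintro rfl
  simp at hb

/-- The power `b ^ (-ν - 1)` is chosen so that the Laplacian becomes `-4 ∂_b`; moving `b` with
velocity `-4 i` then solves the Schrödinger equation. -/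
theorem hasDerivAt_packet {ν : ℝ} (hν : 0 ≤ ν) (n : ℤ) {b : ℂ} (hb : 0 < b.re) :
    HasDerivAt (packet ρ ν n) ((-1 / 4 : ℂ) • packetLaplacian ρ ν n b) b := by
  have hb0 := ne_zero_of_re_pos hb
  have h1 := (hasDerivAt_gaussL2 (ρ := ρ) hν n (inv_re_pos hb)).scomp b (hasDerivAt_inv hb0)
  have h2 := (hasDerivAt_id b).cpow_const (c := -((ν + 1 : ℝ) : ℂ)) (Or.inl hb)
  refine (h2.smul h1).congr_deriv ?_
  simp only [packetLaplacian, Complex.cpow_sub _ _ hb0, Complex.cpow_one, id_eq, Function.comp_apply]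
  simp only [smul_sub, smul_neg, smul_smul, mul_one]
  rw [add_comm, sub_eq_add_neg]
  congr 1
  · congr 1
    push_cast
    field_simp
  · rw [← neg_smul, ← neg_smul]
    congr 1
    field_simp
    try norm_num

theorem log_mul_of_re_pos {x y : ℂ} (hx : 0 < x.re) (hy : 0 < y.re) :
    Complex.log (x * y) = Complex.log x + Complex.log y := by
  rw [Complex.log_mul_eq_add_log_iff (ne_zero_of_re_pos hx) (ne_zero_of_re_pos hy)]
  have h1 := abs_lt.1 (Complex.abs_arg_lt_pi_div_two_iff.2 (Or.inl hx))
  have h2 := abs_lt.1 (Complex.abs_arg_lt_pi_div_two_iff.2 (Or.inl hy))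
  constructor <;> linarith [h1.1, h1.2, h2.1, h2.2]

/-- All the numbers lie in the right half-plane, where principal logarithms of products of two add
up. Factoring `(x⁻¹ + y⁻¹) y = (x + y) x⁻¹` in both ways gives the identity. -/
theorem cpow_mul_cpow_mul_inv_add_inv {x y : ℂ} (hx : 0 < x.re) (hy : 0 < y.re) (s : ℂ) :
    x ^ s * y ^ s * (x⁻¹ + y⁻¹) ^ s = (x + y) ^ s := by
  have hx' := inv_re_pos hx
  have hy' := inv_re_pos hy
  have hs : 0 < (x + y).re := by rw [Complex.add_re]; linarith
  have hs' : 0 < (x⁻¹ + y⁻¹).re := by rw [Complex.add_re]; linarith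
  have hx0 := ne_zero_of_re_pos hx
  have hy0 := ne_zero_of_re_pos hy
  have h1 := log_mul_of_re_pos hs' hy
  have h2 := log_mul_of_re_pos hs hx'
  have e : (x⁻¹ + y⁻¹) * y = (x + y) * x⁻¹ := by
    field_simp
    ring
  have h3 := log_mul_of_re_pos hx hx'
  rw [mul_inv_cancel₀ hx0, Complex.log_one] at h3
  rw [e] at h1
  rw [Complex.cpow_def_of_ne_zero hx0, Complex.cpow_def_of_ne_zero hy0,
    Complex.cpow_def_of_ne_zero (ne_zero_of_re_pos hs),
    Complex.cpow_def_of_ne_zero (ne_zero_of_re_pos hs'), ← Complex.exp_add, ← Complex.exp_add]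
  congr 1
  linear_combination s * (h2 - h1 - h3)

/-- The normalisation of the packets leaves a function of `conj b + c` alone, which does not change
when `b` and `c` both move by `-4 i t`. This is the unitarity of the evolution. -/
theorem inner_packet {ν : ℝ} (hν : 0 ≤ ν) {n m : ℤ} {b c : ℂ} (hb : 0 < b.re) (hc : 0 < c.re) :
    (inner ℂ (packet ρ ν n b) (packet ρ ν m c) : ℂ) = if n = m then
      ((2 * Real.pi * ρ * (Real.Gamma (ν + 1) / 2) : ℝ) : ℂ) * (conj b + c) ^ (-((ν + 1 : ℝ) : ℂ))
      else 0 := by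
  rw [packet, packet, inner_smul_left, inner_smul_right, inner_gaussL2 hν (inv_re_pos hb)
    (inv_re_pos hc)]
  split_ifs
  · have hb' : 0 < (conj b).re := by simpa using hb
    have h := Complex.cpow_conj b (-((ν + 1 : ℝ) : ℂ)) (Complex.slitPlane_arg_ne_pi (Or.inl hb))
    rw [map_neg, Complex.conj_ofReal] at h
    rw [← cpow_mul_cpow_mul_inv_add_inv hb' hc, map_inv₀, h, Complex.conj_conj]
    ring
  · ring

theorem hasDerivAt_packet_sub {ν : ℝ} (hν : 0 ≤ ν) (n : ℤ) {b : ℂ} (hb : 0 < b.re) :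
    HasDerivAt (fun t : ℝ => packet ρ ν n (b - 4 * Complex.I * t))
      (Complex.I • packetLaplacian ρ ν n b) 0 := by
  have h0 : b - 4 * Complex.I * ((0 : ℝ) : ℂ) = b := by simp
  have h1 : HasDerivAt (fun t : ℝ => b - 4 * Complex.I * t) (-(4 * Complex.I)) 0 := by
    simpa using ((Complex.ofRealCLM.hasDerivAt (x := (0 : ℝ))).const_mul (4 * Complex.I)).const_sub b
  have h2 : HasDerivAt (packet ρ ν n) ((-1 / 4 : ℂ) • packetLaplacian ρ ν n b)
      (b - 4 * Complex.I * ((0 : ℝ) : ℂ)) := by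
    rw [h0]
    exact hasDerivAt_packet hν n hb
  refine (h2.scomp (0 : ℝ) h1).congr_deriv ?_
  rw [smul_smul]
  congr 1
  ring

/-- Differentiating the Gram matrix along the flow of `c` lowers its exponent by one; `Γ(ν + 2) = (ν
+ 1) Γ(ν + 1)` identifies the result with the Gram matrix of index `ν + 1`. The matrix of the
Laplacian is thus hermitian and positive. -/
theorem inner_packet_packetLaplacian {ν : ℝ} (hν : 0 ≤ ν) {n m : ℤ} {b c : ℂ} (hb : 0 < b.re)
    (hc : 0 < c.re) : (inner ℂ (packet ρ ν n b) (packetLaplacian ρ ν m c) : ℂ) =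
      4 * inner ℂ (packet ρ (ν + 1) n b) (packet ρ (ν + 1) m c) := by
  set K : ℂ := ((2 * Real.pi * ρ * (Real.Gamma (ν + 1) / 2) : ℝ) : ℂ) with hK
  set z : ℂ := conj b + c with hz
  have hz0 : 0 < z.re := by
    rw [hz, Complex.add_re, Complex.conj_re]
    linarith
  have h1 := (hasDerivAt_const (0 : ℝ) (packet ρ ν n b)).inner ℂ
    (hasDerivAt_packet_sub (ρ := ρ) hν m hc)
  have e : (fun t : ℝ => (inner ℂ (packet ρ ν n b) (packet ρ ν m (c - 4 * Complex.I * t)) : ℂ)) =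
      fun t : ℝ => if n = m then K * (z - 4 * Complex.I * t) ^ (-((ν + 1 : ℝ) : ℂ)) else 0 := by
    funext t
    rw [inner_packet hν hb (by simpa using hc)]
    congr 3
    rw [hz]
    ring
  rw [e, inner_zero_left, add_zero, inner_smul_right] at h1
  rw [inner_packet (by linarith) hb hc]
  split_ifs at h1 ⊢ with hnm
  · have h0 : z - 4 * Complex.I * ((0 : ℝ) : ℂ) = z := by simp
    have h2 : HasDerivAt (fun t : ℝ => z - 4 * Complex.I * t) (-(4 * Complex.I)) 0 := by
      simpa using
        ((Complex.ofRealCLM.hasDerivAt (x := (0 : ℝ))).const_mul (4 * Complex.I)).const_sub z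
    have h3 : HasDerivAt (fun w : ℂ => K * w ^ (-((ν + 1 : ℝ) : ℂ)))
        (K * (-((ν + 1 : ℝ) : ℂ) * z ^ (-((ν + 1 : ℝ) : ℂ) - 1)))
        (z - 4 * Complex.I * ((0 : ℝ) : ℂ)) := by
      rw [h0]
      simpa using ((hasDerivAt_id z).cpow_const (c := -((ν + 1 : ℝ) : ℂ)) (Or.inl hz0)).const_mul K
    have h4 := h1.unique (HasDerivAt.scomp (h := fun t : ℝ => z - 4 * Complex.I * t)
      (g₁ := fun w : ℂ => K * w ^ (-((ν + 1 : ℝ) : ℂ))) (0 : ℝ) h3 h2)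
    have h5 : -((ν + 1 : ℝ) : ℂ) - 1 = -((ν + 1 + 1 : ℝ) : ℂ) := by
      push_cast
      ring
    rw [h5, smul_eq_mul] at h4
    have h6 : Complex.I * inner ℂ (packet ρ ν n b) (packetLaplacian ρ ν m c) = Complex.I *
        (4 * K * ((ν + 1 : ℝ) : ℂ) * z ^ (-((ν + 1 + 1 : ℝ) : ℂ))) := by
      rw [h4]
      ring
    rw [mul_left_cancel₀ Complex.I_ne_zero h6, Real.Gamma_add_one (by linarith : ν + 1 ≠ 0), hK]
    push_cast
    ring
  · have := h1.unique (hasDerivAt_const (0 : ℝ) (0 : ℂ))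
    rw [mul_zero]
    exact (mul_eq_zero.1 this).resolve_left Complex.I_ne_zero

end Packets

/-- The derivative at `0` of the constant `⟪U t x, U t y⟫` vanishes; this is the symmetry of the
generator. -/
theorem IsUnitaryGroupOf.inner_symm {H : Type*} [NormedAddCommGroup H] [InnerProductSpace ℂ H]
    {U : ℝ → H ≃ₗᵢ[ℂ] H} {A : Set (H × H)} (hU : IsUnitaryGroupOf U A) {p q : H × H} (hp : p ∈ A)
    (hq : q ∈ A) : (inner ℂ p.2 q.1 : ℂ) = inner ℂ p.1 q.2 := by
  have h1 := ((hU.generator p.1 p.2).1 hp).inner ℂ ((hU.generator q.1 q.2).1 hq)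
  simp only [LinearIsometryEquiv.inner_map_map, hU.map_zero] at h1
  have h2 := h1.unique (hasDerivAt_const (0 : ℝ) _)
  rw [inner_smul_right, inner_smul_left, Complex.conj_I] at h2
  have h3 : Complex.I * ((inner ℂ p.1 q.2 : ℂ) - inner ℂ p.2 q.1) = 0 := by
    linear_combination h2
  exact (sub_eq_zero.1 ((mul_eq_zero.1 h3).resolve_left Complex.I_ne_zero)).symm

/-! ### The unitary group on the packets and its generator -/

section Group

variable (ρ : ℝ)

/-- The order of the Bessel function attached to the angular frequency `n / ρ`. -/
def order (n : ℤ) : ℝ := |(n : ℝ)| / ρ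

theorem order_neg (n : ℤ) : order ρ (-n) = order ρ n := by
  simp [order]

variable [Fact (0 < ρ)]

theorem order_nonneg (n : ℤ) : 0 ≤ order ρ n :=
  div_nonneg (abs_nonneg _) (Fact.out : 0 < ρ).le

/-- Frequencies and widths of the packets. -/
abbrev PacketIndex : Type := ℤ × {b : ℂ // 0 < b.re}

/-- The evolution of the packets. -/
def translate (t : ℝ) (i : PacketIndex) : PacketIndex :=
  (i.1, ⟨i.2 - 4 * Complex.I * t, by simpa using i.2.2⟩)

/-- The Laplacian on the span of the packets. -/
def packetCore : Submodule ℂ (L2 ρ × L2 ρ) :=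
  Submodule.span ℂ (Set.range fun i : PacketIndex =>
    (packet ρ (order ρ i.1) i.1 i.2, packetLaplacian ρ (order ρ i.1) i.1 i.2))

variable {ρ}

theorem gaussL2_eq_smul (ν : ℝ) (n : ℤ) {a : ℂ} (ha : 0 < a.re) :
    gaussL2 ρ ν n a = (a⁻¹ ^ (-((ν + 1 : ℝ) : ℂ)))⁻¹ • packet ρ ν n a⁻¹ := by
  rw [packet, inv_inv, smul_smul, inv_mul_cancel₀, one_smul]
  rw [Complex.cpow_ne_zero_iff]
  exact Or.inl (inv_ne_zero (ne_zero_of_re_pos ha))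

theorem integrable_mul_gauss {u : Polar ρ → ℂ} (hu : MemLp u 2 (coneMeasure ρ)) {ν : ℝ}
    (hν : 0 ≤ ν) (n : ℤ) {a : ℂ} (ha : 0 < a.re) :
    Integrable (fun p => u p * gauss ρ ν n a p) (coneMeasure ρ) :=
  hu.integrable_mul (memLp_gauss hν ha)

theorem inner_gaussL2_left (u : L2 ρ) {ν : ℝ} (hν : 0 ≤ ν) (n : ℤ) {a : ℂ} (ha : 0 < a.re) :
    (inner ℂ (gaussL2 ρ ν n a) u : ℂ) =
      ∫ p, u p * gauss ρ ν (-n) (conj a) p ∂coneMeasure ρ := by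
  rw [L2.inner_def]
  refine integral_congr_ae ?_
  filter_upwards [coeFn_gaussL2 (ρ := ρ) hν (n := n) ha] with p hp
  rw [hp, RCLike.inner_apply, conj_gauss]

/-- Only the packets with `Re (1 / b) = 1` are needed: the modulus `exp (-r²)` is then a fixed
weight and `Im (1 / b)` plays the role of the Fourier variable. -/
theorem packet_total (u : L2 ρ)
    (h : ∀ i : PacketIndex, (inner ℂ (packet ρ (order ρ i.1) i.1 i.2) u : ℂ) = 0) : u = 0 := by
  refine Lp.eq_zero_iff_ae_eq_zero.2
    (ae_eq_zero_of_integral_gaussian (a := 1) (ν := order ρ) (fun n => ?_) fun n y => ?_)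
  · refine (integrable_mul_gauss (Lp.memLp u) (order_nonneg ρ n) 0 (a := 1) (by simp)).congr
      (Eventually.of_forall fun p => ?_)
    simp only [gauss, fourier_zero]
    push_cast
    ring
  · have ha : 0 < (conj ((1 : ℝ) + y * Complex.I : ℂ)).re := by simp
    have h1 := inner_gaussL2_left u (order_nonneg ρ n) (-n) ha
    rw [neg_neg, Complex.conj_conj, gaussL2_eq_smul _ _ ha, inner_smul_left] at h1
    have h2 := h (-n, ⟨_, inv_re_pos ha⟩)
    simp only [order_neg] at h2
    rw [h2, mul_zero] at h1
    exact h1.symm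

theorem inner_gaussL2_of_ne {ν μ : ℝ} (hν : 0 ≤ ν) (hμ : 0 ≤ μ) {n m : ℤ} (hnm : n ≠ m) {a b : ℂ}
    (ha : 0 < a.re) (hb : 0 < b.re) :
    (inner ℂ (gaussL2 ρ ν n a) (gaussL2 ρ μ m b) : ℂ) = 0 := by
  rw [inner_gaussL2_left _ hν n ha]
  have : ∫ p, gaussL2 ρ μ m b p * gauss ρ ν (-n) (conj a) p ∂coneMeasure ρ =
      ∫ p, gauss ρ (μ + ν) (m + -n) (b + conj a) p ∂coneMeasure ρ := by
    refine integral_congr_ae ?_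
    filter_upwards [coeFn_gaussL2 (ρ := ρ) hμ (n := m) hb, ae_cone] with p hp hp'
    rw [hp, gauss_mul_gauss hp']
  rw [this, integral_gauss (add_nonneg hμ hν)
    (by rw [Complex.add_re, Complex.conj_re]; linarith), if_neg (by omega)]

theorem inner_packet_of_ne {ν μ : ℝ} (hν : 0 ≤ ν) (hμ : 0 ≤ μ) {n m : ℤ} (hnm : n ≠ m) {b c : ℂ}
    (hb : 0 < b.re) (hc : 0 < c.re) :
    (inner ℂ (packet ρ ν n b) (packet ρ μ m c) : ℂ) = 0 := by
  rw [packet, packet, inner_smul_left, inner_smul_right,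
    inner_gaussL2_of_ne hν hμ hnm (inv_re_pos hb) (inv_re_pos hc), mul_zero, mul_zero]

theorem inner_packet_packetLaplacian_order (i j : PacketIndex) :
    (inner ℂ (packet ρ (order ρ i.1) i.1 i.2) (packetLaplacian ρ (order ρ j.1) j.1 j.2) : ℂ) =
      4 * inner ℂ (packet ρ (order ρ i.1 + 1) i.1 i.2) (packet ρ (order ρ j.1 + 1) j.1 j.2) := by
  by_cases hij : i.1 = j.1
  · rw [hij]
    exact inner_packet_packetLaplacian (order_nonneg ρ _) i.2.2 j.2.2
  · have hi := order_nonneg ρ i.1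
    have hj := order_nonneg ρ j.1
    have hj' : 0 ≤ order ρ j.1 + 2 := by linarith
    rw [inner_packet_of_ne (by linarith) (by linarith) hij i.2.2 j.2.2, packet, packetLaplacian,
      inner_smul_left, inner_smul_right, inner_sub_right, inner_smul_right, inner_smul_right,
      inner_gaussL2_of_ne hi hj hij (inv_re_pos i.2.2) (inv_re_pos j.2.2),
      inner_gaussL2_of_ne hi hj' hij (inv_re_pos i.2.2) (inv_re_pos j.2.2)]
    ring

theorem exists_packet_group : ∃ U : ℝ → L2 ρ ≃ₗᵢ[ℂ] L2 ρ,
    (∀ t n b, 0 < b.re → U t (packet ρ (order ρ n) n b) =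
      packet ρ (order ρ n) n (b - 4 * Complex.I * t)) ∧
    IsUnitaryGroupOf U ((packetCore ρ).adjoint : Set (L2 ρ × L2 ρ)) := by
  obtain ⟨U, h1, h2⟩ := exists_unitaryGroup translate
    (fun i : PacketIndex => packet ρ (order ρ i.1) i.1 i.2)
    (fun i : PacketIndex => packetLaplacian ρ (order ρ i.1) i.1 i.2)
    (fun i => by
      refine Prod.ext rfl (Subtype.ext ?_)
      simp [translate])
    (fun s t i => by
      refine Prod.ext rfl (Subtype.ext ?_)
      simp only [translate]
      push_cast
      ring)
    (fun t i j => by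
      by_cases hij : i.1 = j.1
      · have e : ∀ i : PacketIndex, (translate t i).1 = i.1 := fun _ => rfl
        simp only [e, hij]
        rw [inner_packet (order_nonneg ρ _) (translate t i).2.2 (translate t j).2.2,
          inner_packet (order_nonneg ρ _) i.2.2 j.2.2]
        congr 3
        simp only [translate, map_sub, map_mul, Complex.conj_I, Complex.conj_ofReal, map_ofNat]
        ring
      · have e : ∀ i : PacketIndex, (translate t i).1 = i.1 := fun _ => rfl
        simp only [e]
        rw [inner_packet_of_ne (order_nonneg ρ _) (order_nonneg ρ _) hij (translate t i).2.2
          (translate t j).2.2, inner_packet_of_ne (order_nonneg ρ _) (order_nonneg ρ _) hij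
          i.2.2 j.2.2])
    packet_total
    (fun i => hasDerivAt_packet_sub (order_nonneg ρ i.1) i.1 i.2.2)
  exact ⟨U, fun t n b hb => h1 t (n, ⟨b, hb⟩), h2⟩

theorem exists_inner_packetCore {c : L2 ρ × L2 ρ} (hc : c ∈ packetCore ρ) :
    ∃ f : PacketIndex →₀ ℂ,
      c.1 = f.sum (fun i a => a • packet ρ (order ρ i.1) i.1 i.2) ∧
      c.2 = f.sum (fun i a => a • packetLaplacian ρ (order ρ i.1) i.1 i.2) := by
  obtain ⟨f, rfl⟩ := (Finsupp.mem_span_range_iff_exists_finsupp).1 hc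
  exact ⟨f, by simp [Finsupp.sum, Prod.fst_sum], by simp [Finsupp.sum, Prod.snd_sum]⟩

/-- For a combination of packets the form is four times the squared norm of the same combination of
packets of index `ν + 1`. -/
theorem packetCore_pos {c : L2 ρ × L2 ρ} (hc : c ∈ packetCore ρ) :
    0 ≤ (inner ℂ c.1 c.2 : ℂ).re := by
  obtain ⟨f, h1, h2⟩ := exists_inner_packetCore hc
  have : (inner ℂ c.1 c.2 : ℂ) =
      4 * inner ℂ (f.sum fun i a => a • packet ρ (order ρ i.1 + 1) i.1 i.2)
        (f.sum fun i a => a • packet ρ (order ρ i.1 + 1) i.1 i.2) := by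
    rw [h1, h2]
    simp only [Finsupp.sum, sum_inner, inner_sum, inner_smul_left, inner_smul_right,
      inner_packet_packetLaplacian_order, Finset.mul_sum]
    refine Finset.sum_congr rfl fun i _ => Finset.sum_congr rfl fun j _ => ?_
    ring
  rw [this, inner_self_eq_norm_sq_to_K]
  generalize ‖f.sum fun i a => a • packet ρ (order ρ i.1 + 1) i.1 i.2‖ = x
  have e : (4 : ℂ) * ((x : ℂ)) ^ 2 = ((4 * x ^ 2 : ℝ) : ℂ) := by push_cast; rfl
  change 0 ≤ ((4 : ℂ) * ((x : ℂ)) ^ 2).re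
  rw [e, Complex.ofReal_re]
  positivity

theorem packetCore_le_adjoint : packetCore ρ ≤ (packetCore ρ).adjoint := by
  intro c hc
  rw [mem_adjoint_iff_inner]
  intro a ha
  obtain ⟨f, h1, h2⟩ := exists_inner_packetCore hc
  obtain ⟨g, h3, h4⟩ := exists_inner_packetCore ha
  have symm : ∀ i j : PacketIndex,
      (inner ℂ (packetLaplacian ρ (order ρ i.1) i.1 i.2) (packet ρ (order ρ j.1) j.1 j.2) : ℂ) =
      inner ℂ (packet ρ (order ρ i.1) i.1 i.2) (packetLaplacian ρ (order ρ j.1) j.1 j.2) := by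
    intro i j
    rw [← inner_conj_symm, inner_packet_packetLaplacian_order, inner_packet_packetLaplacian_order,
      map_mul, inner_conj_symm, map_ofNat]
  rw [h1, h2, h3, h4]
  simp only [Finsupp.sum, sum_inner, inner_sum, inner_smul_left, inner_smul_right, symm]

/-- Essential self-adjointness: the adjoint generates a unitary group, so it is symmetric, so it
lies in the double adjoint, which is contained in the closure. -/
theorem adjoint_packetCore_subset_closure :
    ((packetCore ρ).adjoint : Set (L2 ρ × L2 ρ)) ⊆ closure (packetCore ρ) := by
  obtain ⟨U, -, hU⟩ := exists_packet_group (ρ := ρ)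
  intro p hp
  refine mem_closure_of_mem_adjoint_adjoint (mem_adjoint_iff_inner.2 fun q hq => ?_)
  exact hU.inner_symm hq hp

theorem dense_fst_adjoint_packetCore :
    Dense (Prod.fst '' ((packetCore ρ).adjoint : Set (L2 ρ × L2 ρ))) := by
  have h0 : (Submodule.span ℂ (Set.range fun i : PacketIndex =>
      packet ρ (order ρ i.1) i.1 i.2))ᗮ = ⊥ := by
    rw [Submodule.eq_bot_iff]
    intro x hx
    exact packet_total x fun i => (Submodule.mem_orthogonal _ _).1 hx _ (Submodule.subset_span ⟨i, rfl⟩)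
  rw [← Submodule.topologicalClosure_eq_top_iff] at h0
  refine (Submodule.dense_iff_topologicalClosure_eq_top.2 h0).mono ?_
  have : Submodule.span ℂ (Set.range fun i : PacketIndex => packet ρ (order ρ i.1) i.1 i.2) ≤
      (packetCore ρ).adjoint.map (LinearMap.fst ℂ (L2 ρ) (L2 ρ)) := by
    rw [Submodule.span_le]
    rintro _ ⟨i, rfl⟩
    exact ⟨_, packetCore_le_adjoint (Submodule.subset_span ⟨i, rfl⟩), rfl⟩
  exact this

end Group

/-! ### Derivatives of test functions and Green's formula -/

section TestFunctions

variable {ρ : ℝ}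

/-- The radial derivative. -/
def derivRadial (φ : Polar ρ → ℂ) (p : Polar ρ) : ℂ := deriv (fun r : ℝ => φ (r, p.2)) p.1

/-- The angular derivative. -/
def derivAngular (φ : Polar ρ → ℂ) (p : Polar ρ) : ℂ :=
  deriv (fun s : ℝ => φ (p.1, p.2 + (s : AddCircle (2 * Real.pi * ρ)))) 0

/-- Iterating the two first-order derivatives keeps every intermediate function a test function. -/
theorem laplacian_eq (φ : Polar ρ → ℂ) (p : Polar ρ) :
    laplacian ρ φ p = -derivRadial (derivRadial φ) p - 1 / (p.1 : ℂ) * derivRadial φ p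
      - 1 / (p.1 : ℂ) ^ 2 * derivAngular (derivAngular φ) p := by
  have h : ∀ f : ℝ → ℂ, ∀ x, iteratedDeriv 2 f x = deriv (deriv f) x := by
    intro f x
    rw [iteratedDeriv_succ, iteratedDeriv_one]
  rw [laplacian, h, h]
  congr 2
  unfold derivAngular
  congr 1
  funext s
  simp only
  have := deriv_comp_const_add (fun u : ℝ => φ (p.1, p.2 + (u : AddCircle (2 * Real.pi * ρ)))) s 0
  rw [add_zero] at this
  rw [← this]
  congr 1
  funext u
  rw [AddCircle.coe_add, add_assoc]

theorem tsupport_subset_of_eventuallyEq {X : Type*} [TopologicalSpace X] {f g : X → ℂ}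
    (h : ∀ x, g =ᶠ[𝓝 x] 0 → f x = 0) : tsupport f ⊆ tsupport g := by
  refine closure_minimal (fun x hx => ?_) (isClosed_tsupport g)
  by_contra hxg
  exact hx (h x (notMem_tsupport_iff_eventuallyEq.1 hxg))

theorem tsupport_derivRadial_subset (φ : Polar ρ → ℂ) : tsupport (derivRadial φ) ⊆ tsupport φ := by
  refine tsupport_subset_of_eventuallyEq fun p hp => ?_
  have hc : ContinuousAt (fun r : ℝ => ((r, p.2) : Polar ρ)) p.1 := by fun_prop
  have : (fun r : ℝ => φ (r, p.2)) =ᶠ[𝓝 p.1] fun _ => 0 := hc.eventually hp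
  rw [derivRadial, this.deriv_eq, deriv_const]

theorem tsupport_derivAngular_subset (φ : Polar ρ → ℂ) :
    tsupport (derivAngular φ) ⊆ tsupport φ := by
  refine tsupport_subset_of_eventuallyEq fun p hp => ?_
  have hc : ContinuousAt (fun s : ℝ =>
      ((p.1, p.2 + (s : AddCircle (2 * Real.pi * ρ))) : Polar ρ)) 0 := by
    have := AddCircle.continuous_mk' (2 * Real.pi * ρ)
    exact Continuous.continuousAt (by fun_prop)
  have hp' : φ =ᶠ[𝓝 ((p.1, p.2 + ((0 : ℝ) : AddCircle (2 * Real.pi * ρ))) : Polar ρ)] 0 := by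
    simpa using hp
  have : (fun s : ℝ => φ (p.1, p.2 + (s : AddCircle (2 * Real.pi * ρ)))) =ᶠ[𝓝 0] fun _ => 0 :=
    hc.eventually hp'
  rw [derivAngular, this.deriv_eq, deriv_const]

theorem IsTestFunction.derivRadial {φ : Polar ρ → ℂ} (h : IsTestFunction ρ φ) :
    IsTestFunction ρ (derivRadial φ) where
  smooth := by
    set Φ : ℝ × ℝ → ℂ := fun x => φ (x.1, (x.2 : AddCircle (2 * Real.pi * ρ))) with hΦ
    have e : (fun x : ℝ × ℝ => FlatCone.derivRadial φ (x.1, (x.2 : AddCircle (2 * Real.pi * ρ)))) =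
        fun x => fderiv ℝ Φ x (1, 0) := by
      funext x
      have h1 : HasDerivAt (fun r : ℝ => (r, x.2)) (1, 0) x.1 :=
        (hasDerivAt_id x.1).prodMk (hasDerivAt_const _ _)
      have h2 : DifferentiableAt ℝ Φ (x.1, x.2) := (h.smooth.differentiable (by simp)) _
      exact (h2.hasFDerivAt.comp_hasDerivAt x.1 h1).deriv
    rw [e]
    exact (h.smooth.fderiv_right (m := ∞) (by simp)).clm_apply contDiff_const
  compact := h.compact.of_isClosed_subset (isClosed_tsupport _) (tsupport_derivRadial_subset φ)
  support := (tsupport_derivRadial_subset φ).trans h.support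

theorem IsTestFunction.derivAngular {φ : Polar ρ → ℂ} (h : IsTestFunction ρ φ) :
    IsTestFunction ρ (derivAngular φ) where
  smooth := by
    set Φ : ℝ × ℝ → ℂ := fun x => φ (x.1, (x.2 : AddCircle (2 * Real.pi * ρ))) with hΦ
    have e : (fun x : ℝ × ℝ => FlatCone.derivAngular φ (x.1, (x.2 : AddCircle (2 * Real.pi * ρ)))) =
        fun x => fderiv ℝ Φ x (0, 1) := by
      funext x
      have h1 : HasDerivAt (fun s : ℝ => (x.1, x.2 + s)) (0, 1) 0 :=
        (hasDerivAt_const _ _).prodMk ((hasDerivAt_id (0 : ℝ)).const_add x.2)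
      have h2 : DifferentiableAt ℝ Φ (x.1, x.2 + 0) := (h.smooth.differentiable (by simp)) _
      have h3 := (h2.hasFDerivAt.comp_hasDerivAt (0 : ℝ) h1).deriv
      rw [add_zero] at h3
      exact h3
    rw [e]
    exact (h.smooth.fderiv_right (m := ∞) (by simp)).clm_apply contDiff_const
  compact := h.compact.of_isClosed_subset (isClosed_tsupport _) (tsupport_derivAngular_subset φ)
  support := (tsupport_derivAngular_subset φ).trans h.support

/-- Continuity on the cylinder can be checked after lifting to the plane, where smoothness of test
functions is defined. -/
theorem isOpenQuotientMap_polar :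
    IsOpenQuotientMap fun x : ℝ × ℝ => ((x.1, (x.2 : AddCircle (2 * Real.pi * ρ))) : Polar ρ) :=
  IsOpenQuotientMap.id.prodMap QuotientAddGroup.isOpenQuotientMap_mk

theorem IsTestFunction.continuous {φ : Polar ρ → ℂ} (h : IsTestFunction ρ φ) : Continuous φ :=
  isOpenQuotientMap_polar.isQuotientMap.continuous_iff.2 h.smooth.continuous

theorem isOpen_cone : IsOpen (cone ρ) := isOpen_lt continuous_const continuous_fst

/-- The support of `φ` stays away from the vertex, so the behaviour of `g` at `r ≤ 0` is irrelevant.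
-/
theorem IsTestFunction.continuous_mul {φ g : Polar ρ → ℂ} (h : IsTestFunction ρ φ)
    (hg : ContinuousOn g (cone ρ)) : Continuous fun p => φ p * g p := by
  refine continuous_of_tsupport fun p hp => ?_
  have hp' : p ∈ cone ρ := h.support (closure_mono (Function.support_mul_subset_left φ g) hp)
  exact h.continuous.continuousAt.mul (hg.continuousAt (isOpen_cone.mem_nhds hp'))

theorem IsTestFunction.hasCompactSupport_mul {φ g : Polar ρ → ℂ} (h : IsTestFunction ρ φ) :
    HasCompactSupport fun p => φ p * g p := h.compact.mul_right

theorem IsTestFunction.conj {ψ : Polar ρ → ℂ} (h : IsTestFunction ρ ψ) :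
    IsTestFunction ρ fun p => conj (ψ p) where
  smooth := Complex.conjCLE.contDiff.comp h.smooth
  compact := h.compact.comp_left (map_zero _)
  support := (tsupport_comp_subset (map_zero (starRingEnd ℂ)) ψ).trans h.support

theorem continuousOn_inv_pow (k : ℕ) :
    ContinuousOn (fun p : Polar ρ => 1 / (p.1 : ℂ) ^ k) (cone ρ) := by
  refine ContinuousOn.div continuousOn_const (by fun_prop) fun p hp => ?_
  have hp : 0 < p.1 := hp
  exact pow_ne_zero _ (by exact_mod_cast hp.ne')

theorem IsTestFunction.exists_bounds {φ : Polar ρ → ℂ} (h : IsTestFunction ρ φ) :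
    ∃ A B : ℝ, 0 < A ∧ A < B ∧ ∀ p, p.1 ≤ A ∨ B ≤ p.1 → φ p = 0 := by
  have hK : IsCompact (Prod.fst '' tsupport φ) := h.compact.isCompact.image continuous_fst
  obtain ⟨B, hB⟩ := hK.bddAbove
  have : ∃ A, 0 < A ∧ ∀ r ∈ Prod.fst '' tsupport φ, A < r := by
    rcases (Prod.fst '' tsupport φ).eq_empty_or_nonempty with he | hne
    · exact ⟨1, one_pos, by simp [he]⟩
    · obtain ⟨A, hA, hA'⟩ := hK.exists_isLeast hne
      obtain ⟨p, hp, rfl⟩ := hA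
      have : 0 < p.1 := h.support hp
      exact ⟨p.1 / 2, by linarith, fun r hr => by linarith [hA' hr]⟩
  obtain ⟨A, hA, hA'⟩ := this
  refine ⟨A, max B A + 1, hA, by linarith [le_max_right B A], fun p hp => ?_⟩
  by_contra hne
  have hm : p.1 ∈ Prod.fst '' tsupport φ := ⟨p, subset_tsupport φ hne, rfl⟩
  rcases hp with hp | hp
  · linarith [hA' _ hm]
  · have := hB hm
    linarith [le_max_left B A]

/-- Green's formula on a ray. -/
theorem IsTestFunction.radial_green {φ : Polar ρ → ℂ} (h : IsTestFunction ρ φ) {f f' f'' : ℝ → ℂ}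
    (hf : ∀ r, 0 < r → HasDerivAt f (f' r) r) (hf' : ∀ r, 0 < r → HasDerivAt f' (f'' r) r)
    (hf'' : ContinuousOn f'' (Set.Ioi 0)) (θ : AddCircle (2 * Real.pi * ρ)) :
    ∫ r, ((-FlatCone.derivRadial (FlatCone.derivRadial φ) (r, θ) -
        1 / (r : ℂ) * FlatCone.derivRadial φ (r, θ)) * f r -
        φ (r, θ) * (-f'' r - 1 / (r : ℂ) * f' r)) ∂radialMeasure = 0 := by
  set u : ℝ → ℂ := fun r => φ (r, θ) with hu
  set u' : ℝ → ℂ := fun r => FlatCone.derivRadial φ (r, θ) with hu'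
  set u'' : ℝ → ℂ := fun r => FlatCone.derivRadial (FlatCone.derivRadial φ) (r, θ) with hu''
  have du : ∀ r, HasDerivAt u (u' r) r := fun r =>
    ((h.contDiff_radial θ).differentiable (by simp) r).hasDerivAt
  have du' : ∀ r, HasDerivAt u' (u'' r) r := fun r =>
    ((h.derivRadial.contDiff_radial θ).differentiable (by simp) r).hasDerivAt
  have cu'' : Continuous u'' := (h.derivRadial.derivRadial.contDiff_radial θ).continuous
  obtain ⟨A, B, hA, hAB, hz⟩ := h.exists_bounds
  obtain ⟨A', B', hA', hAB', hz'⟩ := h.derivRadial.exists_bounds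
  obtain ⟨A'', B'', hA'', hAB'', hz''⟩ := h.derivRadial.derivRadial.exists_bounds
  set a := min A (min A' A'') with ha
  set b := max B (max B' B'') with hb
  have ha0 : 0 < a := lt_min hA (lt_min hA' hA'')
  have hab : a ≤ b := (min_le_left _ _).trans (hAB.le.trans (le_max_left _ _))
  have z0 : ∀ r, r ≤ a ∨ b ≤ r → u r = 0 := fun r hr => hz (r, θ)
    (hr.imp (fun h => h.trans (min_le_left _ _)) fun h => (le_max_left _ _).trans h)
  have z1 : ∀ r, r ≤ a ∨ b ≤ r → u' r = 0 := fun r hr => hz' (r, θ)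
    (hr.imp (fun h => h.trans ((min_le_right _ _).trans (min_le_left _ _)))
      fun h => ((le_max_left _ _).trans (le_max_right _ _)).trans h)
  have z2 : ∀ r, r ≤ a ∨ b ≤ r → u'' r = 0 := fun r hr => hz'' (r, θ)
    (hr.imp (fun h => h.trans ((min_le_right _ _).trans (min_le_right _ _)))
      fun h => ((le_max_right _ _).trans (le_max_right _ _)).trans h)
  -- This is the derivative of `r (u f' - u' f)`, whose boundary values vanish with `u` and `u'`.
  set w' : ℝ → ℂ := fun r => -((u' r + r * u'' r) * f r) + u r * (f' r + r * f'' r) with hw'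
  rw [integral_radialMeasure]
  have e1 : ∫ r in Set.Ioi (0 : ℝ), (r : ℂ) * ((-u'' r - 1 / (r : ℂ) * u' r) * f r -
      u r * (-f'' r - 1 / (r : ℂ) * f' r)) = ∫ r in Set.Ioi (0 : ℝ), w' r := by
    refine setIntegral_congr_fun measurableSet_Ioi fun r hr => ?_
    have : (r : ℂ) ≠ 0 := by exact_mod_cast (ne_of_gt hr)
    simp only [hw']
    field_simp
    ring
  have e2 : ∫ r in Set.Ioi (0 : ℝ), w' r = ∫ r in Set.Ioc a b, w' r := by
    refine setIntegral_eq_of_subset_of_forall_sdiff_eq_zero measurableSet_Ioi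
      (fun r hr => ha0.trans hr.1) fun r hr => ?_
    have : r ≤ a ∨ b ≤ r := by
      by_contra! hc
      exact hr.2 ⟨hc.1, hc.2.le⟩
    simp only [hw', z0 r this, z1 r this, z2 r this]
    ring
  rw [e1, e2, ← intervalIntegral.integral_of_le hab]
  have dw : ∀ r ∈ Set.uIcc a b,
      HasDerivAt (fun r : ℝ => -((r * u' r) * f r) + u r * (r * f' r)) (w' r) r := by
    intro r hr
    rw [Set.uIcc_of_le hab] at hr
    have hr0 : 0 < r := ha0.trans_le hr.1
    have hid : HasDerivAt (fun r : ℝ => (r : ℂ)) 1 r := Complex.ofRealCLM.hasDerivAt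
    refine ((((hid.mul (du' r)).mul (hf r hr0)).neg).add
      ((du r).mul (hid.mul (hf' r hr0)))).congr_deriv ?_
    simp only [hw', Pi.mul_apply]
    ring
  have cu : Continuous u := (h.contDiff_radial θ).continuous
  have cu' : Continuous u' := (h.derivRadial.contDiff_radial θ).continuous
  have cw : ContinuousOn w' (Set.uIcc a b) := by
    have hs : Set.uIcc a b ⊆ Set.Ioi 0 := by
      rw [Set.uIcc_of_le hab]
      exact fun r hr => ha0.trans_le hr.1
    have cf : ContinuousOn f (Set.uIcc a b) := fun r hr =>
      (hf r (hs hr)).continuousAt.continuousWithinAt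
    have cf' : ContinuousOn f' (Set.uIcc a b) := fun r hr =>
      (hf' r (hs hr)).continuousAt.continuousWithinAt
    have cf'' := hf''.mono hs
    have cid : Continuous fun r : ℝ => (r : ℂ) := Complex.continuous_ofReal
    exact (((cu'.continuousOn.add (cid.continuousOn.mul cu''.continuousOn)).mul cf).neg).add
      (cu.continuousOn.mul (cf'.add (cid.continuousOn.mul cf'')))
  rw [intervalIntegral.integral_eq_sub_of_hasDerivAt dw cw.intervalIntegrable,
    z0 a (Or.inl le_rfl), z1 a (Or.inl le_rfl), z0 b (Or.inr le_rfl), z1 b (Or.inr le_rfl)]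
  ring

variable [Fact (0 < ρ)]

theorem IsTestFunction.integrable_mul {φ g : Polar ρ → ℂ} (h : IsTestFunction ρ φ)
    (hg : ContinuousOn g (cone ρ)) : Integrable (fun p => φ p * g p) (coneMeasure ρ) :=
  (h.continuous_mul hg).integrable_of_hasCompactSupport h.hasCompactSupport_mul

theorem IsTestFunction.memLp_mul {φ g : Polar ρ → ℂ} (h : IsTestFunction ρ φ)
    (hg : ContinuousOn g (cone ρ)) : MemLp (fun p => φ p * g p) 2 (coneMeasure ρ) :=
  (h.continuous_mul hg).memLp_of_hasCompactSupport h.hasCompactSupport_mul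

theorem IsTestFunction.memLp {φ : Polar ρ → ℂ} (h : IsTestFunction ρ φ) :
    MemLp φ 2 (coneMeasure ρ) :=
  h.continuous.memLp_of_hasCompactSupport h.compact

theorem IsTestFunction.memLp_laplacian {φ : Polar ρ → ℂ} (h : IsTestFunction ρ φ) :
    MemLp (laplacian ρ φ) 2 (coneMeasure ρ) := by
  have := (h.derivRadial.derivRadial.memLp.neg.sub
    (h.derivRadial.memLp_mul (continuousOn_inv_pow 1))).sub
    (h.derivAngular.derivAngular.memLp_mul (continuousOn_inv_pow 2))
  refine this.ae_eq (Eventually.of_forall fun p => ?_)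
  simp only [Pi.sub_apply, Pi.neg_apply, laplacian_eq]
  ring

theorem hasDerivAt_fourier_coe (n : ℤ) (x : ℝ) :
    HasDerivAt (fun x : ℝ => fourier n (x : AddCircle (2 * Real.pi * ρ)))
      (Complex.I * (n / ρ : ℝ) * fourier n (x : AddCircle (2 * Real.pi * ρ))) x := by
  refine (hasDerivAt_fourier (2 * Real.pi * ρ) n x).congr_deriv ?_
  have h1 : (ρ : ℂ) ≠ 0 := by exact_mod_cast (Fact.out : 0 < ρ).ne'
  have h2 : (Real.pi : ℂ) ≠ 0 := by exact_mod_cast Real.pi_ne_zero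
  congr 1
  push_cast
  field_simp

/-- Green's formula on a circle. -/
theorem IsTestFunction.angular_green {φ : Polar ρ → ℂ} (h : IsTestFunction ρ φ) (n : ℤ) (r : ℝ) :
    ∫ θ, (FlatCone.derivAngular (FlatCone.derivAngular φ) (r, θ) * fourier n θ +
      φ (r, θ) * (((n / ρ : ℝ) : ℂ) ^ 2 * fourier n θ)) = 0 := by
  set E : ℝ → ℂ := fun x => fourier n (x : AddCircle (2 * Real.pi * ρ)) with hE
  set v : ℝ → ℂ := fun x => φ (r, (x : AddCircle (2 * Real.pi * ρ))) with hv
  set v' : ℝ → ℂ := fun x => FlatCone.derivAngular φ (r, (x : AddCircle (2 * Real.pi * ρ))) with hv'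
  set v'' : ℝ → ℂ := fun x => FlatCone.derivAngular (FlatCone.derivAngular φ)
    (r, (x : AddCircle (2 * Real.pi * ρ))) with hv''
  have dv : ∀ {ψ : Polar ρ → ℂ}, IsTestFunction ρ ψ → ∀ x : ℝ,
      HasDerivAt (fun x : ℝ => ψ (r, (x : AddCircle (2 * Real.pi * ρ))))
        (FlatCone.derivAngular ψ (r, (x : AddCircle (2 * Real.pi * ρ)))) x := by
    intro ψ hψ x
    have h1 := ((hψ.contDiff_angular (r, (x : AddCircle (2 * Real.pi * ρ)))).differentiable
      (by simp) 0).hasDerivAt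
    have h2 : HasDerivAt (fun s : ℝ => ψ (r, (x : AddCircle (2 * Real.pi * ρ)) +
        (s : AddCircle (2 * Real.pi * ρ)))) (FlatCone.derivAngular ψ
          (r, (x : AddCircle (2 * Real.pi * ρ)))) (x - x) := by
      rw [sub_self]
      exact h1
    refine (HasDerivAt.comp_sub_const x x h2).congr_of_eventuallyEq
      (Eventually.of_forall fun y => ?_)
    simp only
    rw [← AddCircle.coe_add, add_sub_cancel]
  rw [← AddCircle.intervalIntegral_preimage (2 * Real.pi * ρ) 0]
  have dw : ∀ x ∈ Set.uIcc (0 : ℝ) (0 + 2 * Real.pi * ρ),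
      HasDerivAt (fun x => v' x * E x - v x * (Complex.I * (n / ρ : ℝ) * E x))
        (v'' x * E x + v x * (((n / ρ : ℝ) : ℂ) ^ 2 * E x)) x := by
    intro x _
    have hEx := hasDerivAt_fourier_coe (ρ := ρ) n x
    refine (((dv h.derivAngular x).mul hEx).sub ((dv h x).mul
      (hEx.const_mul (Complex.I * (n / ρ : ℝ))))).congr_deriv ?_
    simp only [hv, hv'', hE]
    linear_combination (-(φ (r, (x : AddCircle (2 * Real.pi * ρ)))) * ((n / ρ : ℝ) : ℂ) ^ 2 *
      fourier n (x : AddCircle (2 * Real.pi * ρ))) * Complex.I_sq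
  have hcont : Continuous fun x => v'' x * E x + v x * (((n / ρ : ℝ) : ℂ) ^ 2 * E x) := by
    have := AddCircle.continuous_mk' (2 * Real.pi * ρ)
    have c1 : Continuous v'' := h.derivAngular.derivAngular.continuous.comp (by fun_prop)
    have c2 : Continuous v := h.continuous.comp (by fun_prop)
    have c3 : Continuous E := (map_continuous (fourier n)).comp this
    fun_prop
  rw [intervalIntegral.integral_eq_sub_of_hasDerivAt dw (hcont.intervalIntegrable _ _)]
  have hp : (((0 : ℝ) + 2 * Real.pi * ρ : ℝ) : AddCircle (2 * Real.pi * ρ)) = ((0 : ℝ) :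
      AddCircle (2 * Real.pi * ρ)) := by
    rw [zero_add, AddCircle.coe_period, AddCircle.coe_zero]
  simp only [hv, hv', hE, hp]
  ring

/-- Green's formula on the cone. -/
theorem IsTestFunction.green {φ : Polar ρ → ℂ} (h : IsTestFunction ρ φ) {f f' f'' : ℝ → ℂ}
    (hf : ∀ r, 0 < r → HasDerivAt f (f' r) r) (hf' : ∀ r, 0 < r → HasDerivAt f' (f'' r) r)
    (hf'' : ContinuousOn f'' (Set.Ioi 0)) (n : ℤ) :
    ∫ p, laplacian ρ φ p * (f p.1 * fourier n p.2) ∂coneMeasure ρ =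
      ∫ p, φ p * ((-f'' p.1 - 1 / (p.1 : ℂ) * f' p.1 + ((n / ρ : ℝ) : ℂ) ^ 2 / (p.1 : ℂ) ^ 2 *
        f p.1) * fourier n p.2) ∂coneMeasure ρ := by
  have cF : Continuous fun p : Polar ρ => fourier n p.2 :=
    (map_continuous (fourier n)).comp continuous_snd
  have cf : ContinuousOn (fun p : Polar ρ => f p.1) (cone ρ) :=
    ContinuousOn.comp (t := Set.Ioi 0) (fun r hr => (hf r hr).continuousAt.continuousWithinAt)
      continuous_fst.continuousOn fun p hp => hp
  have cf' : ContinuousOn (fun p : Polar ρ => f' p.1) (cone ρ) :=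
    ContinuousOn.comp (t := Set.Ioi 0) (fun r hr => (hf' r hr).continuousAt.continuousWithinAt)
      continuous_fst.continuousOn fun p hp => hp
  have cf'' : ContinuousOn (fun p : Polar ρ => f'' p.1) (cone ρ) :=
    hf''.comp continuous_fst.continuousOn fun p hp => hp
  have c1 := continuousOn_inv_pow (ρ := ρ) 1
  have c2 := continuousOn_inv_pow (ρ := ρ) 2
  simp only [pow_one] at c1
  have J1 : Integrable (fun p => ((-FlatCone.derivRadial (FlatCone.derivRadial φ) p -
      1 / (p.1 : ℂ) * FlatCone.derivRadial φ p) * f p.1 -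
      φ p * (-f'' p.1 - 1 / (p.1 : ℂ) * f' p.1)) * fourier n p.2) (coneMeasure ρ) := by
    have i1 := h.derivRadial.derivRadial.integrable_mul (cf.mul cF.continuousOn)
    have i2 := h.derivRadial.integrable_mul (c1.mul (cf.mul cF.continuousOn))
    have i3 := h.integrable_mul (cf''.mul cF.continuousOn)
    have i4 := h.integrable_mul ((c1.mul cf').mul cF.continuousOn)
    refine (((i1.neg.sub i2).add i3).add i4).congr (Eventually.of_forall fun p => ?_)
    simp only [Pi.add_apply, Pi.sub_apply, Pi.neg_apply, Pi.mul_apply]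
    ring
  have J2 : Integrable (fun p => (FlatCone.derivAngular (FlatCone.derivAngular φ) p *
      fourier n p.2 + φ p * (((n / ρ : ℝ) : ℂ) ^ 2 * fourier n p.2)) *
      (1 / (p.1 : ℂ) ^ 2 * f p.1)) (coneMeasure ρ) := by
    have i1 := h.derivAngular.derivAngular.integrable_mul (cF.continuousOn.mul (c2.mul cf))
    have i2 := (h.integrable_mul (cF.continuousOn.mul (c2.mul cf))).const_mul
      (((n / ρ : ℝ) : ℂ) ^ 2)
    refine (i1.add i2).congr (Eventually.of_forall fun p => ?_)
    simp only [Pi.add_apply, Pi.mul_apply]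
    ring
  -- the radial part
  have R : ∫ p, ((-FlatCone.derivRadial (FlatCone.derivRadial φ) p -
      1 / (p.1 : ℂ) * FlatCone.derivRadial φ p) * f p.1 -
      φ p * (-f'' p.1 - 1 / (p.1 : ℂ) * f' p.1)) * fourier n p.2 ∂coneMeasure ρ = 0 := by
    rw [coneMeasure_eq, integral_prod_symm]
    · have : ∀ θ : AddCircle (2 * Real.pi * ρ),
          ∫ r, ((-FlatCone.derivRadial (FlatCone.derivRadial φ) (r, θ) -
          1 / (r : ℂ) * FlatCone.derivRadial φ (r, θ)) * f r -
          φ (r, θ) * (-f'' r - 1 / (r : ℂ) * f' r)) * fourier n θ ∂radialMeasure = 0 := by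
        intro θ
        rw [integral_mul_const, h.radial_green hf hf' hf'', zero_mul]
      simp only [this, integral_zero]
    · exact J1
  -- the angular part
  have Θ : ∫ p, (FlatCone.derivAngular (FlatCone.derivAngular φ) p * fourier n p.2 +
      φ p * (((n / ρ : ℝ) : ℂ) ^ 2 * fourier n p.2)) * (1 / (p.1 : ℂ) ^ 2 * f p.1)
        ∂coneMeasure ρ = 0 := by
    rw [coneMeasure_eq, integral_prod]
    · have : ∀ r : ℝ, ∫ θ, (FlatCone.derivAngular (FlatCone.derivAngular φ) (r, θ) * fourier n θ +
          φ (r, θ) * (((n / ρ : ℝ) : ℂ) ^ 2 * fourier n θ)) * (1 / (r : ℂ) ^ 2 * f r) = 0 := by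
        intro r
        rw [integral_mul_const, h.angular_green, zero_mul]
      simp only [this, integral_zero]
    · exact J2
  have I1 : Integrable (fun p => laplacian ρ φ p * (f p.1 * fourier n p.2)) (coneMeasure ρ) := by
    have i1 := h.derivRadial.derivRadial.integrable_mul (cf.mul cF.continuousOn)
    have i2 := h.derivRadial.integrable_mul (c1.mul (cf.mul cF.continuousOn))
    have i3 := h.derivAngular.derivAngular.integrable_mul (cF.continuousOn.mul (c2.mul cf))
    refine ((i1.neg.sub i2).sub i3).congr (Eventually.of_forall fun p => ?_)
    simp only [Pi.sub_apply, Pi.neg_apply, Pi.mul_apply, laplacian_eq]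
    ring
  have I2 : Integrable (fun p => φ p * ((-f'' p.1 - 1 / (p.1 : ℂ) * f' p.1 +
      ((n / ρ : ℝ) : ℂ) ^ 2 / (p.1 : ℂ) ^ 2 * f p.1) * fourier n p.2)) (coneMeasure ρ) := by
    have i3 := h.integrable_mul (cf''.mul cF.continuousOn)
    have i4 := h.integrable_mul ((c1.mul cf').mul cF.continuousOn)
    have i2 := (h.integrable_mul (cF.continuousOn.mul (c2.mul cf))).const_mul
        (((n / ρ : ℝ) : ℂ) ^ 2)
    refine ((i3.neg.sub i4).add i2).congr (Eventually.of_forall fun p => ?_)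
    simp only [Pi.add_apply, Pi.sub_apply, Pi.neg_apply, Pi.mul_apply]
    ring
  -- The difference of the two integrands is the radial integrand minus the angular one, and both
  -- integrate to zero.
  rw [← sub_eq_zero, ← integral_sub I1 I2]
  rw [← sub_eq_zero.2 (R.trans Θ.symm)]
  rw [← integral_sub J1 J2]
  congr 1
  funext p
  rw [laplacian_eq]
  ring

end TestFunctions

/-! ### Functions of the logarithm of the radius -/

section LogProfile

variable {ρ : ℝ}

theorem hasDerivAt_comp_log {G : ℝ → ℂ} (hG : Differentiable ℝ G) {r : ℝ} (hr : 0 < r) :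
    HasDerivAt (fun r => G (Real.log r)) (deriv G (Real.log r) / r) r := by
  refine ((hG (Real.log r)).hasDerivAt.scomp r (Real.hasDerivAt_log hr.ne')).congr_deriv ?_
  rw [Complex.real_smul]
  push_cast
  ring

theorem hasDerivAt_comp_log_div {G : ℝ → ℂ} (hG : Differentiable ℝ G) {r : ℝ} (hr : 0 < r) :
    HasDerivAt (fun r : ℝ => G (Real.log r) / r)
      ((deriv G (Real.log r) - G (Real.log r)) / (r : ℂ) ^ 2) r := by
  have hid : HasDerivAt (fun r : ℝ => (r : ℂ)) 1 r := Complex.ofRealCLM.hasDerivAt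
  have h0 : (r : ℂ) ≠ 0 := by exact_mod_cast hr.ne'
  refine ((hasDerivAt_comp_log hG hr).div hid h0).congr_deriv ?_
  field_simp

/-- The function `G (log r) exp (i n θ / ρ)` on the cone. -/
def logProfile (ρ : ℝ) (G : ℝ → ℂ) (n : ℤ) (p : Polar ρ) : ℂ :=
  if 0 < p.1 then G (Real.log p.1) * fourier n p.2 else 0

theorem logProfile_of_pos (G : ℝ → ℂ) (n : ℤ) {p : Polar ρ} (hp : p ∈ cone ρ) :
    logProfile ρ G n p = G (Real.log p.1) * fourier n p.2 := if_pos hp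

theorem contDiff_fourier_coe (n : ℤ) :
    ContDiff ℝ ∞ fun x : ℝ => fourier n (x : AddCircle (2 * Real.pi * ρ)) := by
  simp only [fourier_coe_apply]
  have : ContDiff ℝ ∞ fun x : ℝ => (x : ℂ) := Complex.ofRealCLM.contDiff
  fun_prop

variable [Fact (0 < ρ)]

theorem isTestFunction_logProfile {G : ℝ → ℂ} (hG : ContDiff ℝ ∞ G) {M : ℝ}
    (hM : ∀ s, M < |s| → G s = 0) (n : ℤ) : IsTestFunction ρ (logProfile ρ G n) := by
  have hsupp : Function.support (logProfile ρ G n) ⊆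
      Set.Icc (Real.exp (-M)) (Real.exp M) ×ˢ Set.univ := by
    intro p hp
    rw [Function.mem_support, logProfile] at hp
    have hp0 : 0 < p.1 := by
      by_contra h
      exact hp (if_neg h)
    rw [if_pos hp0] at hp
    have : |Real.log p.1| ≤ M := by
      by_contra! h
      exact hp (by rw [hM _ h, zero_mul])
    rw [abs_le] at this
    exact ⟨⟨(Real.le_log_iff_exp_le hp0).1 this.1, (Real.log_le_iff_le_exp hp0).1 this.2⟩, trivial⟩
  have hK : IsCompact (Set.Icc (Real.exp (-M)) (Real.exp M) ×ˢ
      (Set.univ : Set (AddCircle (2 * Real.pi * ρ)))) := isCompact_Icc.prod isCompact_univ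
  have hts : tsupport (logProfile ρ G n) ⊆ _ := closure_minimal hsupp hK.isClosed
  refine ⟨?_, hK.of_isClosed_subset (isClosed_tsupport _) hts, fun p hp =>
    (Real.exp_pos _).trans_le (hts hp).1.1⟩
  rw [contDiff_iff_contDiffAt]
  intro x
  by_cases hx : 0 < x.1
  · have h1 : ContDiffAt ℝ ∞ (fun x : ℝ × ℝ => G (Real.log x.1) *
        fourier n (x.2 : AddCircle (2 * Real.pi * ρ))) x := by
      refine ContDiffAt.mul ?_ ?_
      · exact hG.contDiffAt.comp x (contDiffAt_fst.log hx.ne')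
      · exact ((contDiff_fourier_coe n).comp contDiff_snd).contDiffAt
    refine h1.congr_of_eventuallyEq ?_
    filter_upwards [(isOpen_lt continuous_const continuous_fst).mem_nhds hx] with y hy
    exact if_pos hy
  · refine (contDiffAt_const (c := (0 : ℂ))).congr_of_eventuallyEq ?_
    have hx' : x.1 < Real.exp (-M) := (not_lt.1 hx).trans_lt (Real.exp_pos _)
    filter_upwards [(isOpen_lt continuous_fst continuous_const).mem_nhds hx'] with y hy
    by_contra h
    exact absurd (hsupp h).1.1 (not_le.2 hy)

/-- In the variable `s = log r` the Laplacian is `-r⁻² (∂_s² + ∂_θ²)`: the first-order term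
disappears. -/
theorem laplacian_logProfile {G : ℝ → ℂ} (hG : ContDiff ℝ ∞ G) (n : ℤ) {p : Polar ρ}
    (hp : p ∈ cone ρ) : laplacian ρ (logProfile ρ G n) p =
      (((n / ρ : ℝ) : ℂ) ^ 2 * G (Real.log p.1) - deriv (deriv G) (Real.log p.1)) /
        (p.1 : ℂ) ^ 2 * fourier n p.2 := by
  obtain ⟨r, θ⟩ := p
  have hr : 0 < r := hp
  have hr0 : (r : ℂ) ≠ 0 := by exact_mod_cast hr.ne'
  have dG : Differentiable ℝ G := hG.differentiable (by simp)
  have dG' : Differentiable ℝ (deriv G) :=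
    ((contDiff_infty_iff_deriv.1 hG).2).differentiable (by simp)
  have e1 : ∀ r : ℝ, 0 < r → ∀ θ, derivRadial (logProfile ρ G n) (r, θ) =
      deriv G (Real.log r) / r * fourier n θ := by
    intro r hr θ
    refine HasDerivAt.deriv (((hasDerivAt_comp_log dG hr).mul_const (fourier n θ)).congr_of_eventuallyEq
      ?_)
    filter_upwards [isOpen_Ioi.mem_nhds hr] with s hs
    exact if_pos hs
  have e2 : derivRadial (derivRadial (logProfile ρ G n)) (r, θ) =
      (deriv (deriv G) (Real.log r) - deriv G (Real.log r)) / (r : ℂ) ^ 2 * fourier n θ := by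
    refine HasDerivAt.deriv (((hasDerivAt_comp_log_div dG' hr).mul_const
      (fourier n θ)).congr_of_eventuallyEq ?_)
    filter_upwards [isOpen_Ioi.mem_nhds hr] with s hs
    exact e1 s hs θ
  have hF : ∀ (c : ℂ) (θ : AddCircle (2 * Real.pi * ρ)),
      HasDerivAt (fun s : ℝ => c * fourier n (θ + (s : AddCircle (2 * Real.pi * ρ))))
        (c * (Complex.I * (n / ρ : ℝ) * fourier n θ)) 0 := by
    intro c θ
    have h1 := hasDerivAt_fourier_coe (ρ := ρ) n 0
    rw [AddCircle.coe_zero, fourier_eval_zero, mul_one] at h1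
    have h2 := (h1.const_mul (c * fourier n θ)).congr_deriv
      (g' := c * (Complex.I * (n / ρ : ℝ) * fourier n θ)) (by ring)
    refine h2.congr_of_eventuallyEq (Eventually.of_forall fun s => ?_)
    simp only
    have : fourier n (θ + (s : AddCircle (2 * Real.pi * ρ))) =
        fourier n θ * fourier n (s : AddCircle (2 * Real.pi * ρ)) := by
      simp only [fourier_apply, smul_add, AddCircle.toCircle_add, Circle.coe_mul]
    rw [this]
    ring
  have e3 : ∀ θ, derivAngular (logProfile ρ G n) (r, θ) =
      G (Real.log r) * (Complex.I * (n / ρ : ℝ)) * fourier n θ := by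
    intro θ
    refine HasDerivAt.deriv ((hF (G (Real.log r)) θ).congr_of_eventuallyEq
      (Eventually.of_forall fun s => if_pos hr) |>.congr_deriv (by ring))
  have e4 : derivAngular (derivAngular (logProfile ρ G n)) (r, θ) =
      -(((n / ρ : ℝ) : ℂ) ^ 2 * G (Real.log r) * fourier n θ) := by
    refine HasDerivAt.deriv ((hF (G (Real.log r) * (Complex.I * (n / ρ : ℝ))) θ).congr_of_eventuallyEq
      (Eventually.of_forall fun s => e3 _) |>.congr_deriv ?_)
    linear_combination (((n / ρ : ℝ) : ℂ) ^ 2 * G (Real.log r) * fourier n θ) * Complex.I_sq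
  rw [laplacian_eq, e2, e1 r hr, e4]
  simp only
  field_simp
  ring

/-- No decay of `G` is required, since `φ` vanishes near the vertex and at infinity. -/
theorem IsTestFunction.green_log {φ : Polar ρ → ℂ} (h : IsTestFunction ρ φ) {G : ℝ → ℂ}
    (hG : ContDiff ℝ ∞ G) (n : ℤ) :
    ∫ p, laplacian ρ φ p * (G (Real.log p.1) * fourier n p.2) ∂coneMeasure ρ =
      ∫ p, φ p * ((((n / ρ : ℝ) : ℂ) ^ 2 * G (Real.log p.1) - deriv (deriv G) (Real.log p.1)) /
        (p.1 : ℂ) ^ 2 * fourier n p.2) ∂coneMeasure ρ := by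
  have hG1 := (contDiff_infty_iff_deriv.1 hG).2
  have hG2 := (contDiff_infty_iff_deriv.1 hG1).2
  have hlog : ContinuousOn Real.log (Set.Ioi 0) :=
    Real.continuousOn_log.mono fun r hr => ne_of_gt hr
  rw [h.green (fun r hr => hasDerivAt_comp_log (hG.differentiable (by simp)) hr)
    (fun r hr => hasDerivAt_comp_log_div (hG1.differentiable (by simp)) hr) ?_ n]
  · refine integral_congr_ae ?_
    filter_upwards [ae_cone] with p hp
    have hp0 : (p.1 : ℂ) ≠ 0 := by
      have : 0 < p.1 := hp
      exact_mod_cast this.ne'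
    congr 2
    field_simp
    ring
  · refine ContinuousOn.div ((hG2.continuous.comp_continuousOn hlog).sub
      (hG1.continuous.comp_continuousOn hlog)) (by fun_prop) fun r hr => ?_
    exact pow_ne_zero _ (by exact_mod_cast ne_of_gt hr)

end LogProfile

/-! ### The packets in logarithmic coordinates -/

section GaussProfile

/-- The radial profile of `gauss` as a function of `log r`. -/
def gaussProfile (ν : ℝ) (a : ℂ) (s : ℝ) : ℂ := Complex.exp (ν * s - a * Complex.exp (2 * s))

theorem contDiff_gaussProfile (ν : ℝ) (a : ℂ) : ContDiff ℝ ∞ (gaussProfile ν a) := by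
  have : ContDiff ℝ ∞ fun x : ℝ => (x : ℂ) := Complex.ofRealCLM.contDiff
  unfold gaussProfile
  fun_prop

theorem hasDerivAt_gaussProfile (ν : ℝ) (a : ℂ) (s : ℝ) : HasDerivAt (gaussProfile ν a)
    ((ν - 2 * a * Complex.exp (2 * s)) * gaussProfile ν a s) s := by
  have hid : HasDerivAt (fun r : ℝ => (r : ℂ)) 1 s := Complex.ofRealCLM.hasDerivAt
  refine (((hid.const_mul (ν : ℂ)).sub ((hid.const_mul 2).cexp.const_mul a)).cexp).congr_deriv ?_
  rw [gaussProfile]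
  simp only [mul_one, Pi.sub_apply]
  ring

theorem deriv_gaussProfile (ν : ℝ) (a : ℂ) : deriv (gaussProfile ν a) = fun s : ℝ =>
    (ν - 2 * a * Complex.exp (2 * s)) * gaussProfile ν a s :=
  funext fun s => (hasDerivAt_gaussProfile ν a s).deriv

/-- The terms `ν²` cancel, so what remains is divisible by `exp (2 s) = r²`: for `ν = |n| / ρ` the
Laplacian of a packet has no extra singularity at the vertex. -/
theorem deriv_deriv_gaussProfile (ν : ℝ) (a : ℂ) (s : ℝ) :
    (ν : ℂ) ^ 2 * gaussProfile ν a s - deriv (deriv (gaussProfile ν a)) s =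
    (4 * (ν + 1) * a * Complex.exp (2 * s) - 4 * a ^ 2 * Complex.exp (2 * s) ^ 2) *
      gaussProfile ν a s := by
  have hid : HasDerivAt (fun r : ℝ => (r : ℂ)) 1 s := Complex.ofRealCLM.hasDerivAt
  have h := ((((hid.const_mul 2).cexp.const_mul (2 * a)).const_sub (ν : ℂ)).mul
    (hasDerivAt_gaussProfile ν a s)).deriv
  rw [deriv_gaussProfile]
  have e : (fun s : ℝ => ((ν : ℂ) - 2 * a * Complex.exp (2 * s)) * gaussProfile ν a s) =
    (fun s : ℝ => (ν : ℂ) - 2 * a * Complex.exp (2 * s)) * gaussProfile ν a := rfl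
  rw [e, h]
  ring

theorem exp_two_mul_log {r : ℝ} (hr : 0 < r) :
    Complex.exp (2 * (Real.log r : ℂ)) = (r : ℂ) ^ 2 := by
  rw [two_mul, Complex.exp_add, ← Complex.ofReal_exp, Real.exp_log hr, sq]

variable {ρ : ℝ}

theorem gauss_eq_gaussProfile {ν : ℝ} {n : ℤ} {a : ℂ} {p : Polar ρ} (hp : p ∈ cone ρ) :
    gauss ρ ν n a p = gaussProfile ν a (Real.log p.1) * fourier n p.2 := by
  have hp : 0 < p.1 := hp
  rw [gauss, gaussProfile, exp_two_mul_log hp, Complex.exp_sub, Real.rpow_def_of_pos hp,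
    neg_mul, Complex.exp_neg, div_eq_mul_inv]
  push_cast
  rw [mul_comm (ν : ℂ)]

/-- The Laplacian of `gauss`, for `ν = |n| / ρ`. -/
def gaussLaplacian (ρ : ℝ) (ν : ℝ) (n : ℤ) (a : ℂ) (p : Polar ρ) : ℂ :=
  4 * (ν + 1) * a * gauss ρ ν n a p - 4 * a ^ 2 * gauss ρ (ν + 2) n a p

theorem gaussLaplacian_eq {ν : ℝ} {n : ℤ} {a : ℂ} {p : Polar ρ} (hp : p ∈ cone ρ) :
    gaussLaplacian ρ ν n a p = ((ν : ℂ) ^ 2 * gaussProfile ν a (Real.log p.1) -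
      deriv (deriv (gaussProfile ν a)) (Real.log p.1)) / (p.1 : ℂ) ^ 2 * fourier n p.2 := by
  have hp' : 0 < p.1 := hp
  have hp0 : (p.1 : ℂ) ≠ 0 := by exact_mod_cast hp'.ne'
  have h2 : gauss ρ (ν + 2) n a p = (p.1 : ℂ) ^ 2 * gauss ρ ν n a p := by
    rw [gauss, gauss, Real.rpow_add hp', Real.rpow_two]
    push_cast
    ring
  rw [deriv_deriv_gaussProfile, exp_two_mul_log hp', gaussLaplacian, h2, gauss_eq_gaussProfile hp]
  field_simp

theorem order_sq (n : ℤ) : ((n / ρ : ℝ) : ℂ) ^ 2 = ((order ρ n : ℝ) : ℂ) ^ 2 := by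
  rw [order, ← Complex.ofReal_pow, ← Complex.ofReal_pow, div_pow, div_pow, sq_abs]

variable [Fact (0 < ρ)]

/-- `gaussLaplacian` as a vector of `L²`. -/
def gaussLaplacianL2 (ρ : ℝ) [Fact (0 < ρ)] (ν : ℝ) (n : ℤ) (a : ℂ) : L2 ρ :=
  (4 * (ν + 1) * a) • gaussL2 ρ ν n a - (4 * a ^ 2) • gaussL2 ρ (ν + 2) n a

theorem coeFn_gaussLaplacianL2 {ν : ℝ} (hν : 0 ≤ ν) (n : ℤ) {a : ℂ} (ha : 0 < a.re) :
    gaussLaplacianL2 ρ ν n a =ᵐ[coneMeasure ρ] gaussLaplacian ρ ν n a := by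
  filter_upwards [coeFn_gaussL2 (ρ := ρ) hν (n := n) ha,
    coeFn_gaussL2 (ρ := ρ) (ν := ν + 2) (by linarith) (n := n) ha,
    Lp.coeFn_sub ((4 * (ν + 1) * a) • gaussL2 ρ ν n a) ((4 * a ^ 2) • gaussL2 ρ (ν + 2) n a),
    Lp.coeFn_smul (4 * (ν + 1) * a) (gaussL2 ρ ν n a),
    Lp.coeFn_smul (4 * a ^ 2) (gaussL2 ρ (ν + 2) n a)] with p h1 h2 h3 h4 h5
  rw [gaussLaplacianL2, h3, Pi.sub_apply, h4, h5, Pi.smul_apply, Pi.smul_apply, h1, h2]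
  rfl

theorem packetLaplacian_eq_smul (ν : ℝ) (n : ℤ) (b : ℂ) : packetLaplacian ρ ν n b =
    b ^ (-((ν + 1 : ℝ) : ℂ)) • gaussLaplacianL2 ρ ν n b⁻¹ := by
  rw [packetLaplacian, gaussLaplacianL2, inv_pow]
  rfl

/-- Test functions lie in the domain of the generator. -/
theorem minimalLaplacian_le : minimalLaplacian ρ ≤ (packetCore ρ).adjoint := by
  rintro ⟨u, w⟩ ⟨φ, hφ, hu, hw⟩
  simp only at hu hw
  rw [mem_adjoint_iff_inner]
  intro c hc
  refine Submodule.span_induction (p := fun c _ => (inner ℂ c.2 u : ℂ) = inner ℂ c.1 w)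
    ?_ ?_ ?_ ?_ hc
  · rintro _ ⟨⟨n, b, hb⟩, rfl⟩
    simp only
    have hν := order_nonneg ρ n
    have ha := inv_re_pos hb
    set ν := order ρ n with hνdef
    set a := b⁻¹
    rw [packetLaplacian_eq_smul, packet, inner_smul_left, inner_smul_left]
    congr 1
    rw [inner_gaussL2_left w hν n ha, gaussLaplacianL2, inner_sub_left, inner_smul_left,
      inner_smul_left, inner_gaussL2_left u hν n ha, inner_gaussL2_left u (by linarith) n ha,
      ← integral_const_mul, ← integral_const_mul]
    have hca : 0 < (conj a).re := by simpa using ha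
    rw [← integral_sub ((integrable_mul_gauss (Lp.memLp u) hν _ hca).const_mul _)
      ((integrable_mul_gauss (Lp.memLp u) (by linarith) _ hca).const_mul _)]
    have e1 : ∫ p, w p * gauss ρ ν (-n) (conj a) p ∂coneMeasure ρ = ∫ p, laplacian ρ φ p *
        (gaussProfile ν (conj a) (Real.log p.1) * fourier (-n) p.2) ∂coneMeasure ρ := by
      refine integral_congr_ae ?_
      filter_upwards [hw, ae_cone] with p h1 h2
      rw [h1, gauss_eq_gaussProfile h2]
    -- Green's formula moves the Laplacian from the test function to the conjugate packet, of
    -- frequency `-n`.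
    rw [e1, hφ.green_log (contDiff_gaussProfile _ _)]
    refine integral_congr_ae ?_
    filter_upwards [hu, ae_cone] with p h1 h2
    rw [h1, order_sq, order_neg, ← hνdef, ← gaussLaplacian_eq h2, gaussLaplacian]
    simp only [map_mul, map_add, map_pow, map_ofNat, Complex.conj_ofReal, map_one]
    ring
  · simp
  · intro x y _ _ hx hy
    rw [Prod.snd_add, Prod.fst_add, inner_add_left, inner_add_left, hx, hy]
  · intro c x _ hx
    rw [Prod.smul_snd, Prod.smul_fst, inner_smul_left, inner_smul_left, hx]

end GaussProfile

/-! ### Logarithmic cutoffs -/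

section Cutoff

/-- A smooth bump function. -/
def bump : ContDiffBump (0 : ℝ) := ⟨1, 2, one_pos, one_lt_two⟩

theorem bump_eq_one {x : ℝ} (hx : |x| ≤ 1) : bump x = 1 :=
  bump.one_of_mem_closedBall (by simpa [bump] using hx)

theorem bump_eq_zero {x : ℝ} (hx : 2 ≤ |x|) : bump x = 0 :=
  bump.zero_of_le_dist (by simpa [bump] using hx)

theorem contDiff_bump : ContDiff ℝ ∞ bump := bump.contDiff

theorem exists_bound_deriv_bump :
    ∃ C : ℝ, 1 ≤ C ∧ ∀ x, |deriv bump x| ≤ C ∧ |deriv (deriv bump) x| ≤ C := by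
  have c1 := (contDiff_infty_iff_deriv.1 contDiff_bump).2
  have c2 := (contDiff_infty_iff_deriv.1 c1).2
  obtain ⟨A, hA⟩ := c1.continuous.bounded_above_of_compact_support bump.hasCompactSupport.deriv
  obtain ⟨B, hB⟩ := c2.continuous.bounded_above_of_compact_support bump.hasCompactSupport.deriv.deriv
  exact ⟨max 1 (max A B), le_max_left _ _, fun x =>
    ⟨(hA x).trans ((le_max_left _ _).trans (le_max_right _ _)),
      (hB x).trans ((le_max_right _ _).trans (le_max_right _ _))⟩⟩

theorem deriv_deriv_bump_eq_zero {x : ℝ} (hx : 2 < |x|) : deriv (deriv bump) x = 0 := by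
  have h0 : ∀ y : ℝ, 2 < |y| → (bump : ℝ → ℝ) =ᶠ[𝓝 y] fun _ => 0 := by
    intro y hy
    filter_upwards [(isOpen_lt continuous_const continuous_abs).mem_nhds hy] with z hz
    exact bump_eq_zero (le_of_lt hz)
  have h1 : deriv bump =ᶠ[𝓝 x] fun _ => 0 := by
    filter_upwards [(isOpen_lt continuous_const continuous_abs).mem_nhds hx] with z hz
    rw [(h0 z hz).deriv_eq, deriv_const]
  rw [h1.deriv_eq, deriv_const]

/-- The cut-off profile `h (s / L) k (s)`. -/
def cutProfile (k : ℝ → ℂ) (L : ℝ) (s : ℝ) : ℂ := (bump (s / L) : ℂ) * k s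

theorem contDiff_cutProfile {k : ℝ → ℂ} (hk : ContDiff ℝ ∞ k) (L : ℝ) :
    ContDiff ℝ ∞ (cutProfile k L) := by
  have h1 : ContDiff ℝ ∞ fun s : ℝ => bump (s / L) := contDiff_bump.comp (by fun_prop)
  exact (Complex.ofRealCLM.contDiff.comp h1).mul hk

theorem hasDerivAt_scaled {h : ℝ → ℝ} (hh : Differentiable ℝ h) (L s : ℝ) :
    HasDerivAt (fun s : ℝ => ((h (s / L) : ℝ) : ℂ)) ((deriv h (s / L) / L : ℝ) : ℂ) s := by
  have h1 := ((hh (s / L)).hasDerivAt.comp s ((hasDerivAt_id s).div_const L)).ofReal_comp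
  refine h1.congr_deriv ?_
  congr 1
  ring

theorem deriv_deriv_cutProfile {k : ℝ → ℂ} (hk : ContDiff ℝ ∞ k) (L s : ℝ) :
    deriv (deriv (cutProfile k L)) s = (deriv (deriv bump) (s / L) / L ^ 2 : ℝ) * k s +
      2 * (deriv bump (s / L) / L : ℝ) * deriv k s + bump (s / L) * deriv (deriv k) s := by
  have hb := (contDiff_infty_iff_deriv.1 contDiff_bump).2
  have hk' := (contDiff_infty_iff_deriv.1 hk).2
  have db : Differentiable ℝ bump := contDiff_bump.differentiable (by simp)
  have db' : Differentiable ℝ (deriv bump) := hb.differentiable (by simp)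
  have dk : ∀ s, HasDerivAt k (deriv k s) s := fun s =>
    (hk.differentiable (by simp) s).hasDerivAt
  have dk' : ∀ s, HasDerivAt (deriv k) (deriv (deriv k) s) s := fun s =>
    (hk'.differentiable (by simp) s).hasDerivAt
  have e : deriv (cutProfile k L) = fun s : ℝ =>
      ((deriv bump (s / L) : ℝ) : ℂ) * ((L⁻¹ : ℝ) * k s) + (bump (s / L) : ℂ) * deriv k s := by
    funext s
    refine HasDerivAt.deriv (((hasDerivAt_scaled db L s).mul (dk s)).congr_deriv ?_)
    push_cast
    ring
  rw [e]
  refine HasDerivAt.deriv ((((hasDerivAt_scaled db' L s).mul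
    ((dk s).const_mul ((L⁻¹ : ℝ) : ℂ))).add
    ((hasDerivAt_scaled db L s).mul (dk' s))).congr_deriv ?_)
  push_cast
  ring

variable {ρ : ℝ} [Fact (0 < ρ)]

/-- Bound for the error committed on the Laplacian by a logarithmic cutoff. -/
def cutoffBound (ρ ν : ℝ) (n : ℤ) (a : ℂ) (p : Polar ρ) : ℝ :=
  ‖gaussLaplacian ρ ν n a p‖ + ‖(ν : ℂ) - 2 * a * p.1 ^ 2‖ / p.1 ^ 2 * ‖gauss ρ ν n a p‖ +
    1 / (p.1 ^ 2 * (1 + Real.log p.1 ^ 2)) * ‖gauss ρ ν n a p‖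

/-- The product rule gives three errors: `bump - 1` times the Laplacian, a first-order term with `1
/ L`, and `bump'' / L²`. The last gains the weight `1 / (1 + log² r)` from its support. The
essential point is uniformity in `L`. -/
theorem norm_laplacian_cutoff_sub_le {C : ℝ} (hC1 : 1 ≤ C)
    (hC : ∀ x, |deriv bump x| ≤ C ∧ |deriv (deriv bump) x| ≤ C) (n : ℤ) (a : ℂ) {L : ℝ}
    (hL : 1 ≤ L) {p : Polar ρ} (hp : p ∈ cone ρ) :
    ‖laplacian ρ (logProfile ρ (cutProfile (gaussProfile (order ρ n) a) L) n) p -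
      gaussLaplacian ρ (order ρ n) n a p‖ ≤ 5 * C * cutoffBound ρ (order ρ n) n a p := by
  have hp' : 0 < p.1 := hp
  set ν := order ρ n with hν
  set k := gaussProfile ν a with hk
  set s := Real.log p.1 with hs
  have hL0 : 0 < L := by linarith
  rw [laplacian_logProfile (contDiff_cutProfile (contDiff_gaussProfile _ _) _) n hp, order_sq,
    gaussLaplacian_eq hp, deriv_deriv_cutProfile (contDiff_gaussProfile _ _)]
  have hk' : ‖k s‖ = ‖gauss ρ ν n a p‖ := by
    rw [gauss_eq_gaussProfile hp, norm_mul, norm_fourier_apply, mul_one]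
  have hdk : deriv k s = ((ν : ℂ) - 2 * a * p.1 ^ 2) * k s := by
    rw [hk, deriv_gaussProfile, hs]
    beta_reduce
    rw [exp_two_mul_log hp']
  have hLap : ‖gaussLaplacian ρ ν n a p‖ = ‖((ν : ℂ) ^ 2 * k s - deriv (deriv k) s) /
      (p.1 : ℂ) ^ 2‖ := by
    rw [gaussLaplacian_eq hp, norm_mul, norm_fourier_apply, mul_one]
  have e : (((ν : ℂ) ^ 2 * cutProfile k L s - ((deriv (deriv bump) (s / L) / L ^ 2 : ℝ) * k s +
      2 * (deriv bump (s / L) / L : ℝ) * deriv k s + bump (s / L) * deriv (deriv k) s)) /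
        (p.1 : ℂ) ^ 2 * fourier n p.2 - ((ν : ℂ) ^ 2 * k s - deriv (deriv k) s) /
          (p.1 : ℂ) ^ 2 * fourier n p.2) =
      ((bump (s / L) - 1 : ℝ) * (((ν : ℂ) ^ 2 * k s - deriv (deriv k) s) / (p.1 : ℂ) ^ 2) -
        (2 * (deriv bump (s / L) / L) : ℝ) * (((ν : ℂ) - 2 * a * p.1 ^ 2) / (p.1 : ℂ) ^ 2 * k s) -
        (deriv (deriv bump) (s / L) / L ^ 2 : ℝ) * (k s / (p.1 : ℂ) ^ 2)) * fourier n p.2 := by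
    rw [hdk, cutProfile]
    push_cast
    ring
  rw [e, norm_mul, norm_fourier_apply, mul_one]
  have b0 : ‖((bump (s / L) - 1 : ℝ) : ℂ)‖ ≤ 1 := by
    rw [Complex.norm_real, Real.norm_eq_abs, abs_le]
    constructor <;> linarith [bump.nonneg (x := s / L), bump.le_one (x := s / L)]
  have b1 : ‖((2 * (deriv bump (s / L) / L) : ℝ) : ℂ)‖ ≤ 2 * C := by
    rw [Complex.norm_real, Real.norm_eq_abs, abs_mul, abs_div, abs_of_pos hL0, abs_two]
    have : |deriv bump (s / L)| / L ≤ C := by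
      rw [div_le_iff₀ hL0]
      nlinarith [(hC (s / L)).1]
    linarith
  -- The second derivative lives on `|s| ≤ 2 L`, where `1 + s² ≤ 5 L²` because `1 ≤ L`.
  have b2 : ‖((deriv (deriv bump) (s / L) / L ^ 2 : ℝ) : ℂ)‖ ≤ 5 * C / (1 + s ^ 2) := by
    rw [Complex.norm_real, Real.norm_eq_abs, abs_div, abs_of_pos (by positivity : 0 < L ^ 2)]
    by_cases hx : 2 < |s / L|
    · rw [deriv_deriv_bump_eq_zero hx, abs_zero, zero_div]
      positivity
    · push Not at hx
      rw [abs_div, abs_of_pos hL0, div_le_iff₀ hL0] at hx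
      have hs2 : s ^ 2 ≤ 4 * L ^ 2 := by
        rw [← sq_abs]
        nlinarith [abs_nonneg s]
      rw [div_le_div_iff₀ (by positivity) (by positivity)]
      have := (hC (s / L)).2
      calc |deriv (deriv bump) (s / L)| * (1 + s ^ 2) ≤ C * (5 * L ^ 2) := by
            gcongr
            nlinarith
        _ = 5 * C * L ^ 2 := by ring
  have hr2 : ‖(p.1 : ℂ) ^ 2‖ = p.1 ^ 2 := by
    rw [norm_pow, Complex.norm_real, Real.norm_of_nonneg hp'.le]
  calc _ ≤ ‖((bump (s / L) - 1 : ℝ) : ℂ)‖ * ‖((ν : ℂ) ^ 2 * k s - deriv (deriv k) s) /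
        (p.1 : ℂ) ^ 2‖ + ‖((2 * (deriv bump (s / L) / L) : ℝ) : ℂ)‖ *
          ‖((ν : ℂ) - 2 * a * p.1 ^ 2) / (p.1 : ℂ) ^ 2 * k s‖ +
        ‖((deriv (deriv bump) (s / L) / L ^ 2 : ℝ) : ℂ)‖ * ‖k s / (p.1 : ℂ) ^ 2‖ := by
        rw [← norm_mul, ← norm_mul, ← norm_mul]
        exact (norm_sub_le _ _).trans (add_le_add_left (norm_sub_le _ _) _)
    _ ≤ 1 * ‖gaussLaplacian ρ ν n a p‖ + 2 * C * (‖(ν : ℂ) - 2 * a * p.1 ^ 2‖ / p.1 ^ 2 *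
          ‖gauss ρ ν n a p‖) + 5 * C / (1 + s ^ 2) * (‖gauss ρ ν n a p‖ / p.1 ^ 2) := by
        rw [hLap, norm_mul (_ / _) (k s),
          norm_div ((ν : ℂ) - 2 * a * p.1 ^ 2) ((p.1 : ℂ) ^ 2), norm_div (k s), hr2, hk']
        gcongr
    _ ≤ 5 * C * ‖gaussLaplacian ρ ν n a p‖ + 5 * C * (‖(ν : ℂ) - 2 * a * p.1 ^ 2‖ / p.1 ^ 2 *
          ‖gauss ρ ν n a p‖) + 5 * C / (1 + s ^ 2) * (‖gauss ρ ν n a p‖ / p.1 ^ 2) := by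
        gcongr <;> linarith
    _ = _ := by
        rw [cutoffBound, ← hs]
        field_simp

/-- The approximants are cut off at scale `|log r| ~ N + 1`. Their Laplacians are only shown to be
dominated; smallness in the form comes from the other factor, which at each point is eventually
zero. -/
theorem exists_cutoff (n : ℤ) {a : ℂ} (ha : 0 < a.re) :
    ∃ A : ℕ → L2 ρ × L2 ρ, (∀ N, A N ∈ minimalLaplacian ρ) ∧
      (∀ N, ∀ᵐ p ∂coneMeasure ρ, ‖((A N).1 - gaussL2 ρ (order ρ n) n a) p‖ ≤
        ‖gauss ρ (order ρ n) n a p‖) ∧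
      (∀ᵐ p ∂coneMeasure ρ, ∀ᶠ N in atTop, ((A N).1 - gaussL2 ρ (order ρ n) n a) p = 0) ∧
      ∃ C : ℝ, ∀ N, ∀ᵐ p ∂coneMeasure ρ, ‖((A N).2 - gaussLaplacianL2 ρ (order ρ n) n a) p‖ ≤
        C * cutoffBound ρ (order ρ n) n a p := by
  set ν := order ρ n with hν
  have hν0 : 0 ≤ ν := order_nonneg ρ n
  obtain ⟨C, hC1, hC⟩ := exists_bound_deriv_bump
  set φ : ℕ → Polar ρ → ℂ := fun N => logProfile ρ (cutProfile (gaussProfile ν a) (N + 1)) n with hφ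
  have hL : ∀ N : ℕ, (1 : ℝ) ≤ (N : ℝ) + 1 := fun N => by linarith [(N.cast_nonneg : (0 : ℝ) ≤ N)]
  have ht : ∀ N, IsTestFunction ρ (φ N) := fun N =>
    isTestFunction_logProfile (contDiff_cutProfile (contDiff_gaussProfile _ _) _)
      (M := 2 * ((N : ℝ) + 1)) (fun s hs => by
        rw [cutProfile, bump_eq_zero, Complex.ofReal_zero, zero_mul]
        rw [abs_div, abs_of_pos (lt_of_lt_of_le one_pos (hL N)),
          le_div_iff₀ (lt_of_lt_of_le one_pos (hL N))]
        exact hs.le) n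
  have c1 : ∀ N, (ht N).memLp.toLp _ =ᵐ[coneMeasure ρ] φ N := fun N => MemLp.coeFn_toLp _
  have c2 : ∀ N, (ht N).memLp_laplacian.toLp _ =ᵐ[coneMeasure ρ] laplacian ρ (φ N) :=
    fun N => MemLp.coeFn_toLp _
  have d1 : ∀ N, ∀ᵐ p ∂coneMeasure ρ, ((ht N).memLp.toLp _ - gaussL2 ρ ν n a) p =
      ((bump (Real.log p.1 / (N + 1)) - 1 : ℝ) : ℂ) * gauss ρ ν n a p := by
    intro N
    filter_upwards [c1 N, Lp.coeFn_sub ((ht N).memLp.toLp _) (gaussL2 ρ ν n a),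
      coeFn_gaussL2 (ρ := ρ) hν0 (n := n) ha, ae_cone] with p h1 h2 h3 h4
    rw [h2, Pi.sub_apply, h1, h3]
    simp only [hφ]
    rw [logProfile_of_pos _ _ h4, cutProfile, gauss_eq_gaussProfile h4]
    push_cast
    ring
  refine ⟨fun N => ((ht N).memLp.toLp _, (ht N).memLp_laplacian.toLp _),
    fun N => ⟨φ N, ht N, c1 N, c2 N⟩, fun N => ?_, ?_, 5 * C, fun N => ?_⟩
  · filter_upwards [d1 N] with p hp
    rw [hp, norm_mul, Complex.norm_real, Real.norm_eq_abs]
    refine mul_le_of_le_one_left (norm_nonneg _) ?_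
    rw [abs_le]
    constructor <;> linarith [bump.nonneg (x := Real.log p.1 / (N + 1)),
      bump.le_one (x := Real.log p.1 / (N + 1))]
  · filter_upwards [ae_all_iff.2 d1] with p hp
    obtain ⟨N0, hN0⟩ := exists_nat_ge |Real.log p.1|
    filter_upwards [eventually_ge_atTop N0] with N hN
    rw [hp N, bump_eq_one, sub_self, Complex.ofReal_zero, zero_mul]
    rw [abs_div, abs_of_pos (lt_of_lt_of_le one_pos (hL N)),
      div_le_iff₀ (lt_of_lt_of_le one_pos (hL N))]
    have : (N0 : ℝ) ≤ N := by exact_mod_cast hN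
    linarith
  · filter_upwards [c2 N, Lp.coeFn_sub ((ht N).memLp_laplacian.toLp _) (gaussLaplacianL2 ρ ν n a),
      coeFn_gaussLaplacianL2 (ρ := ρ) hν0 n ha, ae_cone] with p h1 h2 h3 h4
    rw [h2, Pi.sub_apply, h1, h3]
    exact norm_laplacian_cutoff_sub_le hC1 hC n a (hL N) h4

/-- The substitution `r = exp s` turns the radial integral into `∫ ds / (1 + s²)`. Without the
logarithmic weight, `1 / r²` would diverge on the cone. -/
theorem integrable_inv_one_add_log_sq :
    Integrable (fun p : Polar ρ => 1 / (p.1 ^ 2 * (1 + Real.log p.1 ^ 2))) (coneMeasure ρ) := by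
  have h1 : IntegrableOn (fun r : ℝ => 1 / (r * (1 + Real.log r ^ 2))) (Set.Ioi 0) := by
    have himg : Set.Ioi (0 : ℝ) = Real.exp '' Set.univ := by
      rw [Set.image_univ, Real.range_exp]
    rw [himg, integrableOn_image_iff_integrableOn_abs_deriv_smul MeasurableSet.univ
      (fun x _ => (Real.hasDerivAt_exp x).hasDerivWithinAt) Real.exp_injective.injOn]
    refine (integrable_inv_one_add_sq.integrableOn).congr_fun (fun s _ => ?_) MeasurableSet.univ
    have := Real.exp_pos s
    simp only [Real.log_exp, smul_eq_mul, abs_of_pos this]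
    field_simp
  have h2 : Integrable (fun r : ℝ => 1 / (r ^ 2 * (1 + Real.log r ^ 2))) radialMeasure := by
    rw [integrable_radialMeasure_iff]
    refine h1.congr_fun (fun r hr => ?_) measurableSet_Ioi
    have hr : 0 < r := hr
    simp only [smul_eq_mul]
    field_simp
  exact h2.comp_fst _

/-- The Laplacian term pairs two `L²` functions, and the logarithmic term is borderline only when
both indices are `0`. The bound `cutoffBound` itself need not be square integrable. -/
theorem integrable_gauss_mul_cutoffBound {n m : ℤ} {a b : ℂ} (ha : 0 < a.re) (hb : 0 < b.re) :
    Integrable (fun p => ‖gauss ρ (order ρ n) n a p‖ * cutoffBound ρ (order ρ m) m b p)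
      (coneMeasure ρ) := by
  set ν := order ρ n with hν
  set μ := order ρ m with hμ
  have hν0 : 0 ≤ ν := order_nonneg ρ n
  have hμ0 : 0 ≤ μ := order_nonneg ρ m
  have hab : 0 < (a + b).re := by
    rw [Complex.add_re]
    linarith
  have m1 := memLp_gauss (ρ := ρ) hν0 (n := n) ha
  have m2 : MemLp (gaussLaplacian ρ μ m b) 2 (coneMeasure ρ) :=
    (Lp.memLp _).ae_eq (coeFn_gaussLaplacianL2 hμ0 m hb)
  have i1 : Integrable (fun p => ‖gauss ρ ν n a p‖ * ‖gaussLaplacian ρ μ m b p‖)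
      (coneMeasure ρ) := m1.norm.integrable_mul m2.norm
  have i2 : Integrable (fun p => ‖gauss ρ ν n a p‖ * (‖(μ : ℂ) - 2 * b * p.1 ^ 2‖ / p.1 ^ 2 *
      ‖gauss ρ μ m b p‖)) (coneMeasure ρ) := by
    have j1 : Integrable (fun p => μ * ‖gauss ρ (ν + μ - 2) (n + m) (a + b) p‖)
        (coneMeasure ρ) := by
      -- The singular power `r ^ (ν + μ - 2)` comes with the coefficient `μ`: either it is absent or
      -- its exponent exceeds `-2`.
      rcases hμ0.eq_or_lt with h | h
      · rw [← h]
        simp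
      · exact (integrable_gauss (by linarith) hab).norm.const_mul _
    have j2 : Integrable (fun p => 2 * ‖b‖ * ‖gauss ρ (ν + μ) (n + m) (a + b) p‖)
        (coneMeasure ρ) := (integrable_gauss (by linarith) hab).norm.const_mul _
    refine (j1.add j2).mono' ?_ ?_
    · refine aestronglyMeasurable_gauss.norm.mul (AEStronglyMeasurable.mul ?_
        aestronglyMeasurable_gauss.norm)
      exact Measurable.aestronglyMeasurable (by fun_prop)
    · filter_upwards [ae_cone] with p hp
      have hp' : 0 < p.1 := hp
      have e1 : ‖gauss ρ (ν + μ - 2) (n + m) (a + b) p‖ =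
          ‖gauss ρ (ν + μ) (n + m) (a + b) p‖ / p.1 ^ 2 := by
        rw [norm_gauss hp, norm_gauss hp, Real.rpow_sub hp', Real.rpow_two]
        ring
      rw [Real.norm_of_nonneg (by positivity), Pi.add_apply, e1, ← gauss_mul_gauss hp, norm_mul]
      have e2 : ‖(μ : ℂ) - 2 * b * p.1 ^ 2‖ ≤ μ + 2 * ‖b‖ * p.1 ^ 2 := by
        refine (norm_sub_le _ _).trans ?_
        simp [abs_of_nonneg hμ0]
      calc _ ≤ ‖gauss ρ ν n a p‖ * ((μ + 2 * ‖b‖ * p.1 ^ 2) / p.1 ^ 2 * ‖gauss ρ μ m b p‖) := by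
            gcongr
        _ = _ := by
          field_simp
  have i3 : Integrable (fun p => ‖gauss ρ ν n a p‖ * (1 / (p.1 ^ 2 * (1 + Real.log p.1 ^ 2)) *
      ‖gauss ρ μ m b p‖)) (coneMeasure ρ) := by
    refine (integrable_inv_one_add_log_sq.add (integrable_gauss (ρ := ρ) (ν := ν + μ) (n := n + m)
      (by linarith) hab).norm).mono' ?_ ?_
    · refine aestronglyMeasurable_gauss.norm.mul (AEStronglyMeasurable.mul ?_
        aestronglyMeasurable_gauss.norm)
      exact Measurable.aestronglyMeasurable (by fun_prop)
    · filter_upwards [ae_cone] with p hp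
      have hp' : 0 < p.1 := hp
      rw [Real.norm_of_nonneg (by positivity), Pi.add_apply]
      have e : ‖gauss ρ ν n a p‖ * (1 / (p.1 ^ 2 * (1 + Real.log p.1 ^ 2)) * ‖gauss ρ μ m b p‖) =
          1 / (p.1 ^ 2 * (1 + Real.log p.1 ^ 2)) * ‖gauss ρ (ν + μ) (n + m) (a + b) p‖ := by
        rw [← gauss_mul_gauss hp, norm_mul]
        ring
      rw [e]
      -- Near the vertex the Gaussian factor is at most `1` and the logarithmic weight is
      -- integrable; away from it the roles are exchanged.
      rcases le_total p.1 1 with h1 | h1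
      · have : ‖gauss ρ (ν + μ) (n + m) (a + b) p‖ ≤ 1 := by
          rw [norm_gauss hp]
          refine mul_le_one₀ (Real.rpow_le_one hp'.le h1 (by linarith)) (Real.exp_pos _).le ?_
          rw [Real.exp_le_one_iff]
          nlinarith [sq_nonneg p.1]
        exact (mul_le_of_le_one_right (by positivity) this).trans
          (le_add_of_nonneg_right (norm_nonneg _))
      · have : 1 / (p.1 ^ 2 * (1 + Real.log p.1 ^ 2)) ≤ 1 := by
          rw [div_le_one (by positivity)]
          nlinarith [sq_nonneg (Real.log p.1), mul_self_le_mul_self zero_le_one h1]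
        exact (mul_le_of_le_one_left (norm_nonneg _) this).trans
          (le_add_of_nonneg_left (by positivity))
  refine ((i1.add i2).add i3).congr (Eventually.of_forall fun p => ?_)
  simp only [Pi.add_apply, cutoffBound]
  ring

/-- Dominated convergence for inner products in `L²`. -/
theorem tendsto_inner_of_dominated {u w : ℕ → L2 ρ} {g B : Polar ρ → ℝ} {C : ℝ}
    (hu : ∀ N, ∀ᵐ p ∂coneMeasure ρ, ‖u N p‖ ≤ g p)
    (hu0 : ∀ᵐ p ∂coneMeasure ρ, ∀ᶠ N in atTop, u N p = 0)
    (hw : ∀ N, ∀ᵐ p ∂coneMeasure ρ, ‖w N p‖ ≤ C * B p)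
    (hint : Integrable (fun p => g p * B p) (coneMeasure ρ)) :
    Tendsto (fun N => (inner ℂ (u N) (w N) : ℂ)) atTop (𝓝 0) := by
  simp only [L2.inner_def]
  have h := tendsto_integral_of_dominated_convergence (μ := coneMeasure ρ)
    (F := fun N p => (inner ℂ (u N p) (w N p) : ℂ)) (f := fun _ => 0)
    (fun p => C * (g p * B p)) (fun N => (L2.integrable_inner (𝕜 := ℂ) (u N) (w N)).1)
    (hint.const_mul C) ?_ ?_
  · simpa using h
  · intro N
    filter_upwards [hu N, hw N] with p h1 h2
    calc ‖(inner ℂ (u N p) (w N p) : ℂ)‖ ≤ ‖u N p‖ * ‖w N p‖ := norm_inner_le_norm _ _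
      _ ≤ g p * (C * B p) := mul_le_mul h1 h2 (norm_nonneg _) ((norm_nonneg _).trans h1)
      _ = _ := by ring
  · filter_upwards [hu0] with p hp
    refine tendsto_const_nhds.congr' ?_
    filter_upwards [hp] with N hN
    rw [hN, inner_zero_left]

theorem tendsto_inner_sum {ι H : Type*} [NormedAddCommGroup H] [InnerProductSpace ℂ H]
    (s : Finset ι) (κ : ι → ℂ) {x y : ι → ℕ → H}
    (h : ∀ i j, Tendsto (fun N => (inner ℂ (x i N) (y j N) : ℂ)) atTop (𝓝 0)) :
    Tendsto (fun N => (inner ℂ (∑ i ∈ s, κ i • x i N) (∑ j ∈ s, κ j • y j N) : ℂ))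
      atTop (𝓝 0) := by
  have e : ∀ N, (inner ℂ (∑ i ∈ s, κ i • x i N) (∑ j ∈ s, κ j • y j N) : ℂ) =
      ∑ i ∈ s, ∑ j ∈ s, conj (κ i) * κ j * inner ℂ (x i N) (y j N) := by
    intro N
    rw [sum_inner]
    refine Finset.sum_congr rfl fun i _ => ?_
    rw [inner_sum]
    refine Finset.sum_congr rfl fun j _ => ?_
    rw [inner_smul_left, inner_smul_right, mul_assoc]
  simp only [e]
  have := tendsto_finsetSum s fun i _ => tendsto_finsetSum s fun j _ =>
    (h i j).const_mul (conj (κ i) * κ j)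
  simpa using this

/-- Test functions are dense in the span of the packets for the norm of the form. -/
theorem exists_approx_packetCore {c : L2 ρ × L2 ρ} (hc : c ∈ packetCore ρ) {ε : ℝ} (hε : 0 < ε) :
    ∃ a ∈ minimalLaplacian ρ, ‖a.1 - c.1‖ < ε ∧ ‖(inner ℂ (a.1 - c.1) (a.2 - c.2) : ℂ)‖ < ε := by
  have hA := fun i : PacketIndex => exists_cutoff (ρ := ρ) i.1 (inv_re_pos i.2.2)
  choose A hA1 hA2 hA3 hA4 using hA
  choose C hC using hA4
  set v : PacketIndex → L2 ρ := fun i => gaussL2 ρ (order ρ i.1) i.1 (i.2 : ℂ)⁻¹ with hv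
  set w : PacketIndex → L2 ρ := fun i => gaussLaplacianL2 ρ (order ρ i.1) i.1 (i.2 : ℂ)⁻¹ with hw
  obtain ⟨f, h1, h2⟩ := exists_inner_packetCore hc
  set κ : PacketIndex → ℂ := fun i => f i * (i.2 : ℂ) ^ (-((order ρ i.1 + 1 : ℝ) : ℂ)) with hκ
  have h1' : c.1 = ∑ i ∈ f.support, κ i • v i := by
    rw [h1, Finsupp.sum]
    refine Finset.sum_congr rfl fun i _ => ?_
    rw [packet, smul_smul]
  have h2' : c.2 = ∑ i ∈ f.support, κ i • w i := by
    rw [h2, Finsupp.sum]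
    refine Finset.sum_congr rfl fun i _ => ?_
    rw [packetLaplacian_eq_smul, smul_smul]
  set a : ℕ → L2 ρ × L2 ρ := fun N => ∑ i ∈ f.support, κ i • A i N with ha
  have e1 : ∀ N, (a N).1 - c.1 = ∑ i ∈ f.support, κ i • ((A i N).1 - v i) := by
    intro N
    rw [h1', ha, Prod.fst_sum, ← Finset.sum_sub_distrib]
    simp only [Prod.smul_fst, smul_sub]
  have e2 : ∀ N, (a N).2 - c.2 = ∑ i ∈ f.support, κ i • ((A i N).2 - w i) := by
    intro N
    rw [h2', ha, Prod.snd_sum, ← Finset.sum_sub_distrib]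
    simp only [Prod.smul_snd, smul_sub]
  -- Convergence in `L²` is the same dominated convergence, with the packets themselves as majorants
  -- on both sides.
  have t1 : Tendsto (fun N => (inner ℂ ((a N).1 - c.1) ((a N).1 - c.1) : ℂ)) atTop (𝓝 0) := by
    simp only [e1]
    refine tendsto_inner_sum _ _ fun i j => ?_
    exact tendsto_inner_of_dominated (hA2 i) (hA3 i) (w := fun N => (A j N).1 - v j)
      (C := 1) (B := fun p => ‖gauss ρ (order ρ j.1) j.1 (j.2 : ℂ)⁻¹ p‖)
      (fun N => by simpa using hA2 j N)
      ((memLp_gauss (order_nonneg ρ _) (inv_re_pos i.2.2)).norm.integrable_mul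
        (memLp_gauss (order_nonneg ρ _) (inv_re_pos j.2.2)).norm)
  have t2 : Tendsto (fun N => (inner ℂ ((a N).1 - c.1) ((a N).2 - c.2) : ℂ)) atTop (𝓝 0) := by
    simp only [e1, e2]
    refine tendsto_inner_sum _ _ fun i j => ?_
    exact tendsto_inner_of_dominated (hA2 i) (hA3 i) (hC j)
      (integrable_gauss_mul_cutoffBound (inv_re_pos i.2.2) (inv_re_pos j.2.2))
  have n1 := t1.norm
  have n2 := t2.norm
  rw [norm_zero] at n1 n2
  obtain ⟨N, hN1, hN2⟩ := ((n1.eventually (gt_mem_nhds (by positivity : 0 < ε ^ 2))).and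
    (n2.eventually (gt_mem_nhds hε))).exists
  refine ⟨a N, ?_, ?_, hN2⟩
  · exact Submodule.sum_mem _ fun i _ => Submodule.smul_mem _ _ (hA1 i N)
  · rw [inner_self_eq_norm_sq_to_K, norm_pow, RCLike.norm_ofReal, abs_norm] at hN1
    exact lt_of_pow_lt_pow_left₀ 2 hε.le hN1

theorem friedrichsLaplacian_eq : friedrichsLaplacian ρ = (packetCore ρ).adjoint :=
  friedrichs_eq_adjoint packetCore_le_adjoint adjoint_packetCore_subset_closure
    (fun _ hc => packetCore_pos hc) minimalLaplacian_le
    (fun _ hc _ hε => exists_approx_packetCore hc hε)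

end Cutoff

/-! ### Bessel functions -/

section Bessel

/-- The terms of the power series of the Bessel function. -/
def besselTerm (ν x : ℝ) (k : ℕ) : ℝ :=
  (-1) ^ k / ((k.factorial : ℝ) * Real.Gamma (ν + k + 1)) * (x / 2) ^ (ν + 2 * k)

/-- Restrict the Gamma integral to `x > M`, where `x ^ ν ≥ M ^ ν`. This elementary lower bound
provides uniformity in the order of the Bessel function. -/
theorem rpow_mul_exp_neg_le_Gamma {ν M : ℝ} (hν : 0 ≤ ν) (hM : 0 < M) :
    M ^ ν * Real.exp (-M) ≤ Real.Gamma (ν + 1) := by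
  have hi := Real.GammaIntegral_convergent (s := ν + 1) (by linarith)
  rw [Real.Gamma_eq_integral (by linarith)]
  have h1 : IntegrableOn (fun x : ℝ => M ^ ν * Real.exp (-x)) (Set.Ioi M) :=
    (integrableOn_exp_neg_Ioi M).const_mul _
  calc M ^ ν * Real.exp (-M) = ∫ x in Set.Ioi M, M ^ ν * Real.exp (-x) := by
        rw [integral_const_mul, integral_exp_neg_Ioi]
    _ ≤ ∫ x in Set.Ioi M, Real.exp (-x) * x ^ (ν + 1 - 1) := by
        refine setIntegral_mono_on h1 (hi.mono_set (Set.Ioi_subset_Ioi hM.le)) measurableSet_Ioi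
          fun x hx => ?_
        rw [mul_comm, add_sub_cancel_right]
        have := Real.rpow_le_rpow hM.le (le_of_lt (show M < x from hx)) hν
        gcongr
    _ ≤ _ := by
        refine setIntegral_mono_set hi ?_ (Set.Ioi_subset_Ioi hM.le).eventuallyLE
        filter_upwards [ae_restrict_mem measurableSet_Ioi] with x hx
        have : 0 < x := hx
        positivity

/-- The Gamma factor absorbs `x ^ (ν + k)` at the price of `exp x`, and the `2` in `x / 2` leaves `2
^ (-ν)`. This geometric decay in `ν` is what makes the sum over the frequencies converge. -/
theorem norm_besselTerm_le {ν x : ℝ} (hν : 0 ≤ ν) (hx : 0 < x) (k : ℕ) :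
    ‖besselTerm ν x k‖ ≤ 2 ^ (-ν) * Real.exp x * ((x / 2) ^ k / (k.factorial : ℝ)) := by
  have hk : (0 : ℝ) ≤ k := k.cast_nonneg
  have hG : 0 < Real.Gamma (ν + k + 1) := Real.Gamma_pos_of_pos (by linarith)
  have h1 := rpow_mul_exp_neg_le_Gamma (ν := ν + k) (by linarith) hx
  have hkf : (0 : ℝ) < k.factorial := by positivity
  have e1 : (x / 2) ^ (ν + 2 * k) = (x / 2) ^ k * (x / 2) ^ (ν + k) := by
    rw [← Real.rpow_natCast (x / 2) k, ← Real.rpow_add (by positivity)]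
    congr 1
    ring
  have e2 : (x / 2) ^ (ν + k) ≤ 2 ^ (-ν) * Real.exp x * Real.Gamma (ν + k + 1) := by
    rw [Real.div_rpow hx.le zero_le_two]
    have h2 : (2 : ℝ) ^ ν ≤ 2 ^ (ν + k) := Real.rpow_le_rpow_of_exponent_le one_le_two (by linarith)
    have h3 : x ^ (ν + k) ≤ Real.exp x * Real.Gamma (ν + k + 1) := by
      rw [Real.exp_neg, ← div_eq_mul_inv, div_le_iff₀ (Real.exp_pos _)] at h1
      linarith
    rw [Real.rpow_neg zero_le_two, div_le_iff₀ (by positivity)]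
    calc x ^ (ν + k) ≤ Real.exp x * Real.Gamma (ν + k + 1) := h3
      _ = (2 ^ ν)⁻¹ * Real.exp x * Real.Gamma (ν + k + 1) * 2 ^ ν := by field_simp
      _ ≤ _ := by gcongr
  rw [besselTerm, norm_mul, norm_div, norm_pow, norm_neg, norm_one, one_pow,
    Real.norm_of_nonneg (by positivity), Real.norm_of_nonneg (by positivity), e1]
  calc 1 / ((k.factorial : ℝ) * Real.Gamma (ν + k + 1)) * ((x / 2) ^ k * (x / 2) ^ (ν + k)) ≤
        1 / ((k.factorial : ℝ) * Real.Gamma (ν + k + 1)) *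
          ((x / 2) ^ k * (2 ^ (-ν) * Real.exp x * Real.Gamma (ν + k + 1))) := by gcongr
    _ = _ := by field_simp

theorem summable_besselTerm {ν x : ℝ} (hν : 0 ≤ ν) (hx : 0 < x) : Summable (besselTerm ν x) :=
  Summable.of_norm_bounded ((Real.summable_pow_div_factorial (x / 2)).mul_left _)
    (norm_besselTerm_le hν hx)

theorem hasSum_besselTerm {ν x : ℝ} (hν : 0 ≤ ν) (hx : 0 < x) :
    HasSum (besselTerm ν x) (besselJ ν x) :=
  (summable_besselTerm hν hx).hasSum

theorem abs_besselJ_le {ν x : ℝ} (hν : 0 ≤ ν) (hx : 0 < x) :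
    |besselJ ν x| ≤ 2 ^ (-ν) * Real.exp (2 * x) := by
  have h := tsum_of_norm_bounded
    ((NormedSpace.expSeries_div_hasSum_exp (x / 2)).mul_left (2 ^ (-ν) * Real.exp x))
    (norm_besselTerm_le hν hx)
  rw [← Real.exp_eq_exp_ℝ] at h
  refine h.trans ?_
  rw [mul_assoc, ← Real.exp_add]
  have : x + x / 2 ≤ 2 * x := by linarith
  gcongr

theorem continuousOn_besselJ {ν : ℝ} (hν : 0 ≤ ν) : ContinuousOn (besselJ ν) (Set.Ioi 0) := by
  intro x hx
  have hx : 0 < x := hx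
  have h : ContinuousOn (besselJ ν) (Set.Ioo 0 (x + 1)) := by
    refine continuousOn_tsum (u := fun k : ℕ => 2 ^ (-ν) * Real.exp (x + 1) *
      (((x + 1) / 2) ^ k / (k.factorial : ℝ))) (fun k => ?_)
      ((Real.summable_pow_div_factorial _).mul_left _) (fun k y hy => ?_)
    · refine continuousOn_const.mul (ContinuousOn.rpow_const (by fun_prop) fun y hy => Or.inl ?_)
      have := hy.1
      positivity
    · refine (norm_besselTerm_le hν hy.1 k).trans ?_
      have h1 := hy.1.le
      have h2 := hy.2.le
      gcongr
  exact (h.continuousAt (Ioo_mem_nhds hx (by linarith))).continuousWithinAt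

/-- The Weber integral of the Bessel function against a Gaussian. -/
theorem integral_besselJ_mul_gaussian {ν κ : ℝ} (hν : 0 ≤ ν) (hκ : 0 < κ) {c : ℂ}
    (hc : 0 < c.re) :
    ∫ s in Set.Ioi (0 : ℝ), (besselJ ν (κ * s) : ℂ) *
        (((s ^ (ν + 1) : ℝ) : ℂ) * Complex.exp (-c * s ^ 2)) =
      (((κ / 2) ^ ν / 2 : ℝ) : ℂ) * c ^ (-((ν + 1 : ℝ) : ℂ)) *
        Complex.exp (-κ ^ 2 / (4 * c)) := by
  set w : ℕ → ℝ := fun k => (-1) ^ k / ((k.factorial : ℝ) * Real.Gamma (ν + k + 1)) *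
    (κ / 2) ^ (ν + 2 * k) with hw
  set F : ℕ → ℝ → ℂ := fun k s => (w k : ℂ) *
    (((s ^ (2 * (ν + k) + 1) : ℝ) : ℂ) * Complex.exp (-c * s ^ 2)) with hF
  have hk : ∀ k : ℕ, (0 : ℝ) ≤ k := fun k => k.cast_nonneg
  have hG : ∀ k : ℕ, 0 < Real.Gamma (ν + k + 1) := fun k =>
    Real.Gamma_pos_of_pos (by linarith [hk k])
  have hterm : ∀ s ∈ Set.Ioi (0 : ℝ), HasSum (fun k => F k s) ((besselJ ν (κ * s) : ℂ) *
        (((s ^ (ν + 1) : ℝ) : ℂ) * Complex.exp (-c * s ^ 2))) := by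
    intro s hs
    have hs : 0 < s := hs
    have h := (Complex.hasSum_ofReal.2 (hasSum_besselTerm hν (mul_pos hκ hs))).mul_right
      (((s ^ (ν + 1) : ℝ) : ℂ) * Complex.exp (-c * s ^ 2))
    refine h.congr_fun fun k => ?_
    have e : besselTerm ν (κ * s) k * s ^ (ν + 1) = w k * s ^ (2 * (ν + k) + 1) := by
      rw [besselTerm, hw, show κ * s / 2 = κ / 2 * s by ring, Real.mul_rpow (by positivity) hs.le,
        show 2 * (ν + k) + 1 = (ν + 2 * k) + (ν + 1) by ring, Real.rpow_add hs (ν + 2 * k)]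
      ring
    simp only [hF]
    rw [← mul_assoc, ← mul_assoc, ← Complex.ofReal_mul, ← Complex.ofReal_mul, e]
  have hint : ∀ k, IntegrableOn (F k) (Set.Ioi 0) := fun k =>
    (integrableOn_rpow_mul_cexp_neg_mul_sq (by linarith [hk k]) hc).const_mul _
  -- Stated for every `c`, since it is applied at `c` for the sum and at `Re c` for the `L¹` norms.
  have hval : ∀ k : ℕ, ∀ c : ℂ, 0 < c.re → ∫ s in Set.Ioi (0 : ℝ), (w k : ℂ) *
      (((s ^ (2 * (ν + k) + 1) : ℝ) : ℂ) * Complex.exp (-c * s ^ 2)) =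
      (((κ / 2) ^ ν / 2 : ℝ) : ℂ) * c ^ (-((ν + 1 : ℝ) : ℂ)) *
        ((-κ ^ 2 / (4 * c)) ^ k / (k.factorial : ℂ)) := by
    intro k c hc
    have hc0 := ne_zero_of_re_pos hc
    rw [integral_const_mul, integral_rpow_mul_cexp_neg_mul_sq (by linarith [hk k]) hc,
      show (2 * (ν + k) + 1 + 1) / 2 = ν + k + 1 by ring]
    have e1 : c ^ (-((ν + k + 1 : ℝ) : ℂ)) = c ^ (-((ν + 1 : ℝ) : ℂ)) * (c ^ k)⁻¹ := by
      rw [← Complex.cpow_natCast, ← Complex.cpow_neg, ← Complex.cpow_add _ _ hc0]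
      congr 1
      push_cast
      ring
    have e2 : (κ / 2) ^ (ν + 2 * k) = (κ / 2) ^ ν * (κ ^ 2 / 4) ^ k := by
      rw [Real.rpow_add (by positivity), Real.rpow_mul (by positivity), Real.rpow_natCast,
        Real.rpow_two]
      congr 2
      ring
    rw [e1, hw]
    simp only [e2]
    have h1 : ((Real.Gamma (ν + k + 1) : ℝ) : ℂ) ≠ 0 := by exact_mod_cast (hG k).ne'
    have h2 : ((k.factorial : ℕ) : ℂ) ≠ 0 := by exact_mod_cast k.factorial_ne_zero
    have e3 : (-(κ : ℂ) ^ 2 / (4 * c)) ^ k = (-1) ^ k * ((κ : ℂ) ^ 2 / 4) ^ k * (c ^ k)⁻¹ := by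
      rw [← inv_pow, ← mul_pow, ← mul_pow]
      congr 1
      field_simp
    rw [e3]
    push_cast
    field_simp
  -- Taking absolute values replaces `c` by `Re c` and removes the sign `(-1) ^ k`, so the `L¹`
  -- norms are again terms of an exponential series and term-by-term integration is legitimate.
  have hnorm : ∀ k, ∫ s in Set.Ioi (0 : ℝ), ‖F k s‖ =
      ‖(((κ / 2) ^ ν / 2 : ℝ) : ℂ) * (c.re : ℂ) ^ (-((ν + 1 : ℝ) : ℂ))‖ *
        (‖-(κ : ℂ) ^ 2 / (4 * (c.re : ℂ))‖ ^ k / (k.factorial : ℝ)) := by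
    intro k
    have h1 : ((∫ s in Set.Ioi (0 : ℝ), ‖F k s‖ : ℝ) : ℂ) = (-1) ^ k *
        ∫ s in Set.Ioi (0 : ℝ), (w k : ℂ) *
          (((s ^ (2 * (ν + k) + 1) : ℝ) : ℂ) * Complex.exp (-(c.re : ℂ) * s ^ 2)) := by
      rw [← integral_complex_ofReal, ← integral_const_mul]
      refine setIntegral_congr_fun measurableSet_Ioi fun s hs => ?_
      have hs : 0 < s := hs
      have hwk : |w k| = (-1) ^ k * w k := by
        have : 0 ≤ (-1) ^ k * w k := by
          simp only [hw]
          rw [← mul_assoc, ← mul_div_assoc, ← mul_pow]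
          have := hG k
          norm_num
          positivity
        rw [← abs_of_nonneg this, abs_mul ((-1) ^ k) (w k), abs_pow, abs_neg, abs_one, one_pow, one_mul]
      simp only [hF]
      rw [norm_mul, norm_mul, Complex.norm_real, Real.norm_eq_abs, hwk, Complex.norm_real,
        Real.norm_of_nonneg (by positivity), norm_cexp_neg_mul_sq]
      push_cast
      ring
    have h2 := congrArg norm h1
    rw [hval k _ (by simpa using hc), Complex.norm_real, Real.norm_of_nonneg
      (integral_nonneg fun s => norm_nonneg _)] at h2
    rw [h2]
    simp
  have hsum : Summable fun k => ∫ s in Set.Ioi (0 : ℝ), ‖F k s‖ := by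
    simp only [hnorm]
    exact (Real.summable_pow_div_factorial _).mul_left _
  have h := hasSum_integral_of_summable_integral_norm hint hsum
  have h1 : ∫ s in Set.Ioi (0 : ℝ), ∑' k, F k s = ∫ s in Set.Ioi (0 : ℝ),
      (besselJ ν (κ * s) : ℂ) * (((s ^ (ν + 1) : ℝ) : ℂ) * Complex.exp (-c * s ^ 2)) :=
    setIntegral_congr_fun measurableSet_Ioi fun s hs => (hterm s hs).tsum_eq
  rw [h1] at h
  refine h.unique ?_
  have h2 := (NormedSpace.expSeries_div_hasSum_exp (-(κ : ℂ) ^ 2 / (4 * c))).mul_left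
    ((((κ / 2) ^ ν / 2 : ℝ) : ℂ) * c ^ (-((ν + 1 : ℝ) : ℂ)))
  rw [← Complex.exp_eq_exp_ℂ] at h2
  refine h2.congr_fun fun k => ?_
  exact hval k c hc

end Bessel

/-! ### The modes of the Schrödinger kernel -/

section Kernel

theorem order_natCast (ρ : ℝ) (j : ℕ) : order ρ (j : ℤ) = j / ρ := by
  simp [order]

theorem norm_I_cpow_ofReal (x : ℝ) : ‖Complex.I ^ (x : ℂ)‖ = 1 := by
  rw [Complex.norm_cpow_real, Complex.norm_I, Real.one_rpow]

theorem abs_circleCos_le (ρ : ℝ) (j : ℕ) (θ : AddCircle (2 * Real.pi * ρ)) :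
    |circleCos ρ j θ| ≤ 1 := by
  induction θ using QuotientAddGroup.induction_on with
  | H z => exact Real.abs_cos_le_one _

theorem circleCos_neg (ρ : ℝ) (j : ℕ) (θ : AddCircle (2 * Real.pi * ρ)) :
    circleCos ρ j (-θ) = circleCos ρ j θ := by
  induction θ using QuotientAddGroup.induction_on with
  | H z =>
    change Real.cos (j / ρ * -z) = Real.cos (j / ρ * z)
    rw [mul_neg, Real.cos_neg]

/-- Symmetry without conjugation lets the kernel act on either factor of a bilinear pairing. -/
theorem schrodingerKernel_symm (ρ t : ℝ) (p q : Polar ρ) :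
    schrodingerKernel ρ t p q = schrodingerKernel ρ t q p := by
  have h : ∀ j x, modeTerm ρ x (p.2 - q.2) j = modeTerm ρ x (q.2 - p.2) j := by
    intro j x
    rw [modeTerm, modeTerm, ← neg_sub, circleCos_neg]
  simp only [schrodingerKernel, h, mul_comm p.1, add_comm ((p.1 : ℂ) ^ 2)]

variable {ρ : ℝ} [Fact (0 < ρ)]

theorem two_mul_circleCos (j : ℕ) (θ : AddCircle (2 * Real.pi * ρ)) :
    2 * (circleCos ρ j θ : ℂ) = fourier (j : ℤ) θ + fourier (-(j : ℤ)) θ := by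
  have h1 : (ρ : ℂ) ≠ 0 := by exact_mod_cast (Fact.out : 0 < ρ).ne'
  have h2 : (Real.pi : ℂ) ≠ 0 := by exact_mod_cast Real.pi_ne_zero
  induction θ using QuotientAddGroup.induction_on with
  | H z =>
    change 2 * ((Real.cos (j / ρ * z) : ℝ) : ℂ) = fourier (j : ℤ) (z : AddCircle (2 * Real.pi * ρ)) +
      fourier (-(j : ℤ)) (z : AddCircle (2 * Real.pi * ρ))
    rw [fourier_coe_apply, fourier_coe_apply, Complex.ofReal_cos, Complex.two_cos]
    congr 2 <;> · push_cast; field_simp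

theorem summable_rpow_neg_order : Summable fun m : ℤ => (2 : ℝ) ^ (-order ρ m) := by
  have hρ : 0 < ρ := Fact.out
  have h : Summable fun j : ℕ => (2 : ℝ) ^ (-order ρ (j : ℤ)) := by
    have e : ∀ j : ℕ, (2 : ℝ) ^ (-order ρ (j : ℤ)) = ((2 : ℝ) ^ (-ρ⁻¹)) ^ j := by
      intro j
      rw [order_natCast, ← Real.rpow_natCast, ← Real.rpow_mul zero_le_two]
      congr 1
      ring
    simp only [e]
    exact summable_geometric_of_lt_one (by positivity)
      (Real.rpow_lt_one_of_one_lt_of_neg one_lt_two (by simpa using hρ))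
  refine Summable.of_nat_of_neg h ?_
  simpa only [order_neg] using h

theorem summable_rpow_neg_order_add_one :
    Summable fun j : ℕ => (2 : ℝ) ^ (-(((j + 1 : ℕ) : ℝ) / ρ)) := by
  have h := (summable_rpow_neg_order (ρ := ρ)).comp_injective
    (i := fun j : ℕ => ((j + 1 : ℕ) : ℤ)) (fun a b h => by simpa using h)
  simpa only [Function.comp_def, order_natCast] using h

theorem norm_modeTerm_le {x : ℝ} (hx : 0 < x) (η : AddCircle (2 * Real.pi * ρ)) (j : ℕ) :
    ‖modeTerm ρ x η j‖ ≤ 2 ^ (-((j : ℝ) / ρ)) * Real.exp (2 * x) := by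
  have hρ : 0 < ρ := Fact.out
  rw [modeTerm, norm_mul, norm_mul, norm_I_cpow_ofReal, one_mul, Complex.norm_real,
    Complex.norm_real, Real.norm_eq_abs, Real.norm_eq_abs]
  exact (mul_le_of_le_one_right (abs_nonneg _) (abs_circleCos_le _ _ _)).trans
    (abs_besselJ_le (by positivity) hx)

theorem summable_modeTerm {x : ℝ} (hx : 0 < x) (η : AddCircle (2 * Real.pi * ρ)) :
    Summable fun j : ℕ => modeTerm ρ x η (j + 1) :=
  Summable.of_norm_bounded (summable_rpow_neg_order_add_one.mul_right _)
    fun j => norm_modeTerm_le hx η (j + 1)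

/-- The scalar factor of the Schrödinger kernel. -/
def kernelFactor (ρ t r s : ℝ) : ℂ :=
  -(Complex.exp (((r : ℂ) ^ 2 + (s : ℂ) ^ 2) / (4 * Complex.I * t)) /
    (4 * Real.pi * Complex.I * ρ * t))

/-- The component of the Schrödinger kernel in a given angular frequency. -/
def kernelMode (ρ t : ℝ) (m : ℤ) (p q : Polar ρ) : ℂ :=
  kernelFactor ρ t p.1 q.1 * (Complex.I ^ ((order ρ m : ℝ) : ℂ) *
    (besselJ (order ρ m) (p.1 * q.1 / (2 * t)) : ℂ) * fourier m (p.2 - q.2))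

/-- Since `1 / (4 i t) = -i / (4 t)`, the exponential is a product of two quadratic phases; the one
in `s` merely shifts the width of a Gaussian by `i / (4 t)`. -/
theorem kernelFactor_eq {t : ℝ} (ht : 0 < t) (r s : ℝ) :
    kernelFactor ρ t r s = Complex.I / (4 * Real.pi * ρ * t : ℝ) *
      (Complex.exp (-((1 / (4 * t) : ℝ) * Complex.I) * r ^ 2) *
        Complex.exp (-((1 / (4 * t) : ℝ) * Complex.I) * s ^ 2)) := by
  have h1 : (ρ : ℂ) ≠ 0 := by exact_mod_cast (Fact.out : 0 < ρ).ne'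
  have h2 : (Real.pi : ℂ) ≠ 0 := by exact_mod_cast Real.pi_ne_zero
  have h3 : (t : ℂ) ≠ 0 := by exact_mod_cast ht.ne'
  have e : ((r : ℂ) ^ 2 + (s : ℂ) ^ 2) / (4 * Complex.I * t) =
      -((1 / (4 * t) : ℝ) * Complex.I) * r ^ 2 + -((1 / (4 * t) : ℝ) * Complex.I) * s ^ 2 := by
    push_cast
    field_simp
    linear_combination ((r : ℂ) ^ 2 + (s : ℂ) ^ 2) * Complex.I_sq
  rw [kernelFactor, e, Complex.exp_add]
  push_cast
  field_simp
  rw [Complex.I_sq]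

theorem norm_kernelFactor {t : ℝ} (ht : 0 < t) (r s : ℝ) :
    ‖kernelFactor ρ t r s‖ = 1 / (4 * Real.pi * ρ * t) := by
  have hρ : 0 < ρ := Fact.out
  have hpi := Real.pi_pos
  rw [kernelFactor_eq ht, norm_mul, norm_mul, norm_cexp_neg_mul_sq, norm_cexp_neg_mul_sq, norm_div,
    Complex.norm_I, Complex.norm_real, Real.norm_of_nonneg (by positivity)]
  simp

variable {t : ℝ}

theorem norm_kernelMode_le (ht : 0 < t) (m : ℤ) {p q : Polar ρ} (hp : p ∈ cone ρ)
    (hq : q ∈ cone ρ) :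
    ‖kernelMode ρ t m p q‖ ≤
      1 / (4 * Real.pi * ρ * t) * (2 ^ (-order ρ m) * Real.exp (p.1 / t * q.1)) := by
  have hp' : 0 < p.1 := hp
  have hq' : 0 < q.1 := hq
  have hρ : 0 < ρ := Fact.out
  have hpi := Real.pi_pos
  rw [kernelMode, norm_mul, norm_kernelFactor ht, norm_mul, norm_mul, norm_I_cpow_ofReal, one_mul,
    norm_fourier_apply, mul_one, Complex.norm_real, Real.norm_eq_abs]
  have h := abs_besselJ_le (order_nonneg ρ m) (by positivity : 0 < p.1 * q.1 / (2 * t))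
  rw [show 2 * (p.1 * q.1 / (2 * t)) = p.1 / t * q.1 by field_simp] at h
  gcongr

theorem summable_kernelMode (ht : 0 < t) {p q : Polar ρ} (hp : p ∈ cone ρ) (hq : q ∈ cone ρ) :
    Summable fun m => kernelMode ρ t m p q :=
  Summable.of_norm_bounded ((summable_rpow_neg_order.mul_right _).mul_left _)
    fun m => norm_kernelMode_le ht m hp hq

/-- The frequencies `m` and `-m` have the same order and combine into twice a cosine; the frequency
`0` stands alone. -/
theorem hasSum_kernelMode (ht : 0 < t) {p q : Polar ρ} (hp : p ∈ cone ρ) (hq : q ∈ cone ρ) :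
    HasSum (fun m => kernelMode ρ t m p q) (schrodingerKernel ρ t p q) := by
  have hp' : 0 < p.1 := hp
  have hq' : 0 < q.1 := hq
  have hx : 0 < p.1 * q.1 / (2 * t) := by positivity
  have hs := summable_kernelMode ht hp hq
  have h1 : Summable fun j : ℕ => kernelMode ρ t ((j : ℤ) + 1) p q :=
    hs.comp_injective (i := fun j : ℕ => (j : ℤ) + 1) fun a b h => by simpa using h
  have h2 : Summable fun j : ℕ => kernelMode ρ t (-((j : ℤ) + 1)) p q :=
    hs.comp_injective (i := fun j : ℕ => -((j : ℤ) + 1)) fun a b h => by simpa using h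
  have h := HasSum.of_add_one_of_neg_add_one (f := fun m => kernelMode ρ t m p q)
    h1.hasSum h2.hasSum
  convert h using 1
  have e : ∀ j : ℕ, kernelMode ρ t ((j : ℤ) + 1) p q + kernelMode ρ t (-((j : ℤ) + 1)) p q =
      kernelFactor ρ t p.1 q.1 *
        (2 * modeTerm ρ (p.1 * q.1 / (2 * t)) (p.2 - q.2) (j + 1)) := by
    intro j
    have e1 := two_mul_circleCos (ρ := ρ) (j + 1) (p.2 - q.2)
    have e2 : order ρ ((j : ℤ) + 1) = ((j + 1 : ℕ) : ℝ) / ρ := by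
      rw [← order_natCast, Nat.cast_succ]
    rw [kernelMode, kernelMode, order_neg, e2, modeTerm]
    push_cast at e1 ⊢
    linear_combination -kernelFactor ρ t p.1 q.1 * Complex.I ^ (((j : ℂ) + 1) / ρ) *
      (besselJ ((j + 1) / ρ) (p.1 * q.1 / (2 * t)) : ℂ) * e1
  have e0 : kernelMode ρ t 0 p q = kernelFactor ρ t p.1 q.1 *
      (besselJ 0 (p.1 * q.1 / (2 * t)) : ℂ) := by
    simp [kernelMode, order]
  rw [add_right_comm, ← h1.tsum_add h2, e0]
  simp only [e, tsum_mul_left]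
  rw [schrodingerKernel, kernelFactor]
  ring

theorem exists_norm_schrodingerKernel_le (ht : 0 < t) : ∃ C : ℝ, 0 ≤ C ∧ ∀ p ∈ cone ρ,
    ∀ q ∈ cone ρ, ‖schrodingerKernel ρ t p q‖ ≤ C * Real.exp (p.1 / t * q.1) := by
  have hρ : 0 < ρ := Fact.out
  have hpi := Real.pi_pos
  refine ⟨1 / (4 * Real.pi * ρ * t) * ∑' m : ℤ, 2 ^ (-order ρ m),
    mul_nonneg (by positivity) (tsum_nonneg fun m => by positivity), fun p hp q hq => ?_⟩
  rw [← (hasSum_kernelMode ht hp hq).tsum_eq]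
  refine tsum_of_norm_bounded ?_ fun m => norm_kernelMode_le ht m hp hq
  rw [mul_assoc (1 / (4 * Real.pi * ρ * t))]
  exact ((summable_rpow_neg_order (ρ := ρ)).hasSum.mul_right _).mul_left _

theorem continuousOn_kernelMode (ht : 0 < t) (m : ℤ) :
    ContinuousOn (fun z : Polar ρ × Polar ρ => kernelMode ρ t m z.1 z.2)
      (cone ρ ×ˢ cone ρ) := by
  have h1 : Continuous fun z : Polar ρ × Polar ρ => kernelFactor ρ t z.1.1 z.2.1 := by
    unfold kernelFactor
    fun_prop
  have h0 : Continuous fun z : Polar ρ × Polar ρ => z.1.1 * z.2.1 / (2 * t) := by fun_prop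
  have h2 : ContinuousOn (fun z : Polar ρ × Polar ρ =>
      besselJ (order ρ m) (z.1.1 * z.2.1 / (2 * t))) (cone ρ ×ˢ cone ρ) := by
    refine (continuousOn_besselJ (order_nonneg ρ m)).comp h0.continuousOn fun z hz => ?_
    have h1 : 0 < z.1.1 := hz.1
    have h2 : 0 < z.2.1 := hz.2
    exact div_pos (mul_pos h1 h2) (by positivity)
  have h3 : Continuous fun z : Polar ρ × Polar ρ => fourier m (z.1.2 - z.2.2) :=
    (map_continuous (fourier m)).comp
      ((continuous_snd.comp continuous_fst).sub (continuous_snd.comp continuous_snd))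
  exact h1.continuousOn.mul ((continuousOn_const.mul
    (Complex.continuous_ofReal.comp_continuousOn h2)).mul h3.continuousOn)

theorem continuousOn_schrodingerKernel (ht : 0 < t) :
    ContinuousOn (fun z : Polar ρ × Polar ρ => schrodingerKernel ρ t z.1 z.2)
      (cone ρ ×ˢ cone ρ) := by
  have hρ : 0 < ρ := Fact.out
  have hpi := Real.pi_pos
  rintro ⟨p₀, q₀⟩ hz
  set M := p₀.1 / t * q₀.1 + 1 with hM
  -- On this neighbourhood the exponential in the bound for the modes is at most `exp M`, which
  -- gives a uniform summable majorant.
  set O : Set (Polar ρ × Polar ρ) := {z | z.1.1 / t * z.2.1 < M} with hO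
  have hOo : IsOpen O := isOpen_lt (by fun_prop) continuous_const
  have hsub : ContinuousOn (fun z : Polar ρ × Polar ρ => ∑' m, kernelMode ρ t m z.1 z.2)
      ((cone ρ ×ˢ cone ρ) ∩ O) := by
    refine continuousOn_tsum (u := fun m => 1 / (4 * Real.pi * ρ * t) *
      (2 ^ (-order ρ m) * Real.exp M)) (fun m => (continuousOn_kernelMode ht m).mono Set.inter_subset_left)
      ((summable_rpow_neg_order.mul_right _).mul_left _) fun m z hz => ?_
    refine (norm_kernelMode_le ht m hz.1.1 hz.1.2).trans ?_
    have := (show z.1.1 / t * z.2.1 < M from hz.2).le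
    gcongr
  have hK : ContinuousOn (fun z : Polar ρ × Polar ρ => schrodingerKernel ρ t z.1 z.2)
      ((cone ρ ×ˢ cone ρ) ∩ O) :=
    hsub.congr fun z hz => (hasSum_kernelMode ht hz.1.1 hz.1.2).tsum_eq.symm
  have hmem : (p₀, q₀) ∈ O := by simp [hO, hM]
  exact (hK.continuousAt ((((isOpen_cone).prod isOpen_cone).inter hOo).mem_nhds
    ⟨hz, hmem⟩)).continuousWithinAt

end Kernel

/-! ### The Schrödinger kernel acts on Gaussians -/

section GaussianTransform

variable {ρ : ℝ}

theorem fourier_sub_apply (m : ℤ) (θ η : AddCircle (2 * Real.pi * ρ)) :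
    fourier m (θ - η) = fourier m θ * fourier (-m) η := by
  rw [fourier_apply, fourier_apply, fourier_apply, smul_sub, neg_smul, sub_eq_add_neg,
    AddCircle.toCircle_add, Circle.coe_mul]

/-- Completing the square: half of the Gaussian decay absorbs the exponential growth of the kernel.
-/
theorem exp_mul_norm_gauss_le {ν : ℝ} {n : ℤ} {a : ℂ} (ha : 0 < a.re) (R : ℝ) {p : Polar ρ}
    (hp : p ∈ cone ρ) :
    Real.exp (R * p.1) * ‖gauss ρ ν n a p‖ ≤
      Real.exp (R ^ 2 / (2 * a.re)) * ‖gauss ρ ν n (a / 2) p‖ := by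
  have hp' : 0 < p.1 := hp
  rw [norm_gauss hp, norm_gauss hp, mul_left_comm, mul_left_comm (Real.exp (R ^ 2 / _)),
    ← Real.exp_add, ← Real.exp_add]
  have e : (a / 2).re = a.re / 2 := by simp
  have h : R * p.1 ≤ R ^ 2 / (2 * a.re) + a.re / 2 * p.1 ^ 2 := by
    have : R ^ 2 / (2 * a.re) + a.re / 2 * p.1 ^ 2 - R * p.1 =
        (R - a.re * p.1) ^ 2 / (2 * a.re) := by
      field_simp
      ring
    have h2 : 0 ≤ (R - a.re * p.1) ^ 2 / (2 * a.re) := by positivity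
    linarith
  rw [e]
  have : R * p.1 + -a.re * p.1 ^ 2 ≤ R ^ 2 / (2 * a.re) + -(a.re / 2) * p.1 ^ 2 := by
    linarith
  gcongr

variable [Fact (0 < ρ)]

theorem integral_fourier_sub_mul_fourier (m n : ℤ) (θ : AddCircle (2 * Real.pi * ρ)) :
    ∫ η, fourier m (θ - η) * fourier n η =
      if m = n then ((2 * Real.pi * ρ : ℝ) : ℂ) * fourier n θ else 0 := by
  simp only [fourier_sub_apply, mul_assoc, ← fourier_add]
  rw [integral_const_mul, integral_fourier]
  by_cases h : m = n
  · subst h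
    rw [if_pos (neg_add_cancel m), if_pos rfl, mul_comm]
    simp only [mul_assoc]
  · rw [if_neg (by omega), if_neg h, mul_zero]

theorem integrable_exp_mul_norm_gauss {ν : ℝ} (hν : -2 < ν) (n : ℤ) {a : ℂ} (ha : 0 < a.re)
    (R : ℝ) :
    Integrable (fun p => Real.exp (R * p.1) * ‖gauss ρ ν n a p‖) (coneMeasure ρ) := by
  have ha' : 0 < (a / 2).re := by simpa using ha
  refine ((integrable_gauss (ρ := ρ) hν (n := n) ha').norm.const_mul
    (Real.exp (R ^ 2 / (2 * a.re)))).mono' ?_ ?_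
  · exact AEStronglyMeasurable.mul (Measurable.aestronglyMeasurable (by fun_prop))
      aestronglyMeasurable_gauss.norm
  · filter_upwards [ae_cone] with p hp
    rw [Real.norm_of_nonneg (by positivity)]
    exact exp_mul_norm_gauss_le ha R hp

theorem coneMeasure_restrict_cone : (coneMeasure ρ).restrict (cone ρ) = coneMeasure ρ :=
  Measure.restrict_eq_self_of_ae_mem ae_cone

theorem coneMeasure_prod_restrict_cone :
    ((coneMeasure ρ).prod (coneMeasure ρ)).restrict (cone ρ ×ˢ cone ρ) =
      (coneMeasure ρ).prod (coneMeasure ρ) := by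
  rw [← Measure.prod_restrict, coneMeasure_restrict_cone]

variable {t : ℝ}

theorem aestronglyMeasurable_kernelMode (ht : 0 < t) (m : ℤ) {p : Polar ρ} (hp : p ∈ cone ρ) :
    AEStronglyMeasurable (kernelMode ρ t m p) (coneMeasure ρ) := by
  rw [← coneMeasure_restrict_cone]
  refine ContinuousOn.aestronglyMeasurable ?_ isOpen_cone.measurableSet
  exact (continuousOn_kernelMode ht m).comp (f := fun q => (p, q)) (by fun_prop)
    fun q hq => ⟨hp, hq⟩

theorem ofReal_mul_I_cpow {g : ℝ} (hg : 0 < g) (s : ℝ) :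
    ((g : ℂ) * Complex.I) ^ (s : ℂ) = ((g ^ s : ℝ) : ℂ) * Complex.I ^ (s : ℂ) := by
  have hg' : (g : ℂ) ≠ 0 := by exact_mod_cast hg.ne'
  rw [Complex.cpow_def_of_ne_zero (mul_ne_zero hg' Complex.I_ne_zero),
    Complex.log_ofReal_mul hg Complex.I_ne_zero, add_mul, Complex.exp_add,
    Complex.cpow_def_of_ne_zero Complex.I_ne_zero, Real.rpow_def_of_pos hg]
  push_cast
  rfl

/-- The arguments are `π / 2` and some angle in `(-π / 2, π / 2)`, so their sum does not cross the
branch cut. -/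
theorem log_ofReal_mul_I_mul {g : ℝ} (hg : 0 < g) {b : ℂ} (hb : 0 < b.re) :
    Complex.log ((g : ℂ) * Complex.I * b) = Complex.log ((g : ℂ) * Complex.I) + Complex.log b := by
  have hg' : (g : ℂ) ≠ 0 := by exact_mod_cast hg.ne'
  rw [Complex.log_mul_eq_add_log_iff (mul_ne_zero hg' Complex.I_ne_zero) (ne_zero_of_re_pos hb),
    Complex.arg_real_mul _ hg, Complex.arg_I]
  have h := abs_lt.1 (Complex.abs_arg_lt_pi_div_two_iff.2 (Or.inl hb))
  have := Real.pi_pos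
  constructor <;> linarith [h.1, h.2]

theorem cpow_mul_cpow_inv_add {g : ℝ} (hg : 0 < g) {b b' : ℂ} (hb : 0 < b.re) (hb' : 0 < b'.re)
    (h : b * (b⁻¹ + g * Complex.I) = g * Complex.I * b') (s : ℂ) :
    b ^ s * (b⁻¹ + g * Complex.I) ^ s = (g * Complex.I) ^ s * b' ^ s := by
  have hg' : (g : ℂ) * Complex.I ≠ 0 :=
    mul_ne_zero (by exact_mod_cast hg.ne') Complex.I_ne_zero
  have hc : 0 < (b⁻¹ + g * Complex.I).re := by simpa using inv_re_pos hb
  have e := log_mul_of_re_pos hb hc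
  rw [h, log_ofReal_mul_I_mul hg hb'] at e
  rw [Complex.cpow_def_of_ne_zero (ne_zero_of_re_pos hb),
    Complex.cpow_def_of_ne_zero (ne_zero_of_re_pos hc), Complex.cpow_def_of_ne_zero hg',
    Complex.cpow_def_of_ne_zero (ne_zero_of_re_pos hb'), ← Complex.exp_add, ← Complex.exp_add,
    ← add_mul, ← add_mul, e]

theorem integral_kernelMode_mul_gauss_of_ne {m n : ℤ} (hmn : m ≠ n) (ν : ℝ) (a : ℂ)
    (p : Polar ρ) :
    ∫ q, kernelMode ρ t m p q * gauss ρ ν n a q ∂coneMeasure ρ = 0 := by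
  have e : ∀ q, kernelMode ρ t m p q * gauss ρ ν n a q =
      (kernelFactor ρ t p.1 q.1 * (Complex.I ^ ((order ρ m : ℝ) : ℂ) *
        (besselJ (order ρ m) (p.1 * q.1 / (2 * t)) : ℂ)) *
          (((q.1 ^ ν : ℝ) : ℂ) * Complex.exp (-a * q.1 ^ 2))) *
        (fourier m (p.2 - q.2) * fourier n q.2) := by
    intro q
    rw [kernelMode, gauss]
    ring
  simp only [e, coneMeasure_eq]
  rw [integral_prod_mul (fun r : ℝ => kernelFactor ρ t p.1 r * (Complex.I ^ ((order ρ m : ℝ) : ℂ) *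
        (besselJ (order ρ m) (p.1 * r / (2 * t)) : ℂ)) *
          (((r ^ ν : ℝ) : ℂ) * Complex.exp (-a * r ^ 2)))
    (fun η => fourier m (p.2 - η) * fourier n η), integral_fourier_sub_mul_fourier, if_neg hmn,
    mul_zero]

/-- With `g = 1 / (4 t)` the phase changes the width `b⁻¹` into `c = b⁻¹ + i g`, and Weber's
integral with `κ = r / (2 t)`, where `r` is the radius of `p`, returns a Gaussian in `r`. The factor
`i ^ ν` in the kernel is what cancels the phase of `(i g) ^ (-ν - 1)`. -/
theorem integral_kernelMode_mul_gauss (ht : 0 < t) (n : ℤ) {b : ℂ} (hb : 0 < b.re)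
    {p : Polar ρ} (hp : p ∈ cone ρ) :
    b ^ (-((order ρ n + 1 : ℝ) : ℂ)) *
        ∫ q, kernelMode ρ t n p q * gauss ρ (order ρ n) n b⁻¹ q ∂coneMeasure ρ =
      (b - 4 * Complex.I * t) ^ (-((order ρ n + 1 : ℝ) : ℂ)) *
        gauss ρ (order ρ n) n (b - 4 * Complex.I * t)⁻¹ p := by
  have hp' : 0 < p.1 := hp
  have hρ : 0 < ρ := Fact.out
  have hpi := Real.pi_pos
  set ν := order ρ n with hν
  have hν0 : 0 ≤ ν := order_nonneg ρ n
  set g : ℝ := 1 / (4 * t) with hg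
  have hg0 : 0 < g := by positivity
  set b' := b - 4 * Complex.I * t with hb'
  have hb'0 : 0 < b'.re := by simpa [hb'] using hb
  set c := b⁻¹ + g * Complex.I with hc
  have hc0 : 0 < c.re := by simpa [hc] using inv_re_pos hb
  have nb := ne_zero_of_re_pos hb
  have nb' := ne_zero_of_re_pos hb'0
  have nc := ne_zero_of_re_pos hc0
  have nt : (t : ℂ) ≠ 0 := by exact_mod_cast ht.ne'
  have nρ : (ρ : ℂ) ≠ 0 := by exact_mod_cast hρ.ne'
  have npi : (Real.pi : ℂ) ≠ 0 := by exact_mod_cast hpi.ne'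
  -- All the algebra rests on this relation between the width `c` and the translated parameter `b'`.
  have hbc : b * c = g * Complex.I * b' := by
    rw [hc, hb', hg]
    push_cast
    field_simp
    linear_combination (4 * t : ℂ) * Complex.I_sq
  have hκ : 0 < p.1 / (2 * t) := by positivity
  have e : ∀ q, kernelMode ρ t n p q * gauss ρ ν n b⁻¹ q =
      (kernelFactor ρ t p.1 q.1 * (Complex.I ^ ((ν : ℝ) : ℂ) *
        (besselJ ν (p.1 * q.1 / (2 * t)) : ℂ)) *
          (((q.1 ^ ν : ℝ) : ℂ) * Complex.exp (-b⁻¹ * q.1 ^ 2))) *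
        (fourier n (p.2 - q.2) * fourier n q.2) := by
    intro q
    rw [kernelMode, gauss]
    ring
  have hrad : ∫ r, (kernelFactor ρ t p.1 r * (Complex.I ^ ((ν : ℝ) : ℂ) *
        (besselJ ν (p.1 * r / (2 * t)) : ℂ)) *
          (((r ^ ν : ℝ) : ℂ) * Complex.exp (-b⁻¹ * r ^ 2))) ∂radialMeasure =
      Complex.I / (4 * Real.pi * ρ * t : ℝ) * Complex.exp (-(g * Complex.I) * p.1 ^ 2) *
        Complex.I ^ ((ν : ℝ) : ℂ) * ((((p.1 / (2 * t) / 2) ^ ν / 2 : ℝ) : ℂ) *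
          c ^ (-((ν + 1 : ℝ) : ℂ)) *
          Complex.exp (-((p.1 / (2 * t) : ℝ) : ℂ) ^ 2 / (4 * c))) := by
    rw [← integral_besselJ_mul_gaussian hν0 hκ hc0, ← integral_const_mul, integral_radialMeasure]
    refine setIntegral_congr_fun measurableSet_Ioi fun s hs => ?_
    have hs : 0 < s := hs
    rw [kernelFactor_eq ht, ← hg, hc, neg_add, add_mul (-b⁻¹), Complex.exp_add, Real.rpow_add hs,
      Real.rpow_one, show p.1 / (2 * t) * s = p.1 * s / (2 * t) by ring]
    push_cast
    ring
  simp only [e, coneMeasure_eq]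
  rw [integral_prod_mul (fun r : ℝ => kernelFactor ρ t p.1 r * (Complex.I ^ ((ν : ℝ) : ℂ) *
        (besselJ ν (p.1 * r / (2 * t)) : ℂ)) *
          (((r ^ ν : ℝ) : ℂ) * Complex.exp (-b⁻¹ * r ^ 2)))
    (fun η => fourier n (p.2 - η) * fourier n η), integral_fourier_sub_mul_fourier, if_pos rfl,
    hrad]
  have hcp := cpow_mul_cpow_inv_add hg0 hb hb'0 hbc (-((ν + 1 : ℝ) : ℂ))
  rw [← hc] at hcp
  -- From `c⁻¹ = b / (i g b')`, the total width is `i g (1 - b / b') = 4 g t / b' = 1 / b'`.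
  have hexp : Complex.exp (-(g * Complex.I) * p.1 ^ 2) *
      Complex.exp (-((p.1 / (2 * t) : ℝ) : ℂ) ^ 2 / (4 * c)) =
        Complex.exp (-b'⁻¹ * p.1 ^ 2) := by
    rw [← Complex.exp_add]
    congr 1
    have hc1 : c⁻¹ = b / (g * Complex.I * b') := by
      rw [← hbc]
      field_simp
    have ng : (g : ℂ) ≠ 0 := by exact_mod_cast hg0.ne'
    have hbe : b = b' + 4 * Complex.I * t := by rw [hb']; ring
    rw [div_eq_mul_inv, mul_inv, hc1, hg]
    push_cast
    field_simp
    rw [hbe]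
    linear_combination (-(p.1 : ℂ) ^ 2 * b' * 4) * Complex.I_sq
  -- The extra factor `i g` is the product of the constant `i / (4 π ρ t)` of the kernel, the `1 /
  -- 2` of Weber's integral and the length `2 π ρ` of the circle.
  have hpow : (g * Complex.I) ^ (-((ν + 1 : ℝ) : ℂ)) * Complex.I ^ ((ν : ℝ) : ℂ) *
      (((p.1 / (2 * t) / 2) ^ ν : ℝ) : ℂ) * (g * Complex.I) = ((p.1 ^ ν : ℝ) : ℂ) := by
    have ng : (g : ℂ) * Complex.I ≠ 0 :=
      mul_ne_zero (by exact_mod_cast hg0.ne') Complex.I_ne_zero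
    have h1 : p.1 / (2 * t) / 2 = p.1 * g := by
      rw [hg]
      field_simp
      norm_num
    have h2 : (g * Complex.I) ^ (-((ν + 1 : ℝ) : ℂ)) * (g * Complex.I) *
        (g * Complex.I) ^ ((ν : ℝ) : ℂ) = 1 := by
      nth_rewrite 2 [← Complex.cpow_one ((g : ℂ) * Complex.I)]
      rw [← Complex.cpow_add _ _ ng, ← Complex.cpow_add _ _ ng]
      convert Complex.cpow_zero _
      push_cast
      ring
    rw [ofReal_mul_I_cpow hg0 ν] at h2
    rw [h1, Real.mul_rpow hp'.le hg0.le]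
    push_cast at h2 ⊢
    linear_combination ((p.1 ^ ν : ℝ) : ℂ) * h2
  rw [gauss, ← hexp, ← hpow]
  have hgt : (g : ℂ) = 1 / (4 * t) := by
    rw [hg]
    push_cast
    rfl
  calc _ = (b ^ (-((ν + 1 : ℝ) : ℂ)) * c ^ (-((ν + 1 : ℝ) : ℂ))) *
        (Complex.I / (4 * Real.pi * ρ * t : ℝ) * (1 / 2) * (2 * Real.pi * ρ : ℝ)) *
        Complex.I ^ ((ν : ℝ) : ℂ) * (((p.1 / (2 * t) / 2) ^ ν : ℝ) : ℂ) *
        (Complex.exp (-(g * Complex.I) * p.1 ^ 2) *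
          Complex.exp (-((p.1 / (2 * t) : ℝ) : ℂ) ^ 2 / (4 * c))) * fourier n p.2 := by
        push_cast
        ring
    _ = _ := by
        have : Complex.I / (4 * Real.pi * ρ * t : ℝ) * (1 / 2) * (2 * Real.pi * ρ : ℝ) =
            g * Complex.I := by
          rw [hgt]
          push_cast
          field_simp
        rw [hcp, this]
        ring

/-- The Schrödinger kernel maps a Gaussian packet to a Gaussian packet. -/
theorem integral_schrodingerKernel_mul_gauss (ht : 0 < t) (n : ℤ) {b : ℂ} (hb : 0 < b.re)
    {p : Polar ρ} (hp : p ∈ cone ρ) :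
    b ^ (-((order ρ n + 1 : ℝ) : ℂ)) *
        ∫ q, schrodingerKernel ρ t p q * gauss ρ (order ρ n) n b⁻¹ q ∂coneMeasure ρ =
      (b - 4 * Complex.I * t) ^ (-((order ρ n + 1 : ℝ) : ℂ)) *
        gauss ρ (order ρ n) n (b - 4 * Complex.I * t)⁻¹ p := by
  rw [← integral_kernelMode_mul_gauss ht n hb hp]
  congr 1
  have hρ : 0 < ρ := Fact.out
  have hpi := Real.pi_pos
  set G := gauss ρ (order ρ n) n b⁻¹ with hG
  have hν := order_nonneg ρ n
  -- One majorant serves all modes; the coefficients `2 ^ (-order ρ m)` make the `L¹` norms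
  -- summable, so integral and sum may be exchanged.
  set D : Polar ρ → ℝ := fun q => Real.exp (p.1 / t * q.1) * ‖G q‖ with hD
  have iD : Integrable D (coneMeasure ρ) :=
    integrable_exp_mul_norm_gauss (by linarith) n (inv_re_pos hb) _
  have hle : ∀ m, ∀ᵐ q ∂coneMeasure ρ, ‖kernelMode ρ t m p q * G q‖ ≤
      1 / (4 * Real.pi * ρ * t) * 2 ^ (-order ρ m) * D q := by
    intro m
    filter_upwards [ae_cone] with q hq
    rw [norm_mul]
    refine (mul_le_mul_of_nonneg_right (norm_kernelMode_le ht m hp hq) (norm_nonneg _)).trans_eq ?_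
    simp only [hD]
    ring
  have hint : ∀ m, Integrable (fun q => kernelMode ρ t m p q * G q) (coneMeasure ρ) := fun m =>
    (iD.const_mul _).mono' ((aestronglyMeasurable_kernelMode ht m hp).mul
      aestronglyMeasurable_gauss) (hle m)
  have hsum : Summable fun m => ∫ q, ‖kernelMode ρ t m p q * G q‖ ∂coneMeasure ρ := by
    refine Summable.of_nonneg_of_le (fun m => integral_nonneg fun q => norm_nonneg _) (fun m => ?_)
      (((summable_rpow_neg_order (ρ := ρ)).mul_left (1 / (4 * Real.pi * ρ * t))).mul_right
        (∫ q, D q ∂coneMeasure ρ))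
    rw [← integral_const_mul]
    exact integral_mono_ae (hint m).norm (iD.const_mul _) (hle m)
  have h := hasSum_integral_of_summable_integral_norm hint hsum
  have h1 : ∫ q, ∑' m, kernelMode ρ t m p q * G q ∂coneMeasure ρ =
      ∫ q, schrodingerKernel ρ t p q * G q ∂coneMeasure ρ := by
    refine integral_congr_ae ?_
    filter_upwards [ae_cone] with q hq
    rw [tsum_mul_right, (hasSum_kernelMode ht hp hq).tsum_eq]
  rw [h1] at h
  exact h.unique (hasSum_single n fun m hm => integral_kernelMode_mul_gauss_of_ne hm _ _ _)

end GaussianTransform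

/-! ### The Schwartz kernel of the propagator -/

section SchwartzKernel

variable {ρ : ℝ} [Fact (0 < ρ)] {t : ℝ}

theorem locallyIntegrableOn_schrodingerKernel (ht : 0 < t) :
    LocallyIntegrableOn (fun z : Polar ρ × Polar ρ => schrodingerKernel ρ t z.1 z.2)
      (cone ρ ×ˢ cone ρ) ((coneMeasure ρ).prod (coneMeasure ρ)) :=
  (continuousOn_schrodingerKernel ht).locallyIntegrableOn
    (isOpen_cone.prod isOpen_cone).measurableSet

theorem aestronglyMeasurable_schrodingerKernel (ht : 0 < t) :
    AEStronglyMeasurable (fun z : Polar ρ × Polar ρ => schrodingerKernel ρ t z.1 z.2)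
      ((coneMeasure ρ).prod (coneMeasure ρ)) := by
  rw [← coneMeasure_prod_restrict_cone]
  exact (continuousOn_schrodingerKernel ht).aestronglyMeasurable
    (isOpen_cone.prod isOpen_cone).measurableSet

theorem ae_cone_prod :
    ∀ᵐ z ∂(coneMeasure ρ).prod (coneMeasure ρ), z.1 ∈ cone ρ ∧ z.2 ∈ cone ρ :=
  (Measure.quasiMeasurePreserving_fst.ae ae_cone).and
    (Measure.quasiMeasurePreserving_snd.ae ae_cone)

/-- The test function bounds the second radius by some `B`, so the kernel grows at most like `exp (B
r / t)` in the first radius, and the hypothesis on `g` absorbs this. -/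
theorem integrable_schrodingerKernel_mul (ht : 0 < t) {φ g : Polar ρ → ℂ}
    (hφ : IsTestFunction ρ φ) (hgm : AEStronglyMeasurable g (coneMeasure ρ))
    (hg : ∀ R, Integrable (fun p => Real.exp (R * p.1) * ‖g p‖) (coneMeasure ρ)) :
    Integrable (fun z : Polar ρ × Polar ρ => schrodingerKernel ρ t z.1 z.2 * (g z.1 * φ z.2))
      ((coneMeasure ρ).prod (coneMeasure ρ)) := by
  obtain ⟨C, hC0, hC⟩ := exists_norm_schrodingerKernel_le (ρ := ρ) ht
  obtain ⟨A, B, hA, hAB, hz⟩ := hφ.exists_bounds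
  have hφi : Integrable φ (coneMeasure ρ) :=
    hφ.continuous.integrable_of_hasCompactSupport hφ.compact
  refine (((hg (B / t)).mul_prod hφi.norm).const_mul C).mono'
    ((aestronglyMeasurable_schrodingerKernel ht).mul (hgm.comp_fst.mul hφi.1.comp_snd)) ?_
  filter_upwards [ae_cone_prod] with z hzc
  rw [norm_mul, norm_mul]
  by_cases h0 : B ≤ z.2.1
  · rw [hz _ (Or.inr h0)]
    simp
  · have h1 : 0 < z.1.1 := hzc.1
    have h2 : Real.exp (z.1.1 / t * z.2.1) ≤ Real.exp (B / t * z.1.1) := by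
      rw [Real.exp_le_exp, div_mul_eq_mul_div, div_mul_eq_mul_div]
      have : z.1.1 * z.2.1 ≤ B * z.1.1 := by
        rw [mul_comm B]
        exact mul_le_mul_of_nonneg_left (not_le.1 h0).le h1.le
      gcongr
    calc _ ≤ C * Real.exp (z.1.1 / t * z.2.1) * (‖g z.1‖ * ‖φ z.2‖) :=
          mul_le_mul_of_nonneg_right (hC _ hzc.1 _ hzc.2) (by positivity)
      _ ≤ C * Real.exp (B / t * z.1.1) * (‖g z.1‖ * ‖φ z.2‖) := by gcongr
      _ = _ := by ring

theorem IsTestFunction.integrable_exp_mul_norm {ψ : Polar ρ → ℂ} (h : IsTestFunction ρ ψ)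
    (R : ℝ) : Integrable (fun p => Real.exp (R * p.1) * ‖ψ p‖) (coneMeasure ρ) := by
  refine Continuous.integrable_of_hasCompactSupport ?_ h.compact.norm.mul_left
  exact Continuous.mul (by fun_prop) h.continuous.norm

theorem IsUnitaryGroupOf.inner_apply {H : Type*} [NormedAddCommGroup H] [InnerProductSpace ℂ H]
    {U : ℝ → H ≃ₗᵢ[ℂ] H} {A : Set (H × H)} (hU : IsUnitaryGroupOf U A) (t : ℝ) (x y : H) :
    (inner ℂ x (U t y) : ℂ) = inner ℂ (U (-t) x) y := by
  rw [← (U (-t)).inner_map_map x (U t y), ← hU.map_add, neg_add_cancel, hU.map_zero]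

theorem conj_cpow_ofReal {b : ℂ} (hb : 0 < b.re) (s : ℝ) :
    conj (b ^ (s : ℂ)) = conj b ^ (s : ℂ) := by
  have h := abs_lt.1 (Complex.abs_arg_lt_pi_div_two_iff.2 (Or.inl hb))
  have := Real.pi_pos
  rw [Complex.conj_cpow _ _ (by linarith), Complex.conj_ofReal]

theorem inner_packet_left (u : L2 ρ) {ν : ℝ} (hν : 0 ≤ ν) (n : ℤ) {b : ℂ} (hb : 0 < b.re) :
    (inner ℂ (packet ρ ν n b) u : ℂ) = conj b ^ (-((ν + 1 : ℝ) : ℂ)) *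
      ∫ p, u p * gauss ρ ν (-n) (conj b)⁻¹ p ∂coneMeasure ρ := by
  rw [packet, inner_smul_left, inner_gaussL2_left _ hν n (inv_re_pos hb), map_inv₀,
    ← Complex.ofReal_neg, conj_cpow_ofReal hb]

/-- The pairing of a propagated function with a Gaussian. -/
theorem integral_propagator_mul_gauss {U : ℝ → L2 ρ ≃ₗᵢ[ℂ] L2 ρ} {A : Set (L2 ρ × L2 ρ)}
    (hU : IsUnitaryGroupOf U A)
    (hUp : ∀ t n b, 0 < b.re → U t (packet ρ (order ρ n) n b) =
      packet ρ (order ρ n) n (b - 4 * Complex.I * t)) (u : L2 ρ) (t : ℝ) (n : ℤ) {b : ℂ}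
    (hb : 0 < b.re) :
    b ^ (-((order ρ n + 1 : ℝ) : ℂ)) *
        ∫ p, U t u p * gauss ρ (order ρ n) n b⁻¹ p ∂coneMeasure ρ =
      (b - 4 * Complex.I * t) ^ (-((order ρ n + 1 : ℝ) : ℂ)) *
        ∫ p, u p * gauss ρ (order ρ n) n (b - 4 * Complex.I * t)⁻¹ p ∂coneMeasure ρ := by
  have hb' : 0 < (conj b).re := by simpa using hb
  have e : conj (conj b - 4 * Complex.I * (-t : ℝ)) = b - 4 * Complex.I * t := by
    have h4 : conj (4 : ℂ) = 4 := Complex.conj_ofNat 4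
    simp only [map_sub, map_mul, h4, Complex.conj_I, Complex.conj_conj, Complex.conj_ofReal]
    push_cast
    ring
  have hb'' : 0 < (conj b - 4 * Complex.I * (-t : ℝ)).re := by simpa using hb
  -- The inner product conjugates the packet: starting from frequency `-n`, parameter `conj b` and
  -- time `-t` gives the bilinear pairing with frequency `n`, parameter `b` and time `t`.
  have h := hU.inner_apply t (packet ρ (order ρ (-n)) (-n) (conj b)) u
  rw [hUp _ _ _ hb', order_neg, inner_packet_left _ (order_nonneg ρ n) _ hb',
    inner_packet_left _ (order_nonneg ρ n) _ hb'', e, Complex.conj_conj, neg_neg] at h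
  exact h

variable {U : ℝ → L2 ρ ≃ₗᵢ[ℂ] L2 ρ} {A : Set (L2 ρ × L2 ρ)}

/-- Both sides have the same integrals against the packets: the propagator because it is transposed
onto them, the kernel because it maps packets to packets. The integral on the right is not known in
advance to be in `L²`, so totality is applied in the weighted `L¹` form. -/
theorem propagator_ae_eq (hU : IsUnitaryGroupOf U A)
    (hUp : ∀ t n b, 0 < b.re → U t (packet ρ (order ρ n) n b) =
      packet ρ (order ρ n) n (b - 4 * Complex.I * t)) (ht : 0 < t) {φ : Polar ρ → ℂ}
    (hφ : IsTestFunction ρ φ) {u : L2 ρ} (hu : u =ᵐ[coneMeasure ρ] φ) :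
    U t u =ᵐ[coneMeasure ρ] fun p => ∫ q, schrodingerKernel ρ t p q * φ q ∂coneMeasure ρ := by
  set h : Polar ρ → ℂ := fun p => ∫ q, schrodingerKernel ρ t p q * φ q ∂coneMeasure ρ with hh
  have hjoint : ∀ (ν : ℝ) (n : ℤ) (a : ℂ), 0 ≤ ν → 0 < a.re →
      Integrable (fun z : Polar ρ × Polar ρ =>
        schrodingerKernel ρ t z.1 z.2 * (gauss ρ ν n a z.1 * φ z.2))
      ((coneMeasure ρ).prod (coneMeasure ρ)) := fun ν n a hν ha =>
    integrable_schrodingerKernel_mul ht hφ aestronglyMeasurable_gauss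
      fun R => integrable_exp_mul_norm_gauss (by linarith) n ha R
  have hinner : ∀ (g : Polar ρ → ℂ) p, ∫ q, schrodingerKernel ρ t p q * (g p * φ q)
      ∂coneMeasure ρ = h p * g p := by
    intro g p
    rw [hh, ← integral_mul_const]
    congr 1
    funext q
    ring
  have hhi : ∀ (ν : ℝ) (n : ℤ) (a : ℂ), 0 ≤ ν → 0 < a.re →
      Integrable (fun p => h p * gauss ρ ν n a p) (coneMeasure ρ) := by
    intro ν n a hν ha
    have := (hjoint ν n a hν ha).integral_prod_left
    simpa only [hinner] using this
  have hpair : ∀ n b, 0 < b.re → b ^ (-((order ρ n + 1 : ℝ) : ℂ)) *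
        ∫ p, h p * gauss ρ (order ρ n) n b⁻¹ p ∂coneMeasure ρ =
      (b - 4 * Complex.I * t) ^ (-((order ρ n + 1 : ℝ) : ℂ)) *
        ∫ p, u p * gauss ρ (order ρ n) n (b - 4 * Complex.I * t)⁻¹ p ∂coneMeasure ρ := by
    intro n b hb
    -- Fubini and the symmetry of the kernel move its action from `φ` to the packet.
    have e1 : ∫ p, h p * gauss ρ (order ρ n) n b⁻¹ p ∂coneMeasure ρ =
        ∫ q, φ q * ∫ p, schrodingerKernel ρ t q p * gauss ρ (order ρ n) n b⁻¹ p ∂coneMeasure ρ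
          ∂coneMeasure ρ := by
      have hj := hjoint (order ρ n) n b⁻¹ (order_nonneg ρ n) (inv_re_pos hb)
      calc _ = ∫ p, ∫ q, schrodingerKernel ρ t p q * (gauss ρ (order ρ n) n b⁻¹ p * φ q)
            ∂coneMeasure ρ ∂coneMeasure ρ := by simp only [hinner]
        _ = ∫ q, ∫ p, schrodingerKernel ρ t p q * (gauss ρ (order ρ n) n b⁻¹ p * φ q)
            ∂coneMeasure ρ ∂coneMeasure ρ := integral_integral_swap hj
        _ = _ := by
          congr 1
          funext q
          rw [← integral_const_mul]
          congr 1
          funext p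
          rw [schrodingerKernel_symm ρ t p q]
          ring
    rw [e1, ← integral_const_mul, ← integral_const_mul]
    refine integral_congr_ae ?_
    filter_upwards [hu, ae_cone] with q hq hqc
    rw [mul_left_comm, integral_schrodingerKernel_mul_gauss ht n hb hqc, hq, mul_left_comm]
  have hzero : (fun p => U t u p - h p) =ᵐ[coneMeasure ρ] 0 := by
    have hsub : ∀ (ν : ℝ) (n : ℤ) (a : ℂ), 0 ≤ ν → 0 < a.re →
        Integrable (fun p => (U t u p - h p) * gauss ρ ν n a p) (coneMeasure ρ) := by
      intro ν n a hν ha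
      simp only [sub_mul]
      exact (integrable_mul_gauss (Lp.memLp _) hν n ha).sub (hhi ν n a hν ha)
    refine ae_eq_zero_of_integral_gaussian (a := 1) (ν := order ρ) (fun n => ?_) fun n y => ?_
    · refine (hsub _ 0 1 (order_nonneg ρ n) (by simp)).congr (Eventually.of_forall fun p => ?_)
      simp [gauss]
    · have ha : 0 < ((1 : ℝ) + y * Complex.I : ℂ).re := by simp
      set b : ℂ := ((1 : ℝ) + y * Complex.I : ℂ)⁻¹ with hb
      have hb0 : 0 < b.re := inv_re_pos ha
      have e : ∀ p : Polar ρ, (U t u p - h p) * (((p.1 ^ order ρ n : ℝ) : ℂ) *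
          Complex.exp (-((1 : ℝ) + y * Complex.I) * p.1 ^ 2) * fourier n p.2) =
          U t u p * gauss ρ (order ρ n) n b⁻¹ p - h p * gauss ρ (order ρ n) n b⁻¹ p := by
        intro p
        rw [hb, inv_inv, gauss]
        ring
      simp only [e]
      rw [integral_sub (integrable_mul_gauss (Lp.memLp _) (order_nonneg ρ n) n (inv_re_pos hb0))
        (hhi _ n _ (order_nonneg ρ n) (inv_re_pos hb0)), sub_eq_zero]
      have h1 := (integral_propagator_mul_gauss hU hUp u t n hb0).trans (hpair n b hb0).symm
      refine mul_left_cancel₀ ?_ h1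
      rw [Complex.cpow_ne_zero_iff]
      exact Or.inl (ne_zero_of_re_pos hb0)
  filter_upwards [hzero] with p hp
  exact sub_eq_zero.1 hp

theorem integral_propagator_mul (hU : IsUnitaryGroupOf U A)
    (hUp : ∀ t n b, 0 < b.re → U t (packet ρ (order ρ n) n b) =
      packet ρ (order ρ n) n (b - 4 * Complex.I * t)) (ht : 0 < t) {φ ψ : Polar ρ → ℂ}
    (hφ : IsTestFunction ρ φ) (hψ : IsTestFunction ρ ψ) {u : L2 ρ}
    (hu : u =ᵐ[coneMeasure ρ] φ) :
    ∫ p, U t u p * ψ p ∂coneMeasure ρ =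
      ∫ z : Polar ρ × Polar ρ, schrodingerKernel ρ t z.1 z.2 * (ψ z.1 * φ z.2)
        ∂(coneMeasure ρ).prod (coneMeasure ρ) := by
  rw [integral_prod _ (integrable_schrodingerKernel_mul ht hφ hψ.continuous.aestronglyMeasurable
    hψ.integrable_exp_mul_norm)]
  refine integral_congr_ae ?_
  filter_upwards [propagator_ae_eq hU hUp ht hφ hu] with p hp
  rw [hp, ← integral_mul_const]
  congr 1
  funext q
  ring

theorem hasSchwartzKernel_propagator (hU : IsUnitaryGroupOf U A)
    (hUp : ∀ t n b, 0 < b.re → U t (packet ρ (order ρ n) n b) =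
      packet ρ (order ρ n) n (b - 4 * Complex.I * t)) (ht : 0 < t) :
    HasSchwartzKernel (U t) (schrodingerKernel ρ t) :=
  ⟨locallyIntegrableOn_schrodingerKernel ht, fun _ _ hφ hψ _ hu =>
    integral_propagator_mul hU hUp ht hφ hψ hu⟩

/-- Since `U (-t)` is the adjoint of `U t`, its kernel is the conjugate transpose, and the
transposition is undone by symmetry. -/
theorem hasSchwartzKernel_propagator_neg (hU : IsUnitaryGroupOf U A)
    (hUp : ∀ t n b, 0 < b.re → U t (packet ρ (order ρ n) n b) =
      packet ρ (order ρ n) n (b - 4 * Complex.I * t)) (ht : 0 < t) :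
    HasSchwartzKernel (U (-t)) fun p q => conj (schrodingerKernel ρ t p q) := by
  refine ⟨?_, fun φ ψ hφ hψ u hu => ?_⟩
  · exact ((Complex.continuous_conj.comp_continuousOn
      (continuousOn_schrodingerKernel ht)).locallyIntegrableOn
      (isOpen_cone.prod isOpen_cone).measurableSet)
  · set v : L2 ρ := hψ.conj.memLp.toLp _ with hv
    have cv : v =ᵐ[coneMeasure ρ] fun p => conj (ψ p) := MemLp.coeFn_toLp _
    have h := integral_propagator_mul hU hUp ht hψ.conj hφ.conj cv
    have h1 : ∫ p, U (-t) u p * ψ p ∂coneMeasure ρ = inner ℂ v (U (-t) u) := by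
      rw [L2.inner_def]
      refine integral_congr_ae ?_
      filter_upwards [cv] with p hp
      rw [hp, RCLike.inner_apply, Complex.conj_conj]
    have h2 : (inner ℂ (U t v) u : ℂ) = conj (∫ p, U t v p * conj (φ p) ∂coneMeasure ρ) := by
      rw [L2.inner_def, ← integral_conj]
      refine integral_congr_ae ?_
      filter_upwards [hu] with p hp
      rw [hp, RCLike.inner_apply, map_mul, Complex.conj_conj, mul_comm]
    rw [h1, hU.inner_apply, neg_neg, h2, h, ← integral_conj, ← integral_prod_swap]
    congr 1
    funext z
    simp only [Prod.fst_swap, Prod.snd_swap, map_mul, Complex.conj_conj]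
    rw [schrodingerKernel_symm ρ t z.2 z.1]
    ring

end SchwartzKernel

end FlatCone

end

/-- Let `0 < ρ` and let `Δ` be the Friedrichs Laplacian (with nonnegative spectrum) of the cone over
the circle of radius `ρ`.  The unitary group `U t = exp (i t Δ)` exists and is unique, and for
`0 < t` the propagator `U t` has the Schwartz kernel `schrodingerKernel ρ t`, whose series converges
absolutely at every pair of points; the propagator `U (-t)` has the complex conjugate kernel. -/
theorem mainTheorem3 (ρ : ℝ) [Fact (0 < ρ)] :
    ∃ U : ℝ → FlatCone.L2 ρ ≃ₗᵢ[ℂ] FlatCone.L2 ρ,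
      FlatCone.IsUnitaryGroupOf U (FlatCone.friedrichsLaplacian ρ) ∧
      (∀ V : ℝ → FlatCone.L2 ρ ≃ₗᵢ[ℂ] FlatCone.L2 ρ,
        FlatCone.IsUnitaryGroupOf V (FlatCone.friedrichsLaplacian ρ) → V = U) ∧
      ∀ t : ℝ, 0 < t →
        (∀ p ∈ FlatCone.cone ρ, ∀ q ∈ FlatCone.cone ρ,
          Summable fun j : ℕ =>
            FlatCone.modeTerm ρ (p.1 * q.1 / (2 * t)) (p.2 - q.2) (j + 1)) ∧
        FlatCone.HasSchwartzKernel (U t) (FlatCone.schrodingerKernel ρ t) ∧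
        FlatCone.HasSchwartzKernel (U (-t))
          (fun p q => conj (FlatCone.schrodingerKernel ρ t p q)) := by
  obtain ⟨U, hUp, hU⟩ := FlatCone.exists_packet_group (ρ := ρ)
  rw [FlatCone.friedrichsLaplacian_eq]
  refine ⟨U, hU, fun V hV => hU.unique hV FlatCone.dense_fst_adjoint_packetCore, fun t ht =>
    ⟨fun p hp q hq => FlatCone.summable_modeTerm ?_ _,
      FlatCone.hasSchwartzKernel_propagator hU hUp ht,
      FlatCone.hasSchwartzKernel_propagator_neg hU hUp ht⟩⟩
  exact div_pos (mul_pos hp hq) (by linarith)
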